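/- Let $k$ be a field of characteristic zero and $V$ a finite-dimensional $\mathbb Z$-graded $k$-vector space; put $V[1]^i=V^{i+1}$ and let $s:V[1]\to V$ be the identity viewed as a map of degree $1$. All signs follow the Koszul rule and $\operatorname{tr}$ is the graded trace (supertrace): in a homogeneous basis, $\operatorname{tr}_{m+1}(f)(x;y)=\sum_\alpha(-1)^{|e_\alpha|+|e_\alpha||y|}f(x,e_\alpha,y)^\alpha$ for $f$ with $m+1+n$ inputs, $x=(x_1,\dots,x_m)$, $y=(y_1,\dots,y_n)$. An $A_\infty$-structure on $V$ is a family $\Gamma=\{\Gamma_n:V[1]^{\otimes n}\to V[1]\}_{n\ge1}$ of degree one maps with $[\Gamma,\Gamma]=0$ for the Gerstenhaber bracket. Let $\mathrm{Cyc}^p(V,k)$ be the space of families $Q=\{Q_{m,n}\}_{m+n\ge1}$ of degree $p$ linear maps $Q_{m,n}:(V[1]^{\otimes m})_{C_m}\otimes(V[1]^{\otimes n})_{C_n}\to k$, i.e. forms on $V[1]^{\otimes m}\otimes V[1]^{\otimes n}$ invariant under the (Koszul signed) cyclic permutations $\zeta$ of the first $m$ and $\xi$ of the last $n$ arguments ($C_0$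 is trivial). Put $$(Q\bullet\Gamma)_{m,n}=\sum_{i=1}^m\sum_{a=0}^{m-1}Q_{m-i+1,n}(\Gamma_i\otimes 1^{\otimes (m-i)}\otimes1^{\otimes n})\zeta^a+\sum_{i=1}^n\sum_{b=0}^{n-1}Q_{m,n-i+1}(1^{\otimes m}\otimes\Gamma_i\otimes1^{\otimes(n-i)})\xi^b ,$$ $\partial_\Gamma Q=[\Gamma,Q]=-(-1)^{|Q|}Q\bullet\Gamma$, and, for $m+n\ge1$, $$\Gamma^\circlearrowleft_{m,n}=\sum_{\sigma\in C_m}\sum_{\tau\in C_n}\operatorname{tr}_{m+1}(\Gamma_{m+1+n})\,\sigma\tau ,$$ the trace being taken on $V[1]$. A unimodular $A_\infty$-structure on $V$ (a representation of the minimal resolution of the wheeled operad of unimodular associative algebras) consists of a differential $d$ of degree $1$ on $V$, maps $\mu_n:V^{\otimes n}\to V$ of degree $2-n$ ($n\ge2$) and $q_{m,n}:V^{\otimes m}\otimes V^{\otimes n}\to k$ of degree $-m-n$ ($m+n\ge1$) such that $q_{m,n}(-1)^{m+1}\zeta=q_{m,n}$ if $m\ge1$, $q_{m,n}(-1)^{n+1}\xi=q_{m,n}$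 if $n\ge1$, $$\partial\mu_n=\sum_{j=2}^{n-1}\sum_{i=0}^{n-j}(-1)^{ij+i+j+1+n}\mu_{n-j+1}(1^{\otimes i}\otimes\mu_j\otimes1^{\otimes(n-i-j)}),$$ $$\begin{aligned}\partial q_{m,n}=&\sum_{i=2}^m\sum_{a=0}^{m-1}(-1)^{i+m+n+1}q_{m-i+1,n}(\mu_i\otimes1^{\otimes(m-i)}\otimes1^{\otimes n})((-1)^{m+1}\zeta)^a\\&+\sum_{i=2}^n\sum_{b=0}^{n-1}(-1)^{im+n}q_{m,n-i+1}(1^{\otimes m}\otimes\mu_i\otimes1^{\otimes(n-i)})((-1)^{n+1}\xi)^b\\&+\sum_{a=0}^{\max(m,1)-1}\ \sum_{b=0}^{\max(n,1)-1}\operatorname{tr}_{m+1}(\mu_{m+1+n})((-1)^{m+1}\zeta)^a((-1)^{n+1}\xi)^b,\end{aligned}$$ where $\partial$ is the differential induced by $d$ on multilinear maps. It extends $\Gamma$ if $\Gamma_1=s^{-1}ds$ and $\Gamma_n=s^{-1}\mu_ns^{\otimes n}$ for $n\ge2$. **Proposition.** For every $A_\infty$-structure $\Gamma$ on $V$, the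 element $\Gamma^\circlearrowleft$ lies in $\mathrm{Cyc}^1(V,k)$ and $\partial_\Gamma\Gamma^\circlearrowleft=0$. Its class in $H^1(\mathrm{Cyc}(V,k),\partial_\Gamma)$ vanishes if and only if there is a unimodular $A_\infty$-structure on $V$ that extends $\Gamma$. -/

import Mathlib

noncomputable section

namespace UnimodAInf

open scoped BigOperators

/-! ### Graded vector spaces, multilinear maps and Koszul signs

A graded vector space is a vector space `V` with a decomposition `𝒱 : ℤ → Submodule k V`.  Its
shift `V[1]` has the same underlying space, and `V[1]^i = V^{i+1}`; the degree one map
`s : V[1] → V` is the identity of the underlying space. -/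

theorem plug_update_inl {V : Type*} {o κ ι : Type} [DecidableEq o] [DecidableEq ι] (s : o) (α : o → ι)
    (β : κ → ι) (hb : Function.Bijective (Sum.elim (fun p : {p : o // p ≠ s} => α p.1) β))
    (x : ι → V) (p : {p : o // p ≠ s}) (v w : V) :
    (Function.update x (α p.1) v) ∘ β = x ∘ β ∧
      Function.update ((Function.update x (α p.1) v) ∘ α) s w =
        Function.update (Function.update (x ∘ α) s w) p.1 v := by
  constructor
  · funext q
    have h : β q ≠ α p.1 := fun h => by
      have := @hb.1 (Sum.inr q) (Sum.inl p) (by simpa using h)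
      cases this
    simp [Function.update_of_ne h]
  · funext r
    by_cases hr : r = s
    · subst hr
      simp [Function.update_of_ne (Ne.symm p.2)]
    · by_cases hrp : r = p.1
      · subst hrp
        simp [Function.update_of_ne p.2]
      · have h : α r ≠ α p.1 := fun h => by
          have := @hb.1 (Sum.inl ⟨r, hr⟩) (Sum.inl p) (by simpa using h)
          exact hrp (congrArg Subtype.val (Sum.inl.inj this))
        simp [Function.update_of_ne hr, Function.update_of_ne hrp, Function.update_of_ne h]

theorem plug_update_inr {V : Type*} {o κ ι : Type} [DecidableEq o] [DecidableEq κ] [DecidableEq ι] (s : o)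
    (α : o → ι) (β : κ → ι)
    (hb : Function.Bijective (Sum.elim (fun p : {p : o // p ≠ s} => α p.1) β))
    (x : ι → V) (q : κ) (v w : V) :
    (Function.update x (β q) v) ∘ β = Function.update (x ∘ β) q v ∧
      Function.update ((Function.update x (β q) v) ∘ α) s w = Function.update (x ∘ α) s w := by
  constructor
  · have hβ : Function.Injective β := fun a b h => by
      have := @hb.1 (Sum.inr a) (Sum.inr b) (by simpa using h)
      exact Sum.inr.inj this
    exact Function.update_comp_eq_of_injective x hβ q v
  · funext r
    by_cases hr : r = s
    · subst hr; simp
    · have h : α r ≠ β q := fun h => by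
        have := @hb.1 (Sum.inl ⟨r, hr⟩) (Sum.inr q) (by simpa using h)
        cases this
      simp [Function.update_of_ne hr, Function.update_of_ne h]

section Graded

variable {k V W : Type*} [Field k] [AddCommGroup V] [Module k V] [AddCommGroup W] [Module k W]

/-- Linear maps `V^{⊗ι} → W`. -/
abbrev Multi (k V : Type*) [Field k] [AddCommGroup V] [Module k V] (ι : Type) (W : Type*)
    [AddCommGroup W] [Module k W] : Type _ :=
  MultilinearMap k (fun _ : ι => V) W

/-- The grading of the shifted space `V[1]`. -/
def shift (𝒱 : ℤ → Submodule k V) : ℤ → Submodule k V := fun i => 𝒱 (i + 1)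

theorem shift_isInternal (𝒱 : ℤ → Submodule k V) (h : DirectSum.IsInternal 𝒱) :
    DirectSum.IsInternal (shift 𝒱) := by
  rw [DirectSum.isInternal_submodule_iff_iSupIndep_and_iSup_eq_top] at h ⊢
  refine ⟨h.1.comp (add_left_injective (1 : ℤ)), ?_⟩
  rw [← h.2]
  exact (Equiv.addRight (1 : ℤ)).iSup_comp (g := 𝒱)

instance shiftDecomposition (𝒱 : ℤ → Submodule k V) [DirectSum.Decomposition 𝒱] :
    DirectSum.Decomposition (shift 𝒱) :=
  (shift_isInternal 𝒱 (DirectSum.Decomposition.isInternal 𝒱)).chooseDecomposition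

/-- The projection of `V` onto the sum of the `V^i` with `i` of parity `ε`. -/
def parityProj (𝒱 : ℤ → Submodule k V) [DirectSum.Decomposition 𝒱] (ε : ZMod 2) : V →ₗ[k] V :=
  DirectSum.toModule k ℤ V (fun i => if (i : ZMod 2) = ε then (𝒱 i).subtype else 0) ∘ₗ
    (DirectSum.decomposeLinearEquiv 𝒱).toLinearMap

theorem parityProj_of_mem (𝒱 : ℤ → Submodule k V) [DirectSum.Decomposition 𝒱] (ε : ZMod 2)
    {i : ℤ} {x : V} (hx : x ∈ 𝒱 i) :
    parityProj 𝒱 ε x = if (i : ZMod 2) = ε then x else 0 := by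
  simp only [parityProj, LinearMap.comp_apply, LinearEquiv.coe_coe,
    DirectSum.decomposeLinearEquiv_apply, DirectSum.decompose_of_mem 𝒱 hx]
  erw [DirectSum.toModule_lof]
  split_ifs <;> simp

/-- `(-1)^a` for a parity `a`. -/
def sgn (k : Type*) [Field k] (a : ZMod 2) : k := if a = 0 then 1 else -1

/-- Multiplication of a multilinear map by a sign that depends on the parities of its arguments:
on homogeneous arguments `x` the value is `(-1)^{e(|x|)} f(x)`. -/
def twist (𝒱 : ℤ → Submodule k V) [DirectSum.Decomposition 𝒱] {ι : Type} [Fintype ι]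
    [DecidableEq ι] (e : (ι → ZMod 2) → ZMod 2) : Multi k V ι W →ₗ[k] Multi k V ι W :=
  ∑ ε : ι → ZMod 2,
    sgn k (e ε) • MultilinearMap.compLinearMapₗ (fun i => parityProj 𝒱 (ε i))

theorem twist_apply_of_mem (𝒱 : ℤ → Submodule k V) [DirectSum.Decomposition 𝒱] {ι : Type}
    [Fintype ι] [DecidableEq ι] (e : (ι → ZMod 2) → ZMod 2) (f : Multi k V ι W)
    (a : ι → ℤ) (x : ι → V) (hx : ∀ i, x i ∈ 𝒱 (a i)) :
    twist 𝒱 e f x = sgn k (e (fun i => (a i : ZMod 2))) • f x := by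
  simp only [twist, LinearMap.sum_apply, LinearMap.smul_apply, sum_apply,
    smul_apply, MultilinearMap.compLinearMapₗ_apply,
    MultilinearMap.compLinearMap_apply]
  rw [Finset.sum_eq_single (fun i => (a i : ZMod 2))]
  · congr 2
    funext i
    simp [parityProj_of_mem 𝒱 _ (hx i)]
  · intro ε _ hε
    obtain ⟨i, hi⟩ := Function.ne_iff.mp hε
    rw [f.map_coord_zero i, smul_zero]
    rw [parityProj_of_mem 𝒱 _ (hx i), if_neg (fun h => hi h.symm)]
  · simp

/-- `f : V^{⊗ι} → V` is homogeneous of degree `p`. -/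
def HasDegree (𝒱 : ℤ → Submodule k V) {ι : Type} [Fintype ι] (p : ℤ) (f : Multi k V ι V) : Prop :=
  ∀ (a : ι → ℤ) (x : ι → V), (∀ i, x i ∈ 𝒱 (a i)) → f x ∈ 𝒱 ((∑ i, a i) + p)

/-- `f : V^{⊗ι} → k` is homogeneous of degree `p`, where `k` sits in degree zero. -/
def FormHasDegree (𝒱 : ℤ → Submodule k V) {ι : Type} [Fintype ι] (p : ℤ)
    (f : Multi k V ι k) : Prop :=
  ∀ (a : ι → ℤ) (x : ι → V), (∀ i, x i ∈ 𝒱 (a i)) → (∑ i, a i) + p ≠ 0 → f x = 0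

/-! ### Composition -/

/-- Unsigned composition: the output of `g` is put into the slot `s` of `f`.  The other slots
`p` of `f` receive the arguments `x (α p)`, and `g` receives the arguments `x (β q)`. -/
def plug {o κ ι : Type} [DecidableEq o] (f : Multi k V o W) (s : o) (g : Multi k V κ V)
    (α : o → ι) (β : κ → ι)
    (hb : Function.Bijective (Sum.elim (fun p : {p : o // p ≠ s} => α p.1) β)) :
    Multi k V ι W where
  toFun x := f (Function.update (x ∘ α) s (g (x ∘ β)))
  map_update_add' := by
    intro _ x c v w
    classical
    obtain ⟨z, rfl⟩ := hb.2 c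
    cases z with
    | inl p =>
      simp only [Sum.elim_inl]
      simp only [(plug_update_inl s α β hb x p _ (0 : V)).1,
        (plug_update_inl s α β hb x p _ _).2, f.map_update_add]
    | inr q =>
      simp only [Sum.elim_inr]
      simp only [(plug_update_inr s α β hb x q _ (0 : V)).1,
        (plug_update_inr s α β hb x q _ _).2, g.map_update_add, f.map_update_add]
  map_update_smul' := by
    intro _ x c v w
    classical
    obtain ⟨z, rfl⟩ := hb.2 c
    cases z with
    | inl p =>
      simp only [Sum.elim_inl]
      simp only [(plug_update_inl s α β hb x p _ (0 : V)).1,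
        (plug_update_inl s α β hb x p _ _).2, f.map_update_smul]
    | inr q =>
      simp only [Sum.elim_inr]
      simp only [(plug_update_inr s α β hb x q _ (0 : V)).1,
        (plug_update_inr s α β hb x q _ _).2, g.map_update_smul, f.map_update_smul]

/-- Slots of the outer map in `f(1^{⊗i} ⊗ g ⊗ 1^{⊗t})`, where `g` has `j + 1` inputs. -/
def outerIdx {n : ℕ} (j : Fin n) (i : Fin (n - j)) (p : Fin (n - j)) : Fin n :=
  if p.1 ≤ i.1 then ⟨p.1, by omega⟩ else ⟨p.1 + j.1, by omega⟩

/-- Slots of the inner map in `f(1^{⊗i} ⊗ g ⊗ 1^{⊗t})`, where `g` has `j + 1` inputs. -/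
def innerIdx {n : ℕ} (j : Fin n) (i : Fin (n - j)) (q : Fin (j.1 + 1)) : Fin n :=
  ⟨i.1 + q.1, by omega⟩

theorem insert_bijective {n : ℕ} (j : Fin n) (i : Fin (n - j)) :
    Function.Bijective (Sum.elim (fun p : {p : Fin (n - j) // p ≠ i} => outerIdx j i p.1)
      (innerIdx j i)) := by
  constructor
  · rintro (⟨p, hp⟩ | q) (⟨p', hp'⟩ | q') h
    all_goals
      simp only [Sum.elim_inl, Sum.elim_inr, outerIdx, innerIdx] at h
    · have hp1 : p.1 ≠ i.1 := fun h => hp (Fin.ext h)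
      have hp2 : p'.1 ≠ i.1 := fun h => hp' (Fin.ext h)
      have : p = p' := by
        split_ifs at h <;> simp only [Fin.mk.injEq] at h <;> apply Fin.ext <;> omega
      subst this; rfl
    · have hp1 : p.1 ≠ i.1 := fun h => hp (Fin.ext h)
      exfalso
      split_ifs at h <;> simp only [Fin.mk.injEq] at h <;> omega
    · have hp2 : p'.1 ≠ i.1 := fun h => hp' (Fin.ext h)
      exfalso
      split_ifs at h <;> simp only [Fin.mk.injEq] at h <;> omega
    · simp only [Fin.mk.injEq] at h
      exact congrArg Sum.inr (Fin.ext (by omega))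
  · intro c
    rcases lt_or_ge c.1 i.1 with h | h
    · refine ⟨Sum.inl ⟨⟨c.1, by omega⟩, fun e => ?_⟩, ?_⟩
      · have := congrArg Fin.val e
        simp at this; omega
      · simp only [Sum.elim_inl, outerIdx]
        rw [if_pos h.le]
    · rcases le_or_gt c.1 (i.1 + j.1) with h' | h'
      · refine ⟨Sum.inr ⟨c.1 - i.1, by omega⟩, ?_⟩
        simp only [Sum.elim_inr, innerIdx]
        apply Fin.ext
        simp only
        omega
      · refine ⟨Sum.inl ⟨⟨c.1 - j.1, by omega⟩, fun e => ?_⟩, ?_⟩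
        · have := congrArg Fin.val e
          simp at this; omega
        · simp only [Sum.elim_inl, outerIdx]
          rw [if_neg (by omega)]
          apply Fin.ext
          simp only
          omega

/-- `f(1^{⊗i} ⊗ g ⊗ 1^{⊗(n-i-j-1)})` with the Koszul sign rule, where `g` has `j + 1` inputs and
parity `c`: on homogeneous arguments the sign is `(-1)^{c(|x_1| + ⋯ + |x_i|)}`. -/
def insertOp (𝒱 : ℤ → Submodule k V) [DirectSum.Decomposition 𝒱] (c : ZMod 2) {n : ℕ} (j : Fin n)
    (i : Fin (n - j)) (f : Multi k V (Fin (n - j)) V) (g : Multi k V (Fin (j.1 + 1)) V) :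
    Multi k V (Fin n) V :=
  twist 𝒱 (fun ε => c * ∑ p : Fin n, if p.1 < i.1 then ε p else 0)
    (plug f i g (outerIdx j i) (innerIdx j i) (insert_bijective j i))

theorem insertLeft_bijective {m : ℕ} (n : ℕ) (i : Fin m) :
    Function.Bijective (Sum.elim
      (fun p : {p : Fin (m - i) ⊕ Fin n // p ≠ Sum.inl ⟨0, by omega⟩} =>
        Sum.map (outerIdx i ⟨0, by omega⟩) id p.1)
      (fun q : Fin (i.1 + 1) => (Sum.inl (innerIdx i ⟨0, by omega⟩ q) : Fin m ⊕ Fin n))) := by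
  have h := insert_bijective i ⟨0, by omega⟩
  constructor
  · rintro (⟨p | p, hp⟩ | q) (⟨p' | p', hp'⟩ | q') e
    all_goals simp only [Sum.elim_inl, Sum.elim_inr, Sum.map_inl, Sum.map_inr, Sum.inl.injEq,
      Sum.inr.injEq, id, reduceCtorEq] at e
    · have := @h.1 (Sum.inl ⟨p, fun e => hp (by rw [e])⟩) (Sum.inl ⟨p', fun e => hp' (by rw [e])⟩) e
      simpa using this
    · have := @h.1 (Sum.inl ⟨p, fun e => hp (by rw [e])⟩) (Sum.inr q') e
      cases this
    · subst e; rfl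
    · have := @h.1 (Sum.inr q) (Sum.inl ⟨p', fun e => hp' (by rw [e])⟩) e
      cases this
    · have := @h.1 (Sum.inr q) (Sum.inr q') e
      rw [Sum.inr.inj this]
  · rintro (c | c)
    · obtain ⟨⟨p, hp⟩ | q, e⟩ := h.2 c
      · exact ⟨Sum.inl ⟨Sum.inl p, fun e => hp (Sum.inl.inj e)⟩, by simpa using e⟩
      · exact ⟨Sum.inr q, by simpa using e⟩
    · exact ⟨Sum.inl ⟨Sum.inr c, by simp⟩, by simp⟩

theorem insertRight_bijective (m : ℕ) {n : ℕ} (i : Fin n) :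
    Function.Bijective (Sum.elim
      (fun p : {p : Fin m ⊕ Fin (n - i) // p ≠ Sum.inr ⟨0, by omega⟩} =>
        Sum.map id (outerIdx i ⟨0, by omega⟩) p.1)
      (fun q : Fin (i.1 + 1) => (Sum.inr (innerIdx i ⟨0, by omega⟩ q) : Fin m ⊕ Fin n))) := by
  have h := insert_bijective i ⟨0, by omega⟩
  constructor
  · rintro (⟨p | p, hp⟩ | q) (⟨p' | p', hp'⟩ | q') e
    all_goals simp only [Sum.elim_inl, Sum.elim_inr, Sum.map_inl, Sum.map_inr, Sum.inl.injEq,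
      Sum.inr.injEq, id, reduceCtorEq] at e
    · subst e; rfl
    · have := @h.1 (Sum.inl ⟨p, fun e => hp (by rw [e])⟩) (Sum.inl ⟨p', fun e => hp' (by rw [e])⟩) e
      simpa using this
    · have := @h.1 (Sum.inl ⟨p, fun e => hp (by rw [e])⟩) (Sum.inr q') e
      cases this
    · have := @h.1 (Sum.inr q) (Sum.inl ⟨p', fun e => hp' (by rw [e])⟩) e
      cases this
    · have := @h.1 (Sum.inr q) (Sum.inr q') e
      rw [Sum.inr.inj this]
  · rintro (c | c)
    · exact ⟨Sum.inl ⟨Sum.inl c, by simp⟩, by simp⟩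
    · obtain ⟨⟨p, hp⟩ | q, e⟩ := h.2 c
      · exact ⟨Sum.inl ⟨Sum.inr p, fun e => hp (Sum.inr.inj e)⟩, by simpa using e⟩
      · exact ⟨Sum.inr q, by simpa using e⟩

/-! ### Forms with two blocks of arguments -/

/-- Linear forms on `V^{⊗m} ⊗ V^{⊗n}`. -/
abbrev Form (k V : Type*) [Field k] [AddCommGroup V] [Module k V] (m n : ℕ) : Type _ :=
  Multi k V (Fin m ⊕ Fin n) k

/-- `q(g ⊗ 1^{⊗(m-i-1)} ⊗ 1^{⊗n})`: the map `g`, with `i + 1` inputs, is inserted into the first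
slot of the first block. -/
def insertLeft {m n : ℕ} (i : Fin m) (q : Form k V (m - i) n) (g : Multi k V (Fin (i.1 + 1)) V) :
    Form k V m n :=
  plug q (Sum.inl ⟨0, by omega⟩) g _ _ (insertLeft_bijective n i)

/-- `q(1^{⊗m} ⊗ g ⊗ 1^{⊗(n-i-1)})`: the map `g`, with `i + 1` inputs and parity `c`, is inserted
into the first slot of the second block; on homogeneous arguments the Koszul sign is
`(-1)^{c(|x_1| + ⋯ + |x_m|)}`. -/
def insertRight (𝒱 : ℤ → Submodule k V) [DirectSum.Decomposition 𝒱] (c : ZMod 2) {m n : ℕ}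
    (i : Fin n) (q : Form k V m (n - i)) (g : Multi k V (Fin (i.1 + 1)) V) : Form k V m n :=
  twist 𝒱 (fun ε => c * ∑ p : Fin m, ε (Sum.inl p))
    (plug q (Sum.inr ⟨0, by omega⟩) g _ _ (insertRight_bijective m i))

/-- The action of the cycle `ζ` on the first block, with the Koszul sign:
`(fζ)(x_1,…,x_m;y) = (-1)^{|x_1|(|x_2|+⋯+|x_m|)} f(x_2,…,x_m,x_1;y)`. -/
def rotLeft (𝒱 : ℤ → Submodule k V) [DirectSum.Decomposition 𝒱] (m n : ℕ) :
    Module.End k (Form k V m n) :=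
  twist 𝒱 (fun ε => ∑ p : Fin m, ∑ p' : Fin m,
      if p.1 = 0 ∧ 0 < p'.1 then ε (Sum.inl p) * ε (Sum.inl p') else 0) ∘ₗ
    (MultilinearMap.domDomCongrLinearEquiv k k V k
      (Equiv.sumCongr (finRotate m) (Equiv.refl (Fin n)))).toLinearMap

/-- The action of the cycle `ξ` on the second block, with the Koszul sign. -/
def rotRight (𝒱 : ℤ → Submodule k V) [DirectSum.Decomposition 𝒱] (m n : ℕ) :
    Module.End k (Form k V m n) :=
  twist 𝒱 (fun ε => ∑ p : Fin n, ∑ p' : Fin n,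
      if p.1 = 0 ∧ 0 < p'.1 then ε (Sum.inr p) * ε (Sum.inr p') else 0) ∘ₗ
    (MultilinearMap.domDomCongrLinearEquiv k k V k
      (Equiv.sumCongr (Equiv.refl (Fin m)) (finRotate n))).toLinearMap

/-- `(-1)^{m+1} ζ`. -/
def signedRotLeft (𝒱 : ℤ → Submodule k V) [DirectSum.Decomposition 𝒱] (m n : ℕ) :
    Module.End k (Form k V m n) := (-1 : k) ^ (m + 1) • rotLeft 𝒱 m n

/-- `(-1)^{n+1} ξ`. -/
def signedRotRight (𝒱 : ℤ → Submodule k V) [DirectSum.Decomposition 𝒱] (m n : ℕ) :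
    Module.End k (Form k V m n) := (-1 : k) ^ (n + 1) • rotRight 𝒱 m n

/-- The order of the cyclic group `C_n`, where `C_0` is the trivial group. -/
def cycOrder (n : ℕ) : ℕ := max n 1

/-! ### The trace -/

/-- The arguments `(x_1,…,x_m, v, y_1,…,y_n)`. -/
def slotArgs {m n : ℕ} (x : Fin m ⊕ Fin n → V) (v : V) : Fin (m + 1 + n) → V :=
  Fin.append (Fin.append (fun p => x (Sum.inl p)) (fun _ : Fin 1 => v)) (fun p => x (Sum.inr p))

/-- `Fin (m + 1 + n)` as the two blocks together with the middle slot. -/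
def slotEquiv (m n : ℕ) : Fin (m + 1 + n) ≃ (Fin m ⊕ Fin n) ⊕ Fin 1 :=
  finSumFinEquiv.symm.trans <| (Equiv.sumCongr finSumFinEquiv.symm (Equiv.refl (Fin n))).trans <|
    (Equiv.sumAssoc _ _ _).trans <|
      (Equiv.sumCongr (Equiv.refl _) (Equiv.sumComm _ _)).trans (Equiv.sumAssoc _ _ _).symm

/-- The trace over the slot `m + 1` of `f : V^{⊗(m+1+n)} → V`, i.e. the supertrace of the
endomorphism `v ↦ ± f(x,v,y)` where the sign is the Koszul sign `(-1)^{|v||y|}`.  In a homogeneous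
basis the value is `∑_α (-1)^{|e_α| + |e_α||y|} f(x,e_α,y)^α`. -/
def traceSlot (𝒱 : ℤ → Submodule k V) [DirectSum.Decomposition 𝒱] (m n : ℕ)
    (f : Multi k V (Fin (m + 1 + n)) V) : Form k V m n :=
  (LinearMap.trace k V ∘ₗ
      (MultilinearMap.ofSubsingletonₗ k k V V (0 : Fin 1)).symm.toLinearMap).compMultilinearMap
    (MultilinearMap.currySum
      ((twist 𝒱 (fun ε => ε ⟨m, by omega⟩ * (1 + ∑ p : Fin n, ε (Fin.natAdd (m + 1) p)))
        f).domDomCongr (slotEquiv m n)))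

theorem traceSlot_apply (𝒱 : ℤ → Submodule k V) [DirectSum.Decomposition 𝒱] (m n : ℕ)
    (f : Multi k V (Fin (m + 1 + n)) V) (x : Fin m ⊕ Fin n → V) (T : V →ₗ[k] V)
    (hT : ∀ v, T v = twist 𝒱
      (fun ε => ε ⟨m, by omega⟩ * (1 + ∑ p : Fin n, ε (Fin.natAdd (m + 1) p))) f
      (slotArgs x v)) :
    traceSlot 𝒱 m n f x = LinearMap.trace k V T := by
  simp only [traceSlot, LinearMap.compMultilinearMap_apply, LinearMap.comp_apply]
  congr 1
  ext v
  rw [hT]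
  simp only [LinearEquiv.coe_coe]
  change (twist 𝒱 _ f) _ = _
  congr 1
  funext p
  obtain ⟨z, rfl⟩ := (slotEquiv m n).symm.surjective p
  rw [Equiv.apply_symm_apply]
  rcases z with (z | z) | z <;> simp [slotEquiv, slotArgs]

/-! ### `A_∞`-structures on `V`, as elements of `C(V,V)` -/

/-- Families of maps `f_n : V[1]^{⊗n} → V[1]`.  Only the components with `n ≥ 1` play a role. -/
abbrev Cochain (k V : Type*) [Field k] [AddCommGroup V] [Module k V] : Type _ :=
  ∀ n : ℕ, Multi k V (Fin n) V

/-- The composition product `(f ∘ g)_n = ∑_{i,j} f_{n-j+1}(1^{⊗i} ⊗ g_j ⊗ 1^{⊗(n-i-j)})` on `V[1]`,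
for `g` of degree `q`.  The index `j` below is the number of inputs of `g` minus one. -/
def circ (𝒱 : ℤ → Submodule k V) [DirectSum.Decomposition 𝒱] (q : ℤ) (f g : Cochain k V) :
    Cochain k V := fun n =>
  ∑ j : Fin n, ∑ i : Fin (n - j),
    insertOp (shift 𝒱) (q : ZMod 2) j i (f (n - j)) (g (j.1 + 1))

/-- The Gerstenhaber bracket `[f,g] = f ∘ g - (-1)^{pq} g ∘ f` of elements of degrees `p`, `q`. -/
def gerstenhaber (𝒱 : ℤ → Submodule k V) [DirectSum.Decomposition 𝒱] (p q : ℤ)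
    (f g : Cochain k V) : Cochain k V :=
  circ 𝒱 q f g - sgn k ((p * q : ℤ) : ZMod 2) • circ 𝒱 p g f

/-- `Γ` is an `A_∞`-structure on `V`: a degree one element of `C(V,V)` with `[Γ,Γ] = 0`. -/
structure IsAInfinity (𝒱 : ℤ → Submodule k V) [DirectSum.Decomposition 𝒱]
    (Γ : Cochain k V) : Prop where
  degree : ∀ n, 1 ≤ n → HasDegree (shift 𝒱) 1 (Γ n)
  bracket_self : ∀ n, 1 ≤ n → gerstenhaber 𝒱 1 1 Γ Γ n = 0

/-! ### The complex `Cyc(V,k)` -/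

/-- Families of linear forms on `V[1]^{⊗m} ⊗ V[1]^{⊗n}`. -/
abbrev BiForm (k V : Type*) [Field k] [AddCommGroup V] [Module k V] : Type _ :=
  ∀ m n : ℕ, Form k V m n

/-- `Cyc^p(V,k)`: families, indexed by `m + n ≥ 1`, of degree `p` forms on
`(V[1]^{⊗m})_{C_m} ⊗ (V[1]^{⊗n})_{C_n}`, i.e. of forms on `V[1]^{⊗m} ⊗ V[1]^{⊗n}` that are
invariant under both cyclic groups. -/
def Cyc (𝒱 : ℤ → Submodule k V) [DirectSum.Decomposition 𝒱] (p : ℤ) :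
    Submodule k (BiForm k V) where
  carrier := {Q | Q 0 0 = 0 ∧ ∀ m n, FormHasDegree (shift 𝒱) p (Q m n) ∧
    rotLeft (shift 𝒱) m n (Q m n) = Q m n ∧ rotRight (shift 𝒱) m n (Q m n) = Q m n}
  add_mem' := by
    rintro a b ⟨ha0, ha⟩ ⟨hb0, hb⟩
    refine ⟨by simp [ha0, hb0], fun m n => ⟨fun d x hx h => ?_, ?_, ?_⟩⟩
    · simp [(ha m n).1 d x hx h, (hb m n).1 d x hx h]
    · simp [(ha m n).2.1, (hb m n).2.1]
    · simp [(ha m n).2.2, (hb m n).2.2]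
  zero_mem' := ⟨rfl, fun m n => ⟨fun d x hx h => rfl, by simp, by simp⟩⟩
  smul_mem' := by
    rintro c a ⟨ha0, ha⟩
    refine ⟨by simp [ha0], fun m n => ⟨fun d x hx h => ?_, ?_, ?_⟩⟩
    · simp [(ha m n).1 d x hx h]
    · simp [(ha m n).2.1]
    · simp [(ha m n).2.2]

/-- The right action `Q ↦ Q • γ` of an element `γ` of `C(V,V)` of degree `q` on `Cyc(V,k)`: the
sum over all ways to apply `γ` to consecutive letters of one of the two cyclic words. -/
def cycAct (𝒱 : ℤ → Submodule k V) [DirectSum.Decomposition 𝒱] (q : ℤ) (γ : Cochain k V) :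
    BiForm k V →ₗ[k] BiForm k V where
  toFun Q := fun m n =>
    (∑ i : Fin m, ∑ a ∈ Finset.range m,
      (rotLeft (shift 𝒱) m n ^ a) (insertLeft i (Q (m - i) n) (γ (i.1 + 1)))) +
    ∑ i : Fin n, ∑ b ∈ Finset.range n,
      (rotRight (shift 𝒱) m n ^ b)
        (insertRight (shift 𝒱) (q : ZMod 2) i (Q m (n - i)) (γ (i.1 + 1)))
  map_add' Q Q' := by
    funext m n
    have h1 : ∀ (i : Fin m) (f f' : Form k V (m - i) n) g,
        insertLeft i (f + f') g = insertLeft i f g + insertLeft i f' g := fun _ _ _ _ => rfl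
    have h2 : ∀ (i : Fin n) (f f' : Form k V m (n - i)) g,
        insertRight (shift 𝒱) (q : ZMod 2) i (f + f') g =
          insertRight (shift 𝒱) (q : ZMod 2) i f g + insertRight (shift 𝒱) (q : ZMod 2) i f' g :=
      by
        intro i f f' g
        simp only [insertRight]
        rw [← map_add]; rfl
    simp only [Pi.add_apply, h1, h2, map_add, Finset.sum_add_distrib]
    abel
  map_smul' c Q := by
    funext m n
    have h1 : ∀ (i : Fin m) (f : Form k V (m - i) n) g,
        insertLeft i (c • f) g = c • insertLeft i f g := fun _ _ _ => rfl
    have h2 : ∀ (i : Fin n) (f : Form k V m (n - i)) g,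
        insertRight (shift 𝒱) (q : ZMod 2) i (c • f) g =
          c • insertRight (shift 𝒱) (q : ZMod 2) i f g :=
      by
        intro i f g
        simp only [insertRight]
        rw [← map_smul]; rfl
    simp only [Pi.smul_apply, h1, h2, map_smul, RingHom.id_apply, Finset.smul_sum, smul_add]

/-- `∂_Γ = [Γ,-]` on `Cyc^p(V,k)`, for `Γ` of degree one, where the bracket on
`C(V,V) ⊕ Cyc(V,k)` is `[γ,Q] = -(-1)^{|γ||Q|} Q • γ`. -/
def cycDiff (𝒱 : ℤ → Submodule k V) [DirectSum.Decomposition 𝒱] (Γ : Cochain k V) (p : ℤ) :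
    BiForm k V →ₗ[k] BiForm k V :=
  (-sgn k (p : ZMod 2)) • cycAct 𝒱 1 Γ

/-- The cocycles in `Cyc^p(V,k)`. -/
def cocycles (𝒱 : ℤ → Submodule k V) [DirectSum.Decomposition 𝒱] (Γ : Cochain k V) (p : ℤ) :
    Submodule k (BiForm k V) :=
  Cyc 𝒱 p ⊓ LinearMap.ker (cycDiff 𝒱 Γ p)

/-- The coboundaries `∂_Γ(Cyc^{p-1}(V,k))`. -/
def coboundaries (𝒱 : ℤ → Submodule k V) [DirectSum.Decomposition 𝒱] (Γ : Cochain k V) (p : ℤ) :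
    Submodule k (BiForm k V) :=
  (Cyc 𝒱 (p - 1)).map (cycDiff 𝒱 Γ (p - 1))

/-- `H^p(Cyc(V,k), ∂_Γ)`. -/
abbrev CycCohomology (𝒱 : ℤ → Submodule k V) [DirectSum.Decomposition 𝒱] (Γ : Cochain k V)
    (p : ℤ) : Type _ :=
  cocycles 𝒱 Γ p ⧸ (coboundaries 𝒱 Γ p).submoduleOf (cocycles 𝒱 Γ p)

/-- The element `Γ^↻`: the traces `tr_{m+1}(Γ_{m+n+1})` on `V[1]`, summed over the actions of the
cyclic groups `C_m` and `C_n` on the two blocks of arguments. -/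
def wheel (𝒱 : ℤ → Submodule k V) [DirectSum.Decomposition 𝒱] (Γ : Cochain k V) :
    BiForm k V := fun m n =>
  if m + n = 0 then 0 else
    ∑ a ∈ Finset.range (cycOrder m), ∑ b ∈ Finset.range (cycOrder n),
      (rotRight (shift 𝒱) m n ^ b) ((rotLeft (shift 𝒱) m n ^ a)
        (traceSlot (shift 𝒱) m n (Γ (m + 1 + n))))

/-! ### Unimodular `A_∞`-structures on `V` -/

/-- `∑_p f(1 ⊗ ⋯ ⊗ d ⊗ ⋯ ⊗ 1)` with `d`, of degree one, in the slot `p`, where `r` is the order of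
the slots; on homogeneous arguments the sign is `-1` to the sum of the degrees left of `p`. -/
def insertDiff (𝒱 : ℤ → Submodule k V) [DirectSum.Decomposition 𝒱] {ι : Type} [Fintype ι]
    [DecidableEq ι] (r : ι → ι → Prop) [DecidableRel r] (d : V →ₗ[k] V) (f : Multi k V ι W) :
    Multi k V ι W :=
  ∑ p : ι, twist 𝒱 (fun ε => ∑ p' : ι, if r p' p then ε p' else 0)
    (f.compLinearMap (Function.update (fun _ => LinearMap.id) p d))

/-- A unimodular `A_∞`-structure on the graded vector space `V`: a differential `d` on `V` and a
representation in `(V,d)` of the minimal resolution of the wheeled operad of unimodular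
associative algebras.  This is the free wheeled operad on generators of degrees `2 - n` (`n ≥ 2`)
and `-m-n` (`m + n ≥ 1`, with cyclic symmetries), so that a representation consists of operations
`μ_n`, `q_{m,n}` on which the differential takes the prescribed values.  Components `μ_n` with
`n < 2`, and `q_{0,0}`, play no role.  In the sums the number of inputs of the inner operation is
`j + 1` (resp. `i + 1`). -/
structure UnimodularAInfinity (𝒱 : ℤ → Submodule k V) [DirectSum.Decomposition 𝒱] where
  /-- the differential of `V` -/
  d : V →ₗ[k] V
  /-- the operations `μ_n : V^{⊗n} → V` -/
  μ : ∀ n : ℕ, Multi k V (Fin n) V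
  /-- the operations `q_{m,n} : V^{⊗m} ⊗ V^{⊗n} → k` -/
  q : ∀ m n : ℕ, Form k V m n
  d_degree : ∀ (i : ℤ), ∀ x ∈ 𝒱 i, d x ∈ 𝒱 (i + 1)
  d_sq : d ∘ₗ d = 0
  μ_degree : ∀ n : ℕ, 2 ≤ n → HasDegree 𝒱 (2 - n) (μ n)
  q_degree : ∀ m n : ℕ, 1 ≤ m + n → FormHasDegree 𝒱 (-m - n) (q m n)
  q_left : ∀ m n, 1 ≤ m → signedRotLeft 𝒱 m n (q m n) = q m n
  q_right : ∀ m n, 1 ≤ n → signedRotRight 𝒱 m n (q m n) = q m n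
  μ_eq : ∀ n, 2 ≤ n →
    d.compMultilinearMap (μ n) - (-1 : k) ^ n • insertDiff 𝒱 (· < ·) d (μ n) =
      ∑ j : Fin n with 1 ≤ j.1 ∧ j.1 + 1 < n, ∑ i : Fin (n - j),
        (-1 : k) ^ (i.1 * (j.1 + 1) + i.1 + (j.1 + 1) + 1 + n) •
          insertOp 𝒱 ((j.1 + 1 : ℕ) : ZMod 2) j i (μ (n - j)) (μ (j.1 + 1))
  q_eq : ∀ m n, 1 ≤ m + n →
    -((-1 : k) ^ (m + n) • insertDiff 𝒱 (Sum.Lex (· < ·) (· < ·)) d (q m n)) =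
      (∑ i : Fin m with 1 ≤ i.1, ∑ a ∈ Finset.range m,
        (-1 : k) ^ ((i.1 + 1) + m + n + 1) •
          (signedRotLeft 𝒱 m n ^ a) (insertLeft i (q (m - i) n) (μ (i.1 + 1)))) +
      (∑ i : Fin n with 1 ≤ i.1, ∑ b ∈ Finset.range n,
        (-1 : k) ^ ((i.1 + 1) * m + n) •
          (signedRotRight 𝒱 m n ^ b)
            (insertRight 𝒱 ((i.1 + 1 : ℕ) : ZMod 2) i (q m (n - i)) (μ (i.1 + 1)))) +
      ∑ a ∈ Finset.range (cycOrder m), ∑ b ∈ Finset.range (cycOrder n),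
        (signedRotRight 𝒱 m n ^ b) ((signedRotLeft 𝒱 m n ^ a)
          (traceSlot 𝒱 m n (μ (m + 1 + n))))

/-- `s^{-1} f s^{⊗n}`: on homogeneous `x_1,…,x_n` of degrees `a_1,…,a_n` in `V[1]` its value is
`(-1)^{∑ (n-p) a_p} f(x_1,…,x_n)`. -/
def suspend (𝒱 : ℤ → Submodule k V) [DirectSum.Decomposition 𝒱] {n : ℕ}
    (f : Multi k V (Fin n) V) : Multi k V (Fin n) V :=
  twist (shift 𝒱) (fun ε => ∑ p : Fin n, ((n - 1 - p.1 : ℕ) : ZMod 2) * ε p) f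

/-- The unimodular `A_∞`-structure `U` extends the `A_∞`-structure `Γ`: the differential and the
operations `μ_n` of `U` correspond to `Γ` under `Γ_n = s^{-1} μ_n s^{⊗n}`. -/
def UnimodularAInfinity.Extends {𝒱 : ℤ → Submodule k V} [DirectSum.Decomposition 𝒱]
    (U : UnimodularAInfinity 𝒱) (Γ : Cochain k V) : Prop :=
  (∀ x : Fin 1 → V, Γ 1 x = U.d (x 0)) ∧ ∀ n, 2 ≤ n → Γ n = suspend 𝒱 (U.μ n)

end Graded

end UnimodAInf

end

/-!
Multilinear maps on `V` are determined by their values on homogeneous elements, so every identity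
is checked on *words*, i.e. lists of homogeneous elements of `V[1]`, where the Koszul signs are
explicit elements of `ZMod 2`. The predicates `RepOp` and `RepForm` say that a function of words
gives the values of an operation or a form, and each construction on multilinear maps (rotation,
insertion, trace, twist by a sign) corresponds to one on functions of words. The cyclic groups act
through `rotWord`, and `cycSum` is the sum over all rotations.

*The element `Γ^↻` is a cocycle.* It is a sum over rotations, hence invariant. By
`sum_cycSum_graftSigned`, inserting `Γ` into the first places of a cyclic word, after and before
summing over rotations, is inserting it at all places and then summing. Hence `Γ^↻ • Γ` is the
rotation sum of the terms of the traced relation `[Γ,Γ] = 0` in which the inner operation does not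
take the traced letter (`trace_relation`). In the remaining terms the inner operation takes the end
of the first word, the traced letter and the beginning of the second word. Such a term is
`tr(A B)` for two odd endomorphisms `A` and `B`, and `tr(A B) = -tr(B A)`
(`wordTraceMiddle_swap`), where `tr(B A)` is a term of the same kind for rotated words. Summed over
rotations the remaining terms form an expression equal to its negative, so they vanish because
`2` is invertible (`cycSum_cycSum_sum_wordTraceMiddle`, `wordWheel_closed`).

*Primitives are unimodular structures.* An `R` of degree zero satisfies `∂_Γ R = Γ^↻` if and only
if `R • Γ + Γ^↻ = 0`. The operations of a unimodular structure that extends `Γ` are prescribed up to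
the choice of the `q_{m,n}`: `d` is `Γ_1` and `μ_n` is the desuspension of `Γ_n`. The equations of
`d` and `μ_n` are the `A_∞`-relations of `Γ` with the suspension signs moved through
(`differential_sq`, `mu_equation`). The map `biSuspend` identifies forms `R_{m,n}` of degree zero on
`V[1]` with forms `q_{m,n}` of degree `-m-n` on `V`; it exchanges the cyclic symmetries
(`signedRotLeft_biSuspend`, `signedRotRight_biSuspend`), and it turns the equation of `q_{m,n}` into
the component at `m, n` of `R • Γ + Γ^↻ = 0` (`q_equation_iff`). In that equation the terms with `d`
are the insertions of `Γ_1`: invariance of `R` turns the sum over all places of `d` into the sum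
over rotations of insertions at the first place (`sum_graft_one`).
-/

noncomputable section

namespace UnimodAInf

/-! ### Signs -/

section Signs

variable {k : Type*} [Field k]

@[simp] theorem sgn_zero : sgn k 0 = 1 := if_pos rfl

@[simp] theorem sgn_one : sgn k 1 = -1 := if_neg one_ne_zero

theorem sgn_add (a b : ZMod 2) : sgn k (a + b) = sgn k a * sgn k b := by
  have h : ∀ c : ZMod 2, c = 0 ∨ c = 1 := by decide
  have h2 : (1 + 1 : ZMod 2) = 0 := by decide
  rcases h a with rfl | rfl <;> rcases h b with rfl | rfl <;> simp [h2]

@[simp] theorem sgn_mul_self (a : ZMod 2) : sgn k a * sgn k a = 1 := by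
  rw [← sgn_add, CharTwo.add_self_eq_zero, sgn_zero]

theorem sgn_ne_zero (a : ZMod 2) : sgn k a ≠ 0 := fun h => by
  simpa [h] using sgn_mul_self (k := k) a

theorem neg_one_pow_eq_sgn (n : ℕ) : (-1 : k) ^ n = sgn k (n : ZMod 2) := by
  induction n with
  | zero => simp
  | succ n ih => rw [pow_succ, ih, Nat.cast_succ, sgn_add, sgn_one]

theorem neg_eq_sgn_mul (c : k) : -c = sgn k 1 * c := by simp

end Signs

/-- Intervals of places are enumerated by their end `e` and start `s`, or by their length minus one
`i` and start `s`. -/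
theorem sum_intervals {M : Type*} [AddCommMonoid M] (f : ℕ → ℕ → M) (n : ℕ) :
    ∑ e ∈ Finset.range (n + 1), ∑ s ∈ Finset.range e, f s e =
      ∑ i ∈ Finset.range n, ∑ s ∈ Finset.range (n - i), f s (s + i + 1) := by
  rw [Finset.sum_sigma', Finset.sum_sigma']
  refine Finset.sum_bij' (fun z _ => ⟨z.1 - z.2 - 1, z.2⟩) (fun z _ => ⟨z.2 + z.1 + 1, z.2⟩)
    ?_ ?_ ?_ ?_ ?_
  · rintro ⟨e, s⟩ h
    simp only [Finset.mem_sigma, Finset.mem_range] at h ⊢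
    omega
  · rintro ⟨e, s⟩ h
    simp only [Finset.mem_sigma, Finset.mem_range] at h ⊢
    omega
  · rintro ⟨e, s⟩ h
    simp only [Finset.mem_sigma, Finset.mem_range] at h ⊢
    simp only [Sigma.mk.injEq, heq_eq_eq, and_true]
    omega
  · rintro ⟨e, s⟩ h
    simp only [Finset.mem_sigma, Finset.mem_range] at h ⊢
    simp only [Sigma.mk.injEq, heq_eq_eq, and_true]
    omega
  · rintro ⟨e, s⟩ h
    simp only [Finset.mem_sigma, Finset.mem_range] at h ⊢
    congr 1
    omega

/-! ### Signed cyclic words -/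

section Words

variable {k : Type*} [Field k] {H : Type*} (p : H → ZMod 2)

/-- The parity of a word, for letters with parities `p`. -/
def wt (L : List H) : ZMod 2 := (L.map p).sum

@[simp] theorem wt_nil : wt p [] = 0 := rfl

@[simp] theorem wt_cons (x : H) (L : List H) : wt p (x :: L) = p x + wt p L := by simp [wt]

@[simp] theorem wt_append (A B : List H) : wt p (A ++ B) = wt p A + wt p B := by simp [wt]

theorem wt_take_add_drop (n : ℕ) (L : List H) : wt p (L.take n) + wt p (L.drop n) = wt p L := by
  rw [← wt_append, List.take_append_drop]

/-- The action of the cyclic rotation on functions of words, with the Koszul sign. -/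
def rotWord : Module.End k (List H → k) where
  toFun φ X := match X with
    | [] => φ []
    | x :: t => sgn k (p x * wt p t) * φ (t ++ [x])
  map_add' φ ψ := by
    funext X
    cases X <;> simp [mul_add]
  map_smul' c φ := by
    funext X
    cases X <;> simp [mul_left_comm]

theorem rotWord_nil (φ : List H → k) : rotWord p φ [] = φ [] := rfl

theorem rotWord_cons (φ : List H → k) (x : H) (t : List H) :
    rotWord p φ (x :: t) = sgn k (p x * wt p t) * φ (t ++ [x]) := rfl

theorem rotWord_pow_nil (φ : List H → k) (a : ℕ) : (rotWord p ^ a) φ [] = φ [] := by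
  induction a with
  | zero => rfl
  | succ a ih => rw [pow_succ', Module.End.mul_apply, rotWord_nil, ih]

/-- The iterated rotation moves an initial segment `A` past the rest `B` of the word. -/
theorem rotWord_pow_append (φ : List H → k) (A B : List H) :
    (rotWord p ^ A.length) φ (A ++ B) = sgn k (wt p A * wt p B) * φ (B ++ A) := by
  induction A generalizing B with
  | nil => simp
  | cons x A ih =>
    rw [List.length_cons, pow_succ', Module.End.mul_apply, List.cons_append, rotWord_cons,
      List.append_assoc, ih, ← mul_assoc, ← sgn_add, List.append_assoc]
    congr 2
    simp only [wt_append, wt_cons, wt_nil]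
    generalize p x = a
    generalize wt p A = b
    generalize wt p B = c
    revert a b c
    decide

theorem rotWord_pow_take (φ : List H → k) (X : List H) {a : ℕ} (ha : a ≤ X.length) :
    (rotWord p ^ a) φ X = sgn k (wt p (X.take a) * wt p (X.drop a)) * φ (X.drop a ++ X.take a) := by
  have h := rotWord_pow_append p φ (X.take a) (X.drop a)
  rwa [List.take_append_drop, List.length_take, min_eq_left ha] at h

theorem rotWord_pow_length (φ : List H → k) (X : List H) :
    (rotWord p ^ X.length) φ X = φ X := by
  simpa using rotWord_pow_append p φ X []

theorem rotWord_pow_cycOrder (φ : List H → k) (X : List H) :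
    (rotWord p ^ cycOrder X.length) φ X = φ X := by
  cases X with
  | nil => exact rotWord_pow_nil p φ _
  | cons x t =>
    have : cycOrder (x :: t).length = (x :: t).length := by simp [cycOrder]
    rw [this, rotWord_pow_length]

theorem rotWord_pow_congr {φ ψ : List H → k} (a : ℕ) (X : List H)
    (h : ∀ X' : List H, X'.length = X.length → φ X' = ψ X') :
    (rotWord p ^ a) φ X = (rotWord p ^ a) ψ X := by
  induction a generalizing X with
  | zero => simpa using h X rfl
  | succ a ih =>
    rw [pow_succ', Module.End.mul_apply, Module.End.mul_apply]
    cases X with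
    | nil => rw [rotWord_nil, rotWord_nil, ih [] h]
    | cons x t =>
      rw [rotWord_cons, rotWord_cons, ih]
      intro X' hX'
      exact h X' (by rw [hX']; simp)

/-- Functions of words that depend on the word only through its parity and length commute with
the rotation. -/
theorem rotWord_pow_smul {c : List H → k} (hc : ∀ x t, c (x :: t) = c (t ++ [x]))
    (φ : List H → k) (a : ℕ) :
    (rotWord p ^ a) (fun X => c X * φ X) = fun X => c X * (rotWord p ^ a) φ X := by
  induction a with
  | zero => rfl
  | succ a ih =>
    rw [pow_succ', Module.End.mul_apply, ih, Module.End.mul_apply]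
    funext X
    cases X with
    | nil => simp only [rotWord_nil]
    | cons x t => rw [rotWord_cons, rotWord_cons, hc, mul_left_comm]

/-- The sum over all rotations of a word. There is one term for the empty word, as the trivial group
acts on it. -/
def cycSum : Module.End k (List H → k) where
  toFun φ X := ∑ a ∈ Finset.range (cycOrder X.length), (rotWord p ^ a) φ X
  map_add' φ ψ := by
    funext X
    simp [Finset.sum_add_distrib]
  map_smul' c φ := by
    funext X
    simp [Finset.mul_sum]

theorem cycSum_apply (φ : List H → k) (X : List H) :
    cycSum p φ X = ∑ a ∈ Finset.range (cycOrder X.length), (rotWord p ^ a) φ X := rfl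

theorem cycSum_apply_explicit (φ : List H → k) (X : List H) :
    cycSum p φ X = ∑ a ∈ Finset.range (cycOrder X.length),
      sgn k (wt p (X.take a) * wt p (X.drop a)) * φ (X.drop a ++ X.take a) := by
  rw [cycSum_apply]
  refine Finset.sum_congr rfl fun a ha => ?_
  cases X with
  | nil => simp [rotWord_pow_nil]
  | cons x t =>
    refine rotWord_pow_take p φ _ ?_
    have := Finset.mem_range.1 ha
    simp only [cycOrder, List.length_cons] at this ⊢
    omega

theorem cycSum_congr {φ ψ : List H → k} (X : List H)
    (h : ∀ X' : List H, X'.length = X.length → φ X' = ψ X') : cycSum p φ X = cycSum p ψ X := by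
  rw [cycSum_apply, cycSum_apply]
  exact Finset.sum_congr rfl fun a _ => rotWord_pow_congr p a X h

theorem cycSum_smul {c : List H → k} (hc : ∀ x t, c (x :: t) = c (t ++ [x]))
    (φ : List H → k) : cycSum p (fun X => c X * φ X) = fun X => c X * cycSum p φ X := by
  funext X
  simp only [cycSum_apply, rotWord_pow_smul p hc, Finset.mul_sum]

theorem cycSum_const_mul (c : k) (φ : List H → k) (X : List H) :
    cycSum p (fun X' => c * φ X') X = c * cycSum p φ X :=
  congrFun (cycSum_smul p (c := fun _ => c) (fun _ _ => rfl) φ) X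

theorem cycSum_add (φ ψ : List H → k) (X : List H) :
    cycSum p (fun X' => φ X' + ψ X') X = cycSum p φ X + cycSum p ψ X :=
  congrFun (map_add (cycSum p) φ ψ) X

theorem cycSum_zero (X : List H) : cycSum p (fun _ => (0 : k)) X = 0 :=
  congrFun (map_zero (cycSum p)) X

theorem cycSum_sum {κ : Type*} (s : Finset κ) (f : κ → List H → k) (X : List H) :
    cycSum p (fun X' => ∑ i ∈ s, f i X') X = ∑ i ∈ s, cycSum p (f i) X := by
  rw [← Finset.sum_apply, ← map_sum]
  refine congrFun (congrArg _ (funext fun X' => ?_)) X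
  rw [Finset.sum_apply]

theorem cycSum_rotWord (φ : List H → k) : cycSum p (rotWord p φ) = cycSum p φ := by
  funext X
  have h := Finset.sum_range_succ (fun a => (rotWord p ^ a) φ X) (cycOrder X.length)
  rw [Finset.sum_range_succ', rotWord_pow_cycOrder] at h
  rw [cycSum_apply, cycSum_apply]
  refine Eq.trans ?_ (add_right_cancel h)
  refine Finset.sum_congr rfl fun a _ => ?_
  rw [pow_succ, Module.End.mul_apply]

theorem rotWord_cycSum (φ : List H → k) : rotWord p (cycSum p φ) = cycSum p φ := by
  have h1 : rotWord p (cycSum p φ) = cycSum p (rotWord p φ) := by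
    funext X
    cases X with
    | nil => simp only [rotWord_nil, cycSum_apply, rotWord_pow_nil]
    | cons x t =>
      rw [rotWord_cons, cycSum_apply, cycSum_apply, Finset.mul_sum]
      have : (t ++ [x]).length = (x :: t).length := by simp
      rw [this]
      refine Finset.sum_congr rfl fun a _ => ?_
      rw [← Module.End.mul_apply, ← pow_succ, pow_succ', Module.End.mul_apply, rotWord_cons]
  rw [h1, cycSum_rotWord]

theorem cycSum_rotWord_pow (φ : List H → k) (a : ℕ) :
    cycSum p ((rotWord p ^ a) φ) = cycSum p φ := by
  induction a with
  | zero => rfl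
  | succ a ih => rw [pow_succ', Module.End.mul_apply, cycSum_rotWord, ih]

theorem rotWord_pow_of_invariant {φ : List H → k} {n : ℕ}
    (h : ∀ X : List H, X.length = n → rotWord p φ X = φ X) (a : ℕ) (X : List H)
    (hX : X.length = n) : (rotWord p ^ a) φ X = φ X := by
  induction a with
  | zero => rfl
  | succ a ih =>
    rw [pow_succ, Module.End.mul_apply, ← ih]
    exact rotWord_pow_congr p a X fun X' hX' => h X' (hX'.trans hX)

theorem cycSum_comm (F : List H → List H → k) (X Y : List H) :
    cycSum p (fun Y' => cycSum p (fun X' => F X' Y') X) Y =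
      cycSum p (fun X' => cycSum p (F X') Y) X := by
  simp only [cycSum_apply_explicit, Finset.mul_sum]
  rw [Finset.sum_comm]
  refine Finset.sum_congr rfl fun a _ => Finset.sum_congr rfl fun b _ => ?_
  ring

/-! ### Grafting an operation into a cyclic word -/

variable (G : List H → H)

/-- The word in which the letters at the places `i, …, e - 1` are replaced by the value of `G`
on them. -/
def graft (i e : ℕ) (L : List H) : List H := L.take i ++ G ((L.take e).drop i) :: L.drop e

theorem graft_append (A B C : List H) :
    graft G A.length (A.length + B.length) (A ++ (B ++ C)) = A ++ G B :: C := by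
  have h1 : (A ++ (B ++ C)).take (A.length + B.length) = A ++ B := by
    rw [← List.append_assoc, ← List.length_append, List.take_left]
  have h2 : (A ++ (B ++ C)).drop (A.length + B.length) = C := by
    rw [← List.append_assoc, ← List.length_append, List.drop_left]
  rw [graft, h1, h2, List.take_left, List.drop_left]

theorem graft_zero_append (B C : List H) : graft G 0 B.length (B ++ C) = G B :: C := by
  simp [graft]

theorem length_graft {i e : ℕ} {L : List H} (hi : i < e) (he : e ≤ L.length) :
    (graft G i e L).length = L.length + i + 1 - e := by
  simp only [graft, List.length_append, List.length_take, List.length_cons, List.length_drop]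
  omega

theorem graft_append_left {i e : ℕ} {X : List H} (hi : i ≤ e) (he : e ≤ X.length) (Y : List H) :
    graft G i e (X ++ Y) = graft G i e X ++ Y := by
  simp [graft, List.take_append_of_le_length he, List.take_append_of_le_length (hi.trans he),
    List.drop_append_of_le_length he]

theorem graft_append_right (i e : ℕ) (X Y : List H) :
    graft G (X.length + i) (X.length + e) (X ++ Y) = X ++ graft G i e Y := by
  rw [graft, graft, List.take_length_add_append, List.take_length_add_append,
    List.drop_length_add_append, List.drop_length_add_append, List.append_assoc]

theorem graft_append_middle {i : ℕ} {X : List H} (hi : i ≤ X.length) (t : ℕ) (Y : List H) :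
    graft G i (X.length + t) (X ++ Y) = X.take i ++ G (X.drop i ++ Y.take t) :: Y.drop t := by
  rw [graft, List.take_append_of_le_length hi, List.take_length_add_append,
    List.drop_length_add_append, List.drop_append_of_le_length hi]

/-- Composition of a function of words with a grafting of an odd operation, with the Koszul
sign. The sign is that of an operation of degree one; nothing is assumed about `G` here. -/
def graftSigned (i e : ℕ) (φ : List H → k) (X : List H) : k :=
  sgn k (wt p (X.take i)) * φ (graft G i e X)

theorem graftSigned_def (i e : ℕ) (φ : List H → k) :
    graftSigned p G i e φ = fun X => sgn k (wt p (X.take i)) * φ (graft G i e X) := rfl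

variable {p G}

theorem wt_graft (hG : ∀ L, p (G L) = wt p L + 1) {i e : ℕ} (hi : i ≤ e) (L : List H) :
    wt p (graft G i e L) = wt p L + 1 := by
  have h1 := wt_take_add_drop p e L
  have h2 := wt_take_add_drop p i (L.take e)
  rw [List.take_take, min_eq_left hi] at h2
  rw [graft, wt_append, wt_cons, hG, ← h1, ← h2]
  ring

/-- Inserting an odd operation `G` at the place `s` amounts to rotating the word so that the place
`s` comes first, inserting there, and rotating back. -/
theorem rotWord_pow_graftSigned (hG : ∀ L, p (G L) = wt p L + 1) (φ : List H → k) {s r : ℕ}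
    {X : List H} (h : s + r ≤ X.length) :
    (rotWord p ^ s) (graftSigned p G 0 r φ) X =
      graftSigned p G s (s + r) ((rotWord p ^ s) φ) X := by
  obtain ⟨A, B, C, rfl, rfl, rfl⟩ : ∃ A B C : List H, X = A ++ (B ++ C) ∧ s = A.length ∧
      r = B.length :=
    ⟨X.take s, (X.drop s).take r, (X.drop s).drop r, by simp, by simp; omega, by simp; omega⟩
  rw [rotWord_pow_append, graftSigned, graftSigned, List.append_assoc, graft_zero_append,
    graft_append, rotWord_pow_append, List.take_left, List.take_zero, wt_nil, sgn_zero, one_mul,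
    ← mul_assoc, ← sgn_add, List.cons_append]
  congr 2
  simp only [wt_append, wt_cons, hG]
  generalize wt p A = a
  generalize wt p B = b
  generalize wt p C = c
  revert a b c
  decide

/-- Applying an odd operation to the consecutive letters of a cyclic word in all possible ways is
the same as grafting it at all places and then summing over rotations. -/
theorem sum_cycSum_graftSigned (hG : ∀ L, p (G L) = wt p L + 1) (φ : List H → k) (X : List H) :
    ∑ i ∈ Finset.range X.length, cycSum p (graftSigned p G 0 (i + 1) (cycSum p φ)) X =
      ∑ e ∈ Finset.range (X.length + 1), ∑ s ∈ Finset.range e,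
        cycSum p (graftSigned p G s e φ) X := by
  rw [sum_intervals (fun s e => cycSum p (graftSigned p G s e φ) X)]
  refine Finset.sum_congr rfl fun i hi => ?_
  have hi := Finset.mem_range.1 hi
  -- `m'` is the length of the word after the insertion of an operation of `i + 1` letters.
  set m' := X.length - i with hm'
  have hlen : ∀ X' : List H, X'.length = X.length → ∀ s ≤ X.length - (i + 1),
      (graft G s (s + (i + 1)) X').length = m' := by
    intro X' hX' s hs
    rw [length_graft _ (by omega) (by omega)]
    omega
  -- Both sides are sums over `c` of insertions at the first place into `ζ^c φ`: on the left `c`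
  -- runs over `0, …, m' - 1`, on the right over `m', …, 1`. The ends agree as `ζ^{m'} = 1`.
  have h1 : cycSum p (graftSigned p G 0 (i + 1) (cycSum p φ)) X =
      ∑ c ∈ Finset.range m',
        cycSum p (graftSigned p G 0 (i + 1) ((rotWord p ^ c) φ)) X := by
    rw [← Finset.sum_apply, ← map_sum]
    refine cycSum_congr p X fun X' hX' => ?_
    have := hlen X' hX' 0 (by omega)
    rw [zero_add] at this
    rw [Finset.sum_apply, graftSigned, cycSum_apply, this, Finset.mul_sum, cycOrder,
      max_eq_left (by omega)]
    rfl
  have h2 : ∀ s ∈ Finset.range m', cycSum p (graftSigned p G s (s + i + 1) φ) X =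
      cycSum p (graftSigned p G 0 (i + 1) ((rotWord p ^ (m' - s)) φ)) X := by
    intro s hs
    have hs := Finset.mem_range.1 hs
    rw [← cycSum_rotWord_pow p (graftSigned p G 0 (i + 1) ((rotWord p ^ (m' - s)) φ)) s]
    refine cycSum_congr p X fun X' hX' => ?_
    rw [rotWord_pow_graftSigned hG _ (by omega), graftSigned, graftSigned,
      ← Module.End.mul_apply, ← pow_add, Nat.add_sub_cancel' hs.le]
    have := hlen X' hX' s (by omega)
    rw [← this, rotWord_pow_length]
    rfl
  rw [h1, Finset.sum_congr rfl h2]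
  have hF : ∀ c, c = 0 ∨ c = m' →
      cycSum p (graftSigned p G 0 (i + 1) ((rotWord p ^ c) φ)) X =
        cycSum p (graftSigned p G 0 (i + 1) φ) X := by
    rintro c (rfl | rfl)
    · rfl
    · refine cycSum_congr p X fun X' hX' => ?_
      have := hlen X' hX' 0 (by omega)
      rw [zero_add] at this
      rw [graftSigned, graftSigned, ← this, rotWord_pow_length]
  obtain ⟨m, hm⟩ : ∃ m, m' = m + 1 := ⟨m' - 1, by omega⟩
  rw [hm] at hF ⊢
  rw [Finset.sum_range_succ', Finset.sum_range_succ', hF 0 (Or.inl rfl), Nat.sub_zero,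
    hF _ (Or.inr rfl), ← Finset.sum_range_reflect]
  congr 1
  refine Finset.sum_congr rfl fun c hc => ?_
  have hc := Finset.mem_range.1 hc
  rw [show m - 1 - c + 1 = m + 1 - (c + 1) by omega]

end Words

/-! ### The wheel of an `A_∞`-structure is closed -/

section Wheel

variable {k : Type*} [Field k] {H : Type*} (p : H → ZMod 2) (G : List H → H)
  {ι : Type*} [Fintype ι] (E : ι → H) (M : ι → List H → k)

/-- The supertrace of an operation, over the slot between the words `X` and `Y`. Here `E` is a
homogeneous basis and `M α L` is the coordinate at `E α` of the value of the operation on `L`. -/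
def wordTrace (X Y : List H) : k :=
  ∑ α, sgn k (p (E α) * (1 + wt p Y)) * M α (X ++ E α :: Y)

/-- The sum of the supertrace over all rotations of the two words. -/
def wordWheel (X Y : List H) : k :=
  cycSum p (fun Y' => cycSum p (fun X' => wordTrace p E M X' Y') X) Y

/-- The supertrace of those composites in which the inner operation takes the traced letter: it is
applied to the last letters of `X`, from the place `i` on, the traced letter and the first `t`
letters of `Y`. -/
def wordTraceMiddle (i t : ℕ) (X Y : List H) : k :=
  ∑ α, sgn k (p (E α) * (1 + wt p Y) + wt p (X.take i)) *
    M α (X.take i ++ G (X.drop i ++ E α :: Y.take t) :: Y.drop t)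

variable {p G E M}

/-- The intervals of a word of length `m + 1 + n` either lie in the first `m` places, or in the last
`n` places, or contain the place in the middle. -/
theorem sum_intervals_add {A : Type*} [AddCommMonoid A] (f : ℕ → ℕ → A) (m n : ℕ) :
    ∑ e ∈ Finset.range (m + 1 + n + 1), ∑ i ∈ Finset.range e, f i e =
      (∑ e ∈ Finset.range (m + 1), ∑ i ∈ Finset.range e, f i e) +
      (∑ t ∈ Finset.range (n + 1), ∑ i ∈ Finset.range t, f (m + (1 + i)) (m + (1 + t))) +
      ∑ t ∈ Finset.range (n + 1), ∑ i ∈ Finset.range (m + 1), f i (m + (1 + t)) := by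
  rw [add_assoc (m + 1) n 1, Finset.sum_range_add, add_assoc, ← Finset.sum_add_distrib]
  congr 1
  refine Finset.sum_congr rfl fun t _ => ?_
  rw [Finset.sum_range_add, add_comm]
  simp only [add_assoc]

/-- The supertrace of the `A_∞`-relations: the inner operation is applied to letters of `X`, or to
letters of `Y`, or takes the traced letter. -/
theorem trace_relation (hG : ∀ L, p (G L) = wt p L + 1)
    (hrel : ∀ α L, L ≠ [] → ∑ e ∈ Finset.range (L.length + 1), ∑ i ∈ Finset.range e,
      sgn k (wt p (L.take i)) * M α (graft G i e L) = 0) (X Y : List H) :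
    (∑ e ∈ Finset.range (X.length + 1), ∑ i ∈ Finset.range e,
      sgn k (wt p (X.take i)) * wordTrace p E M (graft G i e X) Y) +
    (∑ t ∈ Finset.range (Y.length + 1), ∑ i ∈ Finset.range t,
      sgn k (wt p X + wt p (Y.take i)) * wordTrace p E M X (graft G i t Y)) +
    (∑ t ∈ Finset.range (Y.length + 1), ∑ i ∈ Finset.range (X.length + 1),
      wordTraceMiddle p G E M i t X Y) = 0 := by
  obtain ⟨s, hs⟩ : ∃ s : ι → k, ∀ α, s α = sgn k (p (E α) * (1 + wt p Y)) := ⟨_, fun _ => rfl⟩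
  have h : ∑ α, s α *
      (∑ e ∈ Finset.range ((X ++ E α :: Y).length + 1), ∑ i ∈ Finset.range e,
        sgn k (wt p ((X ++ E α :: Y).take i)) * M α (graft G i e (X ++ E α :: Y))) = 0 :=
    Finset.sum_eq_zero fun α _ => by rw [hrel α _ (by simp), mul_zero]
  rw [← h]
  have hlen : ∀ α, (X ++ E α :: Y).length = X.length + 1 + Y.length := fun α => by
    simp; omega
  simp only [hlen, sum_intervals_add, mul_add, Finset.sum_add_distrib, Finset.mul_sum]
  congr 1
  · congr 1
    · rw [Finset.sum_comm]
      refine Finset.sum_congr rfl fun e he => ?_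
      rw [Finset.sum_comm]
      refine Finset.sum_congr rfl fun i hi => ?_
      have he := Finset.mem_range.1 he
      have hi := Finset.mem_range.1 hi
      rw [wordTrace, Finset.mul_sum]
      refine Finset.sum_congr rfl fun α _ => ?_
      rw [← hs α, graft_append_left G hi.le (by omega), List.take_append_of_le_length (by omega),
        mul_left_comm]
    · rw [Finset.sum_comm]
      refine Finset.sum_congr rfl fun t ht => ?_
      rw [Finset.sum_comm]
      refine Finset.sum_congr rfl fun i hi => ?_
      have ht := Finset.mem_range.1 ht
      have hi := Finset.mem_range.1 hi
      rw [wordTrace, Finset.mul_sum]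
      refine Finset.sum_congr rfl fun α _ => ?_
      have h2 : X ++ E α :: Y = X ++ ([E α] ++ Y) := rfl
      have h3 : graft G (1 + i) (1 + t) ([E α] ++ Y) = [E α] ++ graft G i t Y :=
        graft_append_right G i t [E α] Y
      rw [hs α, h2, graft_append_right, h3, List.take_length_add_append, wt_graft hG hi.le,
        ← mul_assoc, ← mul_assoc, ← sgn_add, ← sgn_add]
      congr 2
      rw [show ([E α] ++ Y).take (1 + i) = E α :: Y.take i by
        rw [add_comm]; rfl]
      simp only [wt_append, wt_cons]
      generalize p (E α) = a
      generalize wt p Y = b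
      generalize wt p X = c
      generalize wt p (Y.take i) = d
      revert a b c d
      decide
  · conv_rhs => rw [Finset.sum_comm]
    refine Finset.sum_congr rfl fun t _ => ?_
    conv_rhs => rw [Finset.sum_comm]
    refine Finset.sum_congr rfl fun i hi => ?_
    have hi := Finset.mem_range.1 hi
    rw [wordTraceMiddle]
    refine Finset.sum_congr rfl fun α _ => ?_
    have h2 : X ++ E α :: Y = X ++ ([E α] ++ Y) := rfl
    rw [graft_append_middle G (by omega), List.take_append_of_le_length (by omega), sgn_add,
      mul_assoc, ← hs α]
    congr 3
    rw [add_comm 1 t]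
    rfl

/-- The supertrace of a composite of two odd operations changes its sign when they are
interchanged. -/
theorem wordTraceMiddle_swap
    (hlin : ∀ α X L Y, L ≠ [] → M α (X ++ G L :: Y) = ∑ β, M β L * M α (X ++ E β :: Y))
    (hdeg : ∀ α L, L ≠ [] → M α L ≠ 0 → p (E α) = wt p L + 1) (A B C D : List H) :
    wordTraceMiddle p G E M A.length C.length (A ++ B) (C ++ D) =
      -(sgn k (wt p A * wt p B) * (sgn k (wt p C * wt p D) *
        wordTraceMiddle p G E M B.length D.length (B ++ A) (D ++ C))) := by
  simp only [wordTraceMiddle, List.take_left, List.drop_left, wt_append]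
  rw [neg_eq_sgn_mul]
  simp only [hlin _ A _ D (List.append_ne_nil_of_right_ne_nil _ (List.cons_ne_nil _ _)),
    hlin _ B _ C (List.append_ne_nil_of_right_ne_nil _ (List.cons_ne_nil _ _)), Finset.mul_sum]
  rw [Finset.sum_comm]
  refine Finset.sum_congr rfl fun β _ => Finset.sum_congr rfl fun α _ => ?_
  by_cases h1 : M β (B ++ E α :: C) = 0
  · simp [h1]
  by_cases h2 : M α (A ++ E β :: D) = 0
  · simp [h2]
  have e1 := hdeg β _ (by simp) h1
  have e2 := hdeg α _ (by simp) h2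
  simp only [wt_append, wt_cons] at e1 e2
  have hs : p (E α) * (1 + (wt p C + wt p D)) + wt p A =
      1 + (wt p A * wt p B + (wt p C * wt p D +
        (p (E β) * (1 + (wt p D + wt p C)) + wt p B))) := by
    revert e1 e2
    generalize p (E α) = a
    generalize p (E β) = b
    generalize wt p A = c
    generalize wt p B = d
    generalize wt p C = e
    generalize wt p D = f
    revert a b c d e f
    decide
  rw [hs]
  simp only [sgn_add]
  ring

/-- After summation over rotations, the terms of the traced relation in which the inner operation
takes the traced letter cancel in pairs: the two operations of a composite exchange their roles. -/
theorem cycSum_cycSum_wordTraceMiddle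
    (hlin : ∀ α X L Y, L ≠ [] → M α (X ++ G L :: Y) = ∑ β, M β L * M α (X ++ E β :: Y))
    (hdeg : ∀ α L, L ≠ [] → M α L ≠ 0 → p (E α) = wt p L + 1) {i t : ℕ} {X Y : List H}
    (hi : i ≤ X.length) (ht : t ≤ Y.length) :
    cycSum p (fun Y' => cycSum p (fun X' => wordTraceMiddle p G E M i t X' Y') X) Y =
      -cycSum p (fun Y' => cycSum p (fun X' => wordTraceMiddle p G E M (X.length - i)
        (Y.length - t) X' Y') X) Y := by
  have h : ∀ X' : List H, X'.length = X.length → ∀ Y' : List H, Y'.length = Y.length →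
      wordTraceMiddle p G E M i t X' Y' = (-1) * (rotWord p ^ t) (fun Y'' => (rotWord p ^ i)
        (fun X'' => wordTraceMiddle p G E M (X.length - i) (Y.length - t) X'' Y'') X') Y' := by
    intro X' hX' Y' hY'
    have := wordTraceMiddle_swap hlin hdeg (X'.take i) (X'.drop i) (Y'.take t) (Y'.drop t)
    rw [List.take_append_drop, List.take_append_drop, List.length_take, List.length_take,
      List.length_drop, List.length_drop, min_eq_left (by omega), min_eq_left (by omega), hX',
      hY'] at this
    rw [this, rotWord_pow_take p _ _ (by omega), rotWord_pow_take p _ _ (by omega)]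
    ring
  have h1 : ∀ Y' : List H, Y'.length = Y.length →
      cycSum p (fun X' => wordTraceMiddle p G E M i t X' Y') X =
        (-1) * (rotWord p ^ t) (fun Y'' => cycSum p
        (fun X'' => wordTraceMiddle p G E M (X.length - i) (Y.length - t) X'' Y'') X) Y' := by
    intro Y' hY'
    rw [cycSum_congr p X fun X' hX' => h X' hX' Y' hY', cycSum_const_mul,
      rotWord_pow_take p _ _ (by omega)]
    simp only [rotWord_pow_take p _ Y' (ht.trans hY'.ge), cycSum_const_mul]
    rw [cycSum_rotWord_pow]
  rw [cycSum_congr p Y h1, cycSum_const_mul, cycSum_rotWord_pow, neg_one_mul]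

theorem cycSum_cycSum_sum_wordTraceMiddle [CharZero k]
    (hlin : ∀ α X L Y, L ≠ [] → M α (X ++ G L :: Y) = ∑ β, M β L * M α (X ++ E β :: Y))
    (hdeg : ∀ α L, L ≠ [] → M α L ≠ 0 → p (E α) = wt p L + 1) (X Y : List H) :
    ∑ t ∈ Finset.range (Y.length + 1), ∑ i ∈ Finset.range (X.length + 1),
      cycSum p (fun Y' => cycSum p (fun X' => wordTraceMiddle p G E M i t X' Y') X) Y = 0 := by
  refine self_eq_neg.1 ?_
  conv_lhs => rw [← Finset.sum_range_reflect]
  rw [← Finset.sum_neg_distrib]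
  refine Finset.sum_congr rfl fun t ht => ?_
  rw [← Finset.sum_range_reflect, ← Finset.sum_neg_distrib]
  refine Finset.sum_congr rfl fun i hi => ?_
  have ht := Finset.mem_range.1 ht
  have hi := Finset.mem_range.1 hi
  rw [cycSum_cycSum_wordTraceMiddle hlin hdeg (by omega) (by omega),
    show X.length - (X.length + 1 - 1 - i) = i by omega,
    show Y.length - (Y.length + 1 - 1 - t) = t by omega]

/-- The wheel is annihilated by the action of the `A_∞`-structure. The hypotheses on the values `G`
and their coordinates `M` are the degree, the `A_∞`-relations, linearity in a letter, and the
vanishing of coordinates of the wrong parity. -/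
theorem wordWheel_closed [CharZero k] (hG : ∀ L, p (G L) = wt p L + 1)
    (hrel : ∀ α L, L ≠ [] → ∑ e ∈ Finset.range (L.length + 1), ∑ i ∈ Finset.range e,
      sgn k (wt p (L.take i)) * M α (graft G i e L) = 0)
    (hlin : ∀ α X L Y, L ≠ [] → M α (X ++ G L :: Y) = ∑ β, M β L * M α (X ++ E β :: Y))
    (hdeg : ∀ α L, L ≠ [] → M α L ≠ 0 → p (E α) = wt p L + 1) (X Y : List H) :
    (∑ i ∈ Finset.range X.length,
      cycSum p (fun X' => wordWheel p E M (graft G 0 (i + 1) X') Y) X) +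
    ∑ i ∈ Finset.range Y.length,
      cycSum p (fun Y' => sgn k (wt p X) * wordWheel p E M X (graft G 0 (i + 1) Y')) Y = 0 := by
  have h1 : ∑ i ∈ Finset.range X.length,
      cycSum p (fun X' => wordWheel p E M (graft G 0 (i + 1) X') Y) X =
      cycSum p (fun Y' => cycSum p (fun X' => ∑ e ∈ Finset.range (X.length + 1),
        ∑ i ∈ Finset.range e, sgn k (wt p (X'.take i)) *
          wordTrace p E M (graft G i e X') Y') X) Y := by
    rw [cycSum_comm]
    have := sum_cycSum_graftSigned hG (fun X' => cycSum p (wordTrace p E M X') Y) X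
    simp only [graftSigned_def, List.take_zero, wt_nil, sgn_zero, one_mul] at this
    have hW : ∀ X', wordWheel p E M X' Y =
        cycSum p (fun X'' => cycSum p (wordTrace p E M X'') Y) X' := fun X' => cycSum_comm p _ _ _
    simp only [hW]
    rw [this]
    simp only [cycSum_sum, cycSum_const_mul]
  have hwt : ∀ F : List H → k, cycSum p (fun X' => sgn k (wt p X') * F X') X =
      sgn k (wt p X) * cycSum p F X := fun F => by
    rw [cycSum_smul p (fun x t => by simp [add_comm])]
  have h2 : ∑ i ∈ Finset.range Y.length,
      cycSum p (fun Y' => sgn k (wt p X) * wordWheel p E M X (graft G 0 (i + 1) Y')) Y =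
      cycSum p (fun Y' => cycSum p (fun X' => ∑ t ∈ Finset.range (Y.length + 1),
        ∑ i ∈ Finset.range t, sgn k (wt p X' + wt p (Y'.take i)) *
          wordTrace p E M X' (graft G i t Y')) X) Y := by
    have := sum_cycSum_graftSigned hG
      (fun Y' => cycSum p (fun X' => wordTrace p E M X' Y') X) Y
    simp only [graftSigned_def, List.take_zero, wt_nil, sgn_zero, one_mul] at this
    simp only [cycSum_const_mul, ← Finset.mul_sum]
    simp only [wordWheel]
    rw [this]
    simp only [cycSum_sum, sgn_add, mul_assoc, hwt, cycSum_const_mul, Finset.mul_sum]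
  have h3 : cycSum p (fun Y' => cycSum p (fun X' => ∑ t ∈ Finset.range (Y.length + 1),
      ∑ i ∈ Finset.range (X.length + 1), wordTraceMiddle p G E M i t X' Y') X) Y = 0 := by
    rw [← cycSum_cycSum_sum_wordTraceMiddle hlin hdeg X Y]
    simp only [cycSum_sum]
  -- The vanishing terms `h3` complete the two actions to the rotation sum of the traced relation.
  rw [h1, h2]
  refine (add_zero _).symm.trans ?_
  conv_lhs => rw [← h3]
  rw [← cycSum_add, ← cycSum_add]
  simp only [← cycSum_add]
  rw [← cycSum_zero (k := k) p Y]
  refine cycSum_congr p Y fun Y' hY' => ?_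
  rw [← cycSum_zero (k := k) p X]
  refine cycSum_congr p X fun X' hX' => ?_
  have := trace_relation (E := E) hG hrel X' Y'
  rw [hX', hY'] at this
  exact this

end Wheel

/-! ### Evaluation of multilinear maps on words of homogeneous elements -/

section Represent

variable {k V W : Type*} [Field k] [AddCommGroup V] [Module k V] [AddCommGroup W] [Module k W]

/-- Homogeneous elements, together with their degree. -/
abbrev Homog (𝒱 : ℤ → Submodule k V) : Type _ := Σ i : ℤ, 𝒱 i

variable {𝒱 : ℤ → Submodule k V}

/-- The element of `V` underlying a homogeneous element. -/
abbrev Homog.val (h : Homog 𝒱) : V := h.2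

/-- The parity of a homogeneous element. -/
def Homog.parity (h : Homog 𝒱) : ZMod 2 := (h.1 : ZMod 2)

theorem exists_homogeneous_basis (𝒱 : ℤ → Submodule k V) [FiniteDimensional k V]
    (h : DirectSum.IsInternal 𝒱) : ∃ (r : ℕ) (E : Fin r → Homog 𝒱)
      (b : Module.Basis (Fin r) k V), ∀ α, b α = (E α).val := by
  have v := fun i => Module.Basis.ofVectorSpace k (𝒱 i)
  have := FiniteDimensional.fintypeBasisIndex (h.collectedBasis v)
  have e := Fintype.equivFin (Σ i, Module.Basis.ofVectorSpaceIndex k (𝒱 i))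
  refine ⟨_, fun α => ⟨(e.symm α).1, v _ (e.symm α).2⟩, (h.collectedBasis v).reindex e,
    fun α => ?_⟩
  simp

/-- The function `φ` of words of homogeneous elements gives the values of `f`. -/
def RepOp {n : ℕ} (f : Multi k V (Fin n) W) (φ : List (Homog 𝒱) → W) : Prop :=
  ∀ x : Fin n → Homog 𝒱, f (fun i => (x i).val) = φ (List.ofFn x)

/-- The function `F` of pairs of words of homogeneous elements gives the values of `q`. -/
def RepForm {m n : ℕ} (q : Form k V m n) (F : List (Homog 𝒱) → List (Homog 𝒱) → k) : Prop :=
  ∀ (x : Fin m → Homog 𝒱) (y : Fin n → Homog 𝒱),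
    q (Sum.elim (fun i => (x i).val) (fun i => (y i).val)) = F (List.ofFn x) (List.ofFn y)

theorem RepOp.apply {n : ℕ} {f : Multi k V (Fin n) W} {φ : List (Homog 𝒱) → W} (h : RepOp f φ)
    (z : Fin n → V) (L : List (Homog 𝒱)) (hL : L.length = n)
    (hz : ∀ (i : ℕ) (hi : i < n), z ⟨i, hi⟩ = (L[i]'(hL ▸ hi)).val) : f z = φ L := by
  subst hL
  have := h (fun i => L.get i)
  rw [List.ofFn_get] at this
  rw [← this]
  congr 1
  funext i
  exact hz i.1 i.2

theorem RepForm.apply {m n : ℕ} {q : Form k V m n} {F : List (Homog 𝒱) → List (Homog 𝒱) → k}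
    (h : RepForm q F) (z : Fin m ⊕ Fin n → V) (X Y : List (Homog 𝒱)) (hX : X.length = m)
    (hY : Y.length = n)
    (hz : ∀ (i : ℕ) (hi : i < m), z (Sum.inl ⟨i, hi⟩) = (X[i]'(hX ▸ hi)).val)
    (hz' : ∀ (i : ℕ) (hi : i < n), z (Sum.inr ⟨i, hi⟩) = (Y[i]'(hY ▸ hi)).val) : q z = F X Y := by
  subst hX hY
  have := h (fun i => X.get i) (fun i => Y.get i)
  rw [List.ofFn_get, List.ofFn_get] at this
  rw [← this]
  congr 1
  funext i
  rcases i with i | i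
  · exact hz i.1 i.2
  · exact hz' i.1 i.2

theorem RepOp.congr {n : ℕ} {f : Multi k V (Fin n) W} {φ ψ : List (Homog 𝒱) → W} (h : RepOp f φ)
    (e : ∀ L, L.length = n → φ L = ψ L) : RepOp f ψ := fun x => by
  rw [h x, e _ (by simp)]

theorem RepForm.congr {m n : ℕ} {q : Form k V m n} {F F' : List (Homog 𝒱) → List (Homog 𝒱) → k}
    (h : RepForm q F) (e : ∀ X Y, X.length = m → Y.length = n → F X Y = F' X Y) :
    RepForm q F' := fun x y => by
  rw [h x y, e _ _ (by simp) (by simp)]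

theorem RepOp.eq_of_length {n : ℕ} {f : Multi k V (Fin n) W} {φ ψ : List (Homog 𝒱) → W}
    (h : RepOp f φ) (h' : RepOp f ψ) (L : List (Homog 𝒱)) (hL : L.length = n) : φ L = ψ L := by
  subst hL
  have h1 := h (fun i => L.get i)
  have h2 := h' (fun i => L.get i)
  rw [List.ofFn_get] at h1 h2
  rw [← h1, h2]

theorem RepForm.eq_of_length {m n : ℕ} {q : Form k V m n}
    {F F' : List (Homog 𝒱) → List (Homog 𝒱) → k} (h : RepForm q F) (h' : RepForm q F')
    (X Y : List (Homog 𝒱)) (hX : X.length = m) (hY : Y.length = n) : F X Y = F' X Y := by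
  subst hX hY
  have h1 := h (fun i => X.get i) (fun i => Y.get i)
  have h2 := h' (fun i => X.get i) (fun i => Y.get i)
  rw [List.ofFn_get, List.ofFn_get] at h1 h2
  rw [← h1, h2]

theorem RepOp.ext [FiniteDimensional k V] (hV : DirectSum.IsInternal 𝒱) {n : ℕ}
    {f g : Multi k V (Fin n) W} {φ : List (Homog 𝒱) → W} (hf : RepOp f φ) (hg : RepOp g φ) :
    f = g := by
  obtain ⟨r, E, b, hb⟩ := exists_homogeneous_basis 𝒱 hV
  refine Module.Basis.ext_multilinear (fun _ => b) fun v => ?_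
  simp only [hb]
  rw [hf (fun i => E (v i)), hg (fun i => E (v i))]

theorem RepForm.ext [FiniteDimensional k V] (hV : DirectSum.IsInternal 𝒱) {m n : ℕ}
    {q q' : Form k V m n} {F : List (Homog 𝒱) → List (Homog 𝒱) → k} (hq : RepForm q F)
    (hq' : RepForm q' F) : q = q' := by
  obtain ⟨r, E, b, hb⟩ := exists_homogeneous_basis 𝒱 hV
  refine Module.Basis.ext_multilinear (fun _ => b) fun v => ?_
  have h : (fun i => b (v i)) = Sum.elim (fun i => (E (v (Sum.inl i))).val)
      (fun i => (E (v (Sum.inr i))).val) := by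
    funext i
    rcases i with i | i <;> simp [hb]
  rw [h, hq (fun i => E (v (Sum.inl i))) (fun i => E (v (Sum.inr i))),
    hq' (fun i => E (v (Sum.inl i))) (fun i => E (v (Sum.inr i)))]

section Linear

variable {m n : ℕ} {q q' : Form k V m n} {F F' : List (Homog 𝒱) → List (Homog 𝒱) → k}
  {f f' : Multi k V (Fin n) W} {φ φ' : List (Homog 𝒱) → W}

theorem RepForm.add (h : RepForm q F) (h' : RepForm q' F') :
    RepForm (q + q') (fun X Y => F X Y + F' X Y) := fun x y => by
  beta_reduce; rw [← h x y, ← h' x y]; rfl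

theorem RepForm.smul (h : RepForm q F) (c : k) : RepForm (c • q) (fun X Y => c * F X Y) :=
  fun x y => by beta_reduce; rw [← h x y]; rfl

theorem RepForm.zero : RepForm (0 : Form k V m n) (fun (_ _ : List (Homog 𝒱)) => 0) :=
  fun _ _ => rfl

theorem RepForm.sum {κ : Type*} {s : Finset κ} {q : κ → Form k V m n}
    {F : κ → List (Homog 𝒱) → List (Homog 𝒱) → k} (h : ∀ i ∈ s, RepForm (q i) (F i)) :
    RepForm (∑ i ∈ s, q i) (fun X Y => ∑ i ∈ s, F i X Y) := fun x y => by
  rw [sum_apply]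
  exact Finset.sum_congr rfl fun i hi => h i hi x y

theorem RepOp.sub (h : RepOp f φ) (h' : RepOp f' φ') :
    RepOp (f - f') (fun L => φ L - φ' L) := fun x => by
  beta_reduce; rw [← h x, ← h' x]; rfl

theorem RepOp.smul (h : RepOp f φ) (c : k) : RepOp (c • f) (fun L => c • φ L) :=
  fun x => by beta_reduce; rw [← h x]; rfl

theorem RepOp.zero : RepOp (0 : Multi k V (Fin n) W) (fun (_ : List (Homog 𝒱)) => 0) :=
  fun _ => rfl

theorem RepOp.sum {κ : Type*} {s : Finset κ} {f : κ → Multi k V (Fin n) W}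
    {φ : κ → List (Homog 𝒱) → W} (h : ∀ i ∈ s, RepOp (f i) (φ i)) :
    RepOp (∑ i ∈ s, f i) (fun L => ∑ i ∈ s, φ i L) := fun x => by
  rw [sum_apply]
  exact Finset.sum_congr rfl fun i hi => h i hi x

end Linear

/-! ### Signs on words -/

theorem sum_parity_eq_wt {n : ℕ} (x : Fin n → Homog 𝒱) :
    ∑ i, (x i).parity = wt Homog.parity (List.ofFn x) := by
  rw [wt, List.map_ofFn, List.sum_ofFn]
  rfl

theorem sum_parity_lt_eq_wt_take {n : ℕ} (x : Fin n → Homog 𝒱) (s : ℕ) :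
    (∑ i : Fin n, if i.1 < s then (x i).parity else 0) =
      wt Homog.parity ((List.ofFn x).take s) := by
  induction n generalizing s with
  | zero => simp
  | succ n ih =>
    rw [Fin.sum_univ_succ, List.ofFn_succ]
    cases s with
    | zero => simp
    | succ s =>
      rw [List.take_succ_cons, wt_cons, ← ih]
      simp

theorem sum_parity_add_one {n : ℕ} (x : Fin n → Homog 𝒱) :
    ∑ i, ((x i).parity + 1) = wt Homog.parity (List.ofFn x) + n := by
  rw [Finset.sum_add_distrib, sum_parity_eq_wt]
  simp

theorem sum_parity_add_one_lt {n : ℕ} (x : Fin n → Homog 𝒱) {s : ℕ} (hs : s ≤ n) :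
    (∑ i : Fin n, if i.1 < s then (x i).parity + 1 else 0) =
      wt Homog.parity ((List.ofFn x).take s) + s := by
  have h : ∀ i : Fin n, (if i.1 < s then (x i).parity + 1 else 0) =
      (if i.1 < s then (x i).parity else 0) + if i.1 < s then 1 else 0 := fun i => by
    split_ifs <;> simp
  simp only [h]
  rw [Finset.sum_add_distrib, sum_parity_lt_eq_wt_take]
  congr 1
  rw [Fin.sum_univ_eq_sum_range (fun i => if i < s then (1 : ZMod 2) else 0) n,
    ← Finset.sum_filter, Finset.sum_const, nsmul_one]
  congr 1
  rw [show (Finset.range n).filter (· < s) = Finset.range s by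
    ext i; simp only [Finset.mem_filter, Finset.mem_range]; omega, Finset.card_range]

/-- The exponent `∑ (n - p) |x_p|`, for `p = 1, …, n`, of the sign by which `s^{⊗n}` acts on a word
of length `n`: each letter has to pass the copies of `s` to its right. -/
def suspSign : List (Homog 𝒱) → ZMod 2
  | [] => 0
  | x :: L => L.length * x.parity + suspSign L

@[simp] theorem suspSign_nil : suspSign ([] : List (Homog 𝒱)) = 0 := rfl

@[simp] theorem suspSign_cons (x : Homog 𝒱) (L : List (Homog 𝒱)) :
    suspSign (x :: L) = L.length * x.parity + suspSign L := rfl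

@[simp] theorem suspSign_append (A B : List (Homog 𝒱)) :
    suspSign (A ++ B) = suspSign A + B.length * wt Homog.parity A + suspSign B := by
  induction A with
  | nil => simp
  | cons x A ih =>
    rw [List.cons_append, suspSign_cons, suspSign_cons, ih, wt_cons, List.length_append]
    push_cast
    ring

theorem sum_eq_suspSign {n : ℕ} (x : Fin n → Homog 𝒱) :
    ∑ i : Fin n, ((n - 1 - i.1 : ℕ) : ZMod 2) * (x i).parity = suspSign (List.ofFn x) := by
  induction n with
  | zero => simp
  | succ n ih =>
    rw [Fin.sum_univ_succ, List.ofFn_succ, suspSign_cons, ← ih]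
    congr 1
    · simp
    · refine Finset.sum_congr rfl fun i _ => ?_
      congr 2
      simp only [Fin.val_succ]
      omega

end Represent

/-! ### Twisting by signs -/

section Twist

variable {k V W : Type*} [Field k] [AddCommGroup V] [Module k V] [AddCommGroup W] [Module k W]
  {𝒱 : ℤ → Submodule k V} [DirectSum.Decomposition 𝒱]

theorem RepOp.twist {n : ℕ} {f : Multi k V (Fin n) W} {φ : List (Homog 𝒱) → W} (h : RepOp f φ)
    {e : (Fin n → ZMod 2) → ZMod 2} {E : List (Homog 𝒱) → ZMod 2}
    (he : ∀ x : Fin n → Homog 𝒱, e (fun i => (x i).parity) = E (List.ofFn x)) :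
    RepOp (twist 𝒱 e f) (fun L => sgn k (E L) • φ L) := fun x => by
  beta_reduce
  rw [twist_apply_of_mem 𝒱 e f (fun i => (x i).1) _ (fun i => (x i).2.2), h x, ← he x]
  rfl

theorem RepForm.twist {m n : ℕ} {q : Form k V m n} {F : List (Homog 𝒱) → List (Homog 𝒱) → k}
    (h : RepForm q F) {e : (Fin m ⊕ Fin n → ZMod 2) → ZMod 2}
    {E : List (Homog 𝒱) → List (Homog 𝒱) → ZMod 2}
    (he : ∀ (x : Fin m → Homog 𝒱) (y : Fin n → Homog 𝒱),
      e (Sum.elim (fun i => (x i).parity) (fun i => (y i).parity)) =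
        E (List.ofFn x) (List.ofFn y)) :
    RepForm (twist 𝒱 e q) (fun X Y => sgn k (E X Y) * F X Y) := fun x y => by
  beta_reduce
  rw [twist_apply_of_mem 𝒱 e q (Sum.elim (fun i => (x i).1) (fun i => (y i).1)) _
    (by rintro (i | i); exacts [(x i).2.2, (y i).2.2]), h x y, ← he x y, smul_eq_mul]
  congr 3
  funext i
  rcases i with i | i <;> rfl

/-- Signs that refer to the degrees in `V` are evaluated on words in `V[1]`: all parities
change. -/
theorem RepOp.twist_unshift {n : ℕ} {f : Multi k V (Fin n) W}
    {φ : List (Homog (shift 𝒱)) → W} (h : RepOp f φ)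
    {e : (Fin n → ZMod 2) → ZMod 2} {E : List (Homog (shift 𝒱)) → ZMod 2}
    (he : ∀ x : Fin n → Homog (shift 𝒱), e (fun i => (x i).parity + 1) = E (List.ofFn x)) :
    RepOp (UnimodAInf.twist 𝒱 e f) (fun L => sgn k (E L) • φ L) := fun x => by
  beta_reduce
  rw [twist_apply_of_mem 𝒱 e f (fun i => (x i).1 + 1) _ (fun i => (x i).2.2), h x, ← he x]
  simp [Homog.parity]

theorem RepForm.twist_unshift {m n : ℕ} {q : Form k V m n}
    {F : List (Homog (shift 𝒱)) → List (Homog (shift 𝒱)) → k}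
    (h : RepForm q F) {e : (Fin m ⊕ Fin n → ZMod 2) → ZMod 2}
    {E : List (Homog (shift 𝒱)) → List (Homog (shift 𝒱)) → ZMod 2}
    (he : ∀ (x : Fin m → Homog (shift 𝒱)) (y : Fin n → Homog (shift 𝒱)),
      e (Sum.elim (fun i => (x i).parity + 1) (fun i => (y i).parity + 1)) =
        E (List.ofFn x) (List.ofFn y)) :
    RepForm (UnimodAInf.twist 𝒱 e q) (fun X Y => sgn k (E X Y) * F X Y) := fun x y => by
  beta_reduce
  rw [twist_apply_of_mem 𝒱 e q (Sum.elim (fun i => (x i).1 + 1) (fun i => (y i).1 + 1)) _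
    (by rintro (i | i); exacts [(x i).2.2, (y i).2.2]), h x y, ← he x y, smul_eq_mul]
  congr 3
  funext i
  rcases i with i | i <;> simp [Homog.parity]

end Twist

/-! ### Rotations, insertions and traces on words -/

section Places

variable {k V W : Type*} [Field k] [AddCommGroup V] [Module k V] [AddCommGroup W] [Module k W]
  {𝒱 : ℤ → Submodule k V}

theorem sum_first_mul_rest {m : ℕ} (ε : Fin (m + 1) → ZMod 2) :
    (∑ p : Fin (m + 1), ∑ p' : Fin (m + 1), if p.1 = 0 ∧ 0 < p'.1 then ε p * ε p' else 0) =
      ε 0 * ∑ p : Fin m, ε p.succ := by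
  rw [Fin.sum_univ_succ]
  simp [Fin.sum_univ_succ, Finset.mul_sum]

theorem getElem_rotate_ofFn {m : ℕ} {α : Type*} (x : Fin m → α) (i : ℕ) (hi : i < m) :
    x (finRotate m ⟨i, hi⟩) =
      ((List.ofFn x).drop 1 ++ (List.ofFn x).take 1)[i]'(by simp; omega) := by
  obtain ⟨m, rfl⟩ : ∃ m', m = m' + 1 := ⟨m - 1, by omega⟩
  rcases Nat.lt_succ_iff_lt_or_eq.1 hi with h | rfl
  · rw [finRotate_of_lt h, List.getElem_append_left (by simpa using h)]
    simp
  · rw [finRotate_last', List.getElem_append_right (by simp)]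
    simp

/-- The exponent of the Koszul sign of the rotation, in terms of parities shifted by `c`. -/
def rotExponent (c : ZMod 2) : List (Homog 𝒱) → ZMod 2
  | [] => 0
  | x :: t => (x.parity + c) * (wt Homog.parity t + t.length * c)

theorem sum_eq_rotExponent {m : ℕ} (c : ZMod 2) (x : Fin m → Homog 𝒱) :
    (∑ p : Fin m, ∑ p' : Fin m, if p.1 = 0 ∧ 0 < p'.1 then
      ((x p).parity + c) * ((x p').parity + c) else 0) = rotExponent c (List.ofFn x) := by
  cases m with
  | zero => simp [rotExponent]
  | succ m =>
    rw [sum_first_mul_rest (fun p => (x p).parity + c), List.ofFn_succ, rotExponent,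
      Finset.sum_add_distrib, sum_parity_eq_wt]
    simp

theorem rotWord_eq_rotExponent (φ : List (Homog 𝒱) → k) (X : List (Homog 𝒱)) :
    rotWord Homog.parity φ X = sgn k (rotExponent 0 X) * φ (X.drop 1 ++ X.take 1) := by
  cases X with
  | nil => simp [rotWord_nil, rotExponent]
  | cons x t => simp [rotWord_cons, rotExponent]

/-- The suspension sign intertwines the rotation of words in `V` with its extra sign
`(-1)^{m+1}` and the rotation of words in `V[1]`. -/
theorem suspSign_rotate {X : List (Homog 𝒱)} (hX : X ≠ []) :
    (X.length + 1 : ZMod 2) + rotExponent 1 X + suspSign (X.drop 1 ++ X.take 1) =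
      suspSign X + rotExponent 0 X := by
  obtain ⟨x, t, rfl⟩ := List.exists_cons_of_ne_nil hX
  simp only [rotExponent, List.drop_succ_cons, List.drop_zero, List.take_succ_cons,
    List.take_zero, suspSign_append, suspSign_cons, suspSign_nil, List.length_cons,
    List.length_nil]
  push_cast
  generalize x.parity = a
  generalize wt Homog.parity t = b
  generalize suspSign t = c
  generalize (t.length : ZMod 2) = d
  revert a b c d
  decide

theorem length_take_succ {α : Type*} {i m : ℕ} (hi : i < m) {L : List α} (hL : L.length = m) :
    (L.take (i + 1)).length = i + 1 := by
  rw [List.length_take, hL, min_eq_left hi]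

theorem RepForm.domDomCongr_left {m n : ℕ} {q : Form k V m n}
    {F : List (Homog 𝒱) → List (Homog 𝒱) → k} (h : RepForm q F) :
    RepForm (MultilinearMap.domDomCongrLinearEquiv k k V k
      (Equiv.sumCongr (finRotate m) (Equiv.refl (Fin n))) q)
      (fun X Y => F (X.drop 1 ++ X.take 1) Y) := by
  intro x y
  refine h.apply _ _ _ (by simp; omega) (by simp) ?_ ?_
  · intro i hi
    simp only [Equiv.sumCongr_apply, Sum.map_inl, Sum.elim_inl]
    rw [← getElem_rotate_ofFn]
  · intro i hi
    simp

theorem RepForm.domDomCongr_right {m n : ℕ} {q : Form k V m n}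
    {F : List (Homog 𝒱) → List (Homog 𝒱) → k} (h : RepForm q F) :
    RepForm (MultilinearMap.domDomCongrLinearEquiv k k V k
      (Equiv.sumCongr (Equiv.refl (Fin m)) (finRotate n)) q)
      (fun X Y => F X (Y.drop 1 ++ Y.take 1)) := by
  intro x y
  refine h.apply _ _ _ (by simp) (by simp; omega) ?_ ?_
  · intro i hi
    simp
  · intro i hi
    simp only [Equiv.sumCongr_apply, Sum.map_inr, Sum.elim_inr]
    rw [← getElem_rotate_ofFn]

/-! #### Insertions -/

variable {G : List (Homog 𝒱) → Homog 𝒱} {c : List (Homog 𝒱) → k}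

theorem RepForm.plug_left {m n : ℕ} {i : Fin m} {q : Form k V (m - i) n}
    {g : Multi k V (Fin (i.1 + 1)) V} {F : List (Homog 𝒱) → List (Homog 𝒱) → k}
    (hq : RepForm q F) (hg : RepOp g (fun L => c L • (G L).val)) :
    RepForm (insertLeft i q g)
      (fun X Y => c (X.take (i + 1)) * F (graft G 0 (i + 1) X) Y) := by
  intro x y
  have hgv : g ((Sum.elim (fun i => (x i).val) fun i => (y i).val) ∘
      fun r => Sum.inl (innerIdx i ⟨0, by omega⟩ r)) =
        c ((List.ofFn x).take (i + 1)) • (G ((List.ofFn x).take (i + 1))).val := by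
    refine hg.apply _ _ (length_take_succ i.2 (by simp)) fun r hr => ?_
    simp [innerIdx]
  change q (Function.update _ _ (g _)) = _
  rw [hgv, q.map_update_smul, smul_eq_mul]
  congr 1
  refine hq.apply _ _ _ ?_ (by simp) (fun r hr => ?_) (fun r hr => ?_)
  · rw [length_graft _ (by omega) (by simp)]
    simp
  · cases r with
    | zero => simp [graft]
    | succ r =>
      rw [Function.update_of_ne (by simp)]
      simp [graft, outerIdx]
      congr 3
      omega
  · rw [Function.update_of_ne (by simp)]
    simp

theorem RepForm.plug_right {m n : ℕ} {i : Fin n} {q : Form k V m (n - i)}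
    {g : Multi k V (Fin (i.1 + 1)) V} {F : List (Homog 𝒱) → List (Homog 𝒱) → k}
    (hq : RepForm q F) (hg : RepOp g (fun L => c L • (G L).val)) :
    RepForm (plug q (Sum.inr ⟨0, by omega⟩) g _ _ (insertRight_bijective m i))
      (fun X Y => c (Y.take (i + 1)) * F X (graft G 0 (i + 1) Y)) := by
  intro x y
  have hgv : g ((Sum.elim (fun i => (x i).val) fun i => (y i).val) ∘
      fun r => Sum.inr (innerIdx i ⟨0, by omega⟩ r)) =
        c ((List.ofFn y).take (i + 1)) • (G ((List.ofFn y).take (i + 1))).val := by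
    refine hg.apply _ _ (length_take_succ i.2 (by simp)) fun r hr => ?_
    simp [innerIdx]
  change q (Function.update _ _ (g _)) = _
  rw [hgv, q.map_update_smul, smul_eq_mul]
  congr 1
  refine hq.apply _ _ _ (by simp) ?_ (fun r hr => ?_) (fun r hr => ?_)
  · rw [length_graft _ (by omega) (by simp)]
    simp
  · rw [Function.update_of_ne (by simp)]
    simp
  · cases r with
    | zero => simp [graft]
    | succ r =>
      rw [Function.update_of_ne (by simp)]
      simp [graft, outerIdx]
      congr 3
      omega

/-- Values of an insertion on words. The inner operation has values `c L • G L` with `G L`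
homogeneous, so that sign factors can be kept apart from the homogeneous element. -/
theorem RepOp.plug {n : ℕ} {j : Fin n} {i : Fin (n - j)} {f : Multi k V (Fin (n - j)) V}
    {g : Multi k V (Fin (j.1 + 1)) V} {φ : List (Homog 𝒱) → V}
    (hf : RepOp f φ) (hg : RepOp g (fun L => c L • (G L).val)) :
    RepOp (plug f i g (outerIdx j i) (innerIdx j i) (insert_bijective j i))
      (fun L => c ((L.take (i + j + 1)).drop i) • φ (graft G i (i + j + 1) L)) := by
  intro x
  have hgv : g ((fun i => (x i).val) ∘ innerIdx j i) =
        c (((List.ofFn x).take (i + j + 1)).drop i) •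
          (G (((List.ofFn x).take (i + j + 1)).drop i)).val := by
    have := i.2
    have := j.2
    refine hg.apply _ _ ?_ fun r hr => ?_
    · simp only [List.length_drop, List.length_take, List.length_ofFn]
      omega
    · simp [innerIdx]
  change f (Function.update _ _ (g _)) = _
  rw [hgv, f.map_update_smul]
  congr 1
  refine hf.apply _ _ ?_ (fun r hr => ?_)
  · rw [length_graft _ (by omega) (by simp; omega)]
    simp; omega
  · rcases lt_trichotomy r i with h | h | h
    · rw [Function.update_of_ne (by simp [Fin.ext_iff]; omega)]
      simp only [graft]
      rw [List.getElem_append_left (by simp; omega)]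
      simp [outerIdx, h.le]
    · subst h
      simp only [graft]
      rw [Function.update_self, List.getElem_append_right (by simp)]
      have h0 : i.1 - ((List.ofFn x).take i).length = 0 := by simp; omega
      simp only [h0, List.getElem_cons_zero]
    · rw [Function.update_of_ne (by simp [Fin.ext_iff]; omega)]
      simp only [graft]
      rw [List.getElem_append_right (by simp; omega)]
      have h0 : r - ((List.ofFn x).take i).length = (r - i - 1) + 1 := by simp; omega
      simp only [h0, List.getElem_cons_succ, List.getElem_drop, List.getElem_ofFn,
        Function.comp_apply, outerIdx]
      rw [if_neg (by simp; omega)]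
      congr 3
      omega

theorem getElem_graft_one {n : ℕ} {d : V →ₗ[k] V} (hd : ∀ z, (G [z]).val = d z.val)
    (x : Fin n → Homog 𝒱) {s r : ℕ} (hs : s < n) (hr : r < n) :
    ((graft G s (s + 1) (List.ofFn x))[r]'(by
      rw [length_graft _ (by omega) (by simpa using hs)]; simpa using hr)).val =
      if r = s then d (x ⟨r, hr⟩).val else (x ⟨r, hr⟩).val := by
  simp only [graft]
  rcases lt_trichotomy r s with h | rfl | h
  · rw [List.getElem_append_left (by simp; omega), if_neg h.ne]
    simp
  · rw [List.getElem_append_right (by simp), if_pos rfl, ← hd]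
    have h0 : r - ((List.ofFn x).take r).length = 0 := by simp; omega
    simp only [h0, List.getElem_cons_zero]
    rw [List.take_succ_eq_append_getElem (by simpa using hr), List.drop_append_of_le_length
      (by simp; omega)]
    simp
  · rw [List.getElem_append_right (by simp; omega), if_neg h.ne']
    have h0 : r - ((List.ofFn x).take s).length = (r - s - 1) + 1 := by simp; omega
    simp only [h0, List.getElem_cons_succ, List.getElem_drop, List.getElem_ofFn]
    congr 3
    omega

theorem RepOp.compLinearMap_update {n : ℕ} {f : Multi k V (Fin n) W} {φ : List (Homog 𝒱) → W}
    (h : RepOp f φ) {d : V →ₗ[k] V} (hd : ∀ z, (G [z]).val = d z.val) (s : Fin n) :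
    RepOp (f.compLinearMap (Function.update (fun _ => LinearMap.id) s d))
      (fun L => φ (graft G s (s + 1) L)) := by
  intro x
  refine h.apply _ _ ?_ fun r hr => ?_
  · rw [length_graft _ (by omega) (by simp)]
    simp
  · rw [getElem_graft_one hd x s.2 hr]
    split_ifs with h
    · subst h; simp
    · rw [Function.update_of_ne (by simpa [Fin.ext_iff] using h)]; rfl

theorem RepForm.compLinearMap_update_left {m n : ℕ} {q : Form k V m n}
    {F : List (Homog 𝒱) → List (Homog 𝒱) → k} (h : RepForm q F) {d : V →ₗ[k] V}
    (hd : ∀ z, (G [z]).val = d z.val) (s : Fin m) :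
    RepForm (q.compLinearMap (Function.update (fun _ => LinearMap.id) (Sum.inl s) d))
      (fun X Y => F (graft G s (s + 1) X) Y) := by
  intro x y
  refine h.apply _ _ _ ?_ (by simp) (fun r hr => ?_) (fun r hr => ?_)
  · rw [length_graft _ (by omega) (by simp)]
    simp
  · rw [getElem_graft_one hd x s.2 hr]
    split_ifs with h
    · subst h; simp
    · rw [Function.update_of_ne (by simpa [Fin.ext_iff] using h)]; rfl
  · rw [Function.update_of_ne (by simp)]; simp

theorem RepForm.compLinearMap_update_right {m n : ℕ} {q : Form k V m n}
    {F : List (Homog 𝒱) → List (Homog 𝒱) → k} (h : RepForm q F) {d : V →ₗ[k] V}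
    (hd : ∀ z, (G [z]).val = d z.val) (s : Fin n) :
    RepForm (q.compLinearMap (Function.update (fun _ => LinearMap.id) (Sum.inr s) d))
      (fun X Y => F X (graft G s (s + 1) Y)) := by
  intro x y
  refine h.apply _ _ _ (by simp) ?_ (fun r hr => ?_) (fun r hr => ?_)
  · rw [length_graft _ (by omega) (by simp)]
    simp
  · rw [Function.update_of_ne (by simp)]; simp
  · rw [getElem_graft_one hd y s.2 hr]
    split_ifs with h
    · subst h; simp
    · rw [Function.update_of_ne (by simpa [Fin.ext_iff] using h)]; rfl

/-! #### Traces -/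

theorem slotArgs_getElem {m n : ℕ} (x : Fin m → Homog 𝒱) (y : Fin n → Homog 𝒱) (z : Homog 𝒱)
    (i : ℕ) (hi : i < m + 1 + n) :
    slotArgs (Sum.elim (fun i => (x i).val) fun i => (y i).val) z.val ⟨i, hi⟩ =
      ((List.ofFn x ++ z :: List.ofFn y)[i]'(by simp; omega)).val := by
  rcases lt_trichotomy i m with h | rfl | h
  · rw [List.getElem_append_left (by simpa using h)]
    rw [show (⟨i, hi⟩ : Fin (m + 1 + n)) = Fin.castAdd n (Fin.castAdd 1 ⟨i, h⟩) from rfl,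
      slotArgs, Fin.append_left, Fin.append_left]
    simp
  · rw [List.getElem_append_right (by simp)]
    rw [show (⟨i, hi⟩ : Fin (i + 1 + n)) = Fin.castAdd n (Fin.natAdd i 0) from rfl,
      slotArgs, Fin.append_left, Fin.append_right]
    simp
  · obtain ⟨j, rfl⟩ : ∃ j, i = m + 1 + j := ⟨i - (m + 1), by omega⟩
    rw [List.getElem_append_right (by simp; omega)]
    rw [show (⟨m + 1 + j, hi⟩ : Fin (m + 1 + n)) = Fin.natAdd (m + 1) ⟨j, by omega⟩ from rfl,
      slotArgs, Fin.append_right]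
    have h0 : m + 1 + j - (List.ofFn x).length = j + 1 := by simp; omega
    simp only [h0, List.getElem_cons_succ]
    simp

theorem slotArgs_eq_update {m n : ℕ} (x : Fin m ⊕ Fin n → V) (v : V) :
    slotArgs x v = Function.update (slotArgs x 0) ⟨m, by omega⟩ v := by
  funext p
  induction p using Fin.addCases with
  | left p =>
    induction p using Fin.addCases with
    | left p =>
      rw [Function.update_of_ne (by simp [Fin.ext_iff]; omega)]
      simp only [slotArgs, Fin.append_left]
    | right p =>
      rw [show (⟨m, by omega⟩ : Fin (m + 1 + n)) = Fin.castAdd n (Fin.natAdd m p) by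
        ext; simp, Function.update_self, slotArgs, Fin.append_left, Fin.append_right]
  | right p =>
    rw [Function.update_of_ne (by simp [Fin.ext_iff]; omega)]
    simp only [slotArgs, Fin.append_right]

/-- The sign exponent `|x_m| (1 + |x_{m+1}| + ⋯)` of the supertrace on words, in terms of
parities shifted by `a`. -/
def traceExponent (a : ZMod 2) (m : ℕ) (L : List (Homog 𝒱)) : ZMod 2 :=
  (wt Homog.parity ((L.drop m).take 1) + a) *
    (1 + (wt Homog.parity (L.drop (m + 1)) + (L.drop (m + 1)).length * a))

theorem traceExponent_append (a : ZMod 2) {m : ℕ} {X : List (Homog 𝒱)} (hX : X.length = m)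
    (z : Homog 𝒱) (Y : List (Homog 𝒱)) :
    traceExponent a m (X ++ z :: Y) =
      (z.parity + a) * (1 + (wt Homog.parity Y + Y.length * a)) := by
  have h : (X ++ z :: Y).drop (m + 1) = Y := by
    rw [← List.singleton_append, ← List.append_assoc]
    exact List.drop_left' (by simp [hX])
  rw [traceExponent, h, List.drop_left' hX]
  simp

theorem slot_eq_traceExponent {m n : ℕ} (a : ZMod 2) (x : Fin (m + 1 + n) → Homog 𝒱) :
    ((x ⟨m, by omega⟩).parity + a) *
      (1 + ∑ p : Fin n, ((x (Fin.natAdd (m + 1) p)).parity + a)) =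
        traceExponent a m (List.ofFn x) := by
  have h : List.ofFn x = (List.ofFn fun i : Fin m => x (Fin.castAdd n (Fin.castAdd 1 i))) ++
      x ⟨m, by omega⟩ :: List.ofFn fun i : Fin n => x (Fin.natAdd (m + 1) i) := by
    rw [List.ofFn_add, List.ofFn_add, List.append_assoc]
    rfl
  rw [h, traceExponent_append a (by simp), Finset.sum_add_distrib,
    sum_parity_eq_wt (fun p => x (Fin.natAdd (m + 1) p))]
  simp

end Places

section Operations

variable {k V W : Type*} [Field k] [AddCommGroup V] [Module k V] [AddCommGroup W] [Module k W]
  {𝒱 : ℤ → Submodule k V} [DirectSum.Decomposition 𝒱]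

theorem RepForm.rotLeft {m n : ℕ} {q : Form k V m n}
    {F : List (Homog 𝒱) → List (Homog 𝒱) → k} (h : RepForm q F) :
    RepForm (rotLeft 𝒱 m n q) (fun X Y => rotWord Homog.parity (fun X' => F X' Y) X) := by
  refine (h.domDomCongr_left.twist (E := fun X _ => rotExponent 0 X) fun x y => ?_).congr
    fun X Y _ _ => (rotWord_eq_rotExponent (fun X' => F X' Y) X).symm
  rw [← sum_eq_rotExponent]
  simp

theorem RepForm.rotRight {m n : ℕ} {q : Form k V m n}
    {F : List (Homog 𝒱) → List (Homog 𝒱) → k} (h : RepForm q F) :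
    RepForm (rotRight 𝒱 m n q) (fun X Y => rotWord Homog.parity (F X) Y) := by
  refine (h.domDomCongr_right.twist (E := fun _ Y => rotExponent 0 Y) fun x y => ?_).congr
    fun X Y _ _ => (rotWord_eq_rotExponent (F X) Y).symm
  rw [← sum_eq_rotExponent]
  simp

theorem RepForm.rotLeft_pow {m n : ℕ} {q : Form k V m n}
    {F : List (Homog 𝒱) → List (Homog 𝒱) → k} (h : RepForm q F) (a : ℕ) :
    RepForm ((UnimodAInf.rotLeft 𝒱 m n ^ a) q)
      (fun X Y => (rotWord Homog.parity ^ a) (fun X' => F X' Y) X) := by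
  induction a with
  | zero => exact h
  | succ a ih =>
    simp only [pow_succ', Module.End.mul_apply]
    exact ih.rotLeft

theorem RepForm.rotRight_pow {m n : ℕ} {q : Form k V m n}
    {F : List (Homog 𝒱) → List (Homog 𝒱) → k} (h : RepForm q F) (a : ℕ) :
    RepForm ((UnimodAInf.rotRight 𝒱 m n ^ a) q)
      (fun X Y => (rotWord Homog.parity ^ a) (F X) Y) := by
  induction a with
  | zero => exact h
  | succ a ih =>
    simp only [pow_succ', Module.End.mul_apply]
    exact ih.rotRight

/-- The signed rotation `(-1)^{m+1} ζ` on `V` becomes the plain rotation on `V[1]` once the form is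
multiplied by the suspension sign. -/
theorem RepForm.signedRotLeft_pow {m n : ℕ} {q : Form k V m n}
    {F : List (Homog (shift 𝒱)) → List (Homog (shift 𝒱)) → k}
    {c : ZMod 2 → List (Homog (shift 𝒱)) → ZMod 2}
    (h : RepForm q (fun X Y => sgn k (suspSign X + c (wt Homog.parity X) Y) * F X Y)) {a : ℕ}
    (ha : a = 0 ∨ 1 ≤ m) :
    RepForm ((signedRotLeft 𝒱 m n ^ a) q)
      (fun X Y => sgn k (suspSign X + c (wt Homog.parity X) Y) *
        (rotWord Homog.parity ^ a) (fun X' => F X' Y) X) := by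
  induction a with
  | zero => exact h
  | succ a ih =>
    have hm : 1 ≤ m := ha.resolve_left (Nat.succ_ne_zero a)
    have ih := ih (Or.inr hm)
    simp only [pow_succ', Module.End.mul_apply]
    refine ((ih.domDomCongr_left.twist_unshift (E := fun X _ => rotExponent 1 X)
      fun x y => ?_).smul ((-1) ^ (m + 1))).congr fun X Y hX _ => ?_
    · rw [← sum_eq_rotExponent]
      simp
    · have hX0 : X ≠ [] := by
        rintro rfl
        simp at hX
        omega
      have hw : wt Homog.parity (X.drop 1 ++ X.take 1) = wt Homog.parity X := by
        rw [wt_append, add_comm, wt_take_add_drop]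
      rw [rotWord_eq_rotExponent, neg_one_pow_eq_sgn, hw, ← mul_assoc, ← mul_assoc, ← mul_assoc,
        ← sgn_add, ← sgn_add, ← sgn_add, ← hX]
      congr 2
      push_cast
      rw [← add_assoc, suspSign_rotate hX0]
      ring

theorem RepForm.signedRotRight_pow {m n : ℕ} {q : Form k V m n}
    {F : List (Homog (shift 𝒱)) → List (Homog (shift 𝒱)) → k}
    {c : List (Homog (shift 𝒱)) → ZMod 2}
    (h : RepForm q (fun X Y => sgn k (suspSign Y + (c X + Y.length * (wt Homog.parity X + 1))) *
      F X Y)) {b : ℕ} (hb : b = 0 ∨ 1 ≤ n) :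
    RepForm ((signedRotRight 𝒱 m n ^ b) q)
      (fun X Y => sgn k (suspSign Y + (c X + Y.length * (wt Homog.parity X + 1))) *
        (rotWord Homog.parity ^ b) (F X) Y) := by
  induction b with
  | zero => exact h
  | succ b ih =>
    have hn : 1 ≤ n := hb.resolve_left (Nat.succ_ne_zero b)
    have ih := ih (Or.inr hn)
    simp only [pow_succ', Module.End.mul_apply]
    refine ((ih.domDomCongr_right.twist_unshift (E := fun _ Y => rotExponent 1 Y)
      fun x y => ?_).smul ((-1) ^ (n + 1))).congr fun X Y _ hY => ?_
    · rw [← sum_eq_rotExponent]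
      simp
    · have hY0 : Y ≠ [] := by
        rintro rfl
        simp at hY
        omega
      have hl : (Y.drop 1 ++ Y.take 1).length = Y.length := by
        simp only [List.length_append, List.length_drop, List.length_take]
        omega
      rw [rotWord_eq_rotExponent, neg_one_pow_eq_sgn, hl, ← mul_assoc, ← mul_assoc, ← mul_assoc,
        ← sgn_add, ← sgn_add, ← sgn_add, ← hY]
      congr 2
      push_cast
      rw [← add_assoc, suspSign_rotate hY0]
      ring

/-! #### Insertions and traces with signs -/

variable {G : List (Homog 𝒱) → Homog 𝒱} {c : List (Homog 𝒱) → k}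

theorem RepOp.insertOp {n : ℕ} {j : Fin n} {i : Fin (n - j)} {f : Multi k V (Fin (n - j)) V}
    {g : Multi k V (Fin (j.1 + 1)) V} {φ : List (Homog 𝒱) → V}
    (hf : RepOp f φ) (hg : RepOp g (fun L => c L • (G L).val)) (a : ZMod 2) :
    RepOp (insertOp 𝒱 a j i f g)
      (fun L => sgn k (a * wt Homog.parity (L.take i)) •
        c ((L.take (i + j + 1)).drop i) • φ (graft G i (i + j + 1) L)) := by
  refine (hf.plug hg).twist (E := fun L => a * wt Homog.parity (L.take i)) fun x => ?_
  rw [sum_parity_lt_eq_wt_take]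

theorem RepForm.insertRight {m n : ℕ} {i : Fin n} {q : Form k V m (n - i)}
    {g : Multi k V (Fin (i.1 + 1)) V} {F : List (Homog 𝒱) → List (Homog 𝒱) → k}
    (hq : RepForm q F) (hg : RepOp g (fun L => c L • (G L).val)) (a : ZMod 2) :
    RepForm (insertRight 𝒱 a i q g)
      (fun X Y => sgn k (a * wt Homog.parity X) *
        (c (Y.take (i + 1)) * F X (graft G 0 (i + 1) Y))) := by
  refine (hq.plug_right hg).twist (E := fun X _ => a * wt Homog.parity X) fun x y => ?_
  simp only [Sum.elim_inl]
  rw [sum_parity_eq_wt]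

theorem traceSlot_eq_sum {m n r : ℕ} (b : Module.Basis (Fin r) k V)
    (f : Multi k V (Fin (m + 1 + n)) V) (x : Fin m ⊕ Fin n → V) :
    traceSlot 𝒱 m n f x = ∑ α, b.repr (UnimodAInf.twist 𝒱
      (fun ε => ε ⟨m, by omega⟩ * (1 + ∑ p : Fin n, ε (Fin.natAdd (m + 1) p))) f
      (slotArgs x (b α))) α := by
  rw [traceSlot_apply 𝒱 m n f x ((UnimodAInf.twist 𝒱
      (fun ε => ε ⟨m, by omega⟩ * (1 + ∑ p : Fin n, ε (Fin.natAdd (m + 1) p))) f).toLinearMap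
      (slotArgs x 0) ⟨m, by omega⟩), LinearMap.trace_eq_matrix_trace k b, Matrix.trace]
  · refine Finset.sum_congr rfl fun α _ => ?_
    rw [Matrix.diag_apply, LinearMap.toMatrix_apply, slotArgs_eq_update x (b α)]
    rfl
  · intro v
    rw [slotArgs_eq_update x v]
    rfl

/-- The trace over a slot with signs that refer to the grading `𝒱`, on words that are homogeneous
for a grading `𝒲`; the parities of the two gradings differ by `a`. -/
theorem RepForm.traceSlot_of_twist {𝒲 : ℤ → Submodule k V} {m n r : ℕ} {E : Fin r → Homog 𝒲}
    {b : Module.Basis (Fin r) k V} (hb : ∀ α, b α = (E α).val)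
    {f : Multi k V (Fin (m + 1 + n)) V} {φ : List (Homog 𝒲) → V} {a : ZMod 2}
    (h : RepOp (UnimodAInf.twist 𝒱
      (fun ε => ε ⟨m, by omega⟩ * (1 + ∑ p : Fin n, ε (Fin.natAdd (m + 1) p))) f)
      (fun L => sgn k (traceExponent a m L) • φ L)) :
    RepForm (traceSlot 𝒱 m n f) (fun X Y => ∑ α, sgn k (((E α).parity + a) *
      (1 + (wt Homog.parity Y + Y.length * a))) * b.repr (φ (X ++ E α :: Y)) α) := by
  intro x y
  rw [traceSlot_eq_sum b]
  refine Finset.sum_congr rfl fun α _ => ?_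
  rw [hb, h.apply _ (List.ofFn x ++ E α :: List.ofFn y) (by simp; omega)
    (slotArgs_getElem x y (E α)), map_smul, Finsupp.smul_apply, smul_eq_mul,
    traceExponent_append a (by simp)]

theorem RepForm.traceSlot {m n r : ℕ} {E : Fin r → Homog 𝒱} {b : Module.Basis (Fin r) k V}
    (hb : ∀ α, b α = (E α).val) {f : Multi k V (Fin (m + 1 + n)) V} {φ : List (Homog 𝒱) → V}
    (h : RepOp f φ) :
    RepForm (traceSlot 𝒱 m n f)
      (wordTrace Homog.parity E (fun α L => b.repr (φ L) α)) := by
  refine (RepForm.traceSlot_of_twist hb (h.twist (E := traceExponent 0 m) fun x => ?_)).congr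
    fun X Y _ _ => ?_
  · rw [← slot_eq_traceExponent]
    simp
  · simp only [wordTrace, add_zero, mul_zero]

theorem RepForm.traceSlot_unshift {m n r : ℕ} {E : Fin r → Homog (shift 𝒱)}
    {b : Module.Basis (Fin r) k V} (hb : ∀ α, b α = (E α).val)
    {f : Multi k V (Fin (m + 1 + n)) V} {φ : List (Homog (shift 𝒱)) → V} (h : RepOp f φ) :
    RepForm (UnimodAInf.traceSlot 𝒱 m n f) (fun X Y => ∑ α, sgn k (((E α).parity + 1) *
      (1 + (wt Homog.parity Y + Y.length))) * b.repr (φ (X ++ E α :: Y)) α) := by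
  refine (RepForm.traceSlot_of_twist hb (h.twist_unshift (E := traceExponent 1 m)
    fun x => ?_)).congr fun X Y _ _ => ?_
  · rw [← slot_eq_traceExponent]
  · simp only [mul_one]

end Operations

/-! ### Words in an `A_∞`-structure -/

section Structure

variable {k V : Type*} [Field k] [AddCommGroup V] [Module k V] {𝒱 : ℤ → Submodule k V}

/-- The degree of a word of homogeneous elements. -/
def degSum (L : List (Homog 𝒱)) : ℤ := (L.map Sigma.fst).sum

@[simp] theorem degSum_nil : degSum ([] : List (Homog 𝒱)) = 0 := rfl

@[simp] theorem degSum_cons (x : Homog 𝒱) (L : List (Homog 𝒱)) :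
    degSum (x :: L) = x.1 + degSum L := by simp [degSum]

@[simp] theorem degSum_append (A B : List (Homog 𝒱)) :
    degSum (A ++ B) = degSum A + degSum B := by simp [degSum]

theorem degSum_ofFn {n : ℕ} (x : Fin n → Homog 𝒱) : degSum (List.ofFn x) = ∑ i, (x i).1 := by
  rw [degSum, List.map_ofFn, List.sum_ofFn]
  rfl

theorem wt_parity_eq_degSum (L : List (Homog 𝒱)) :
    wt Homog.parity L = (degSum L : ZMod 2) := by
  induction L with
  | nil => simp
  | cons x L ih => simp [ih, Homog.parity]

theorem RepForm.hasDegree [DirectSum.Decomposition 𝒱] {m n : ℕ} {q : Form k V m n}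
    {F : List (Homog 𝒱) → List (Homog 𝒱) → k} (h : RepForm q F) {p : ℤ}
    (hF : ∀ X Y, degSum X + degSum Y + p ≠ 0 → F X Y = 0) : FormHasDegree 𝒱 p q := by
  intro a x hx ha
  rw [← hF (List.ofFn fun i : Fin m => ⟨a (Sum.inl i), x (Sum.inl i), hx _⟩)
    (List.ofFn fun i : Fin n => ⟨a (Sum.inr i), x (Sum.inr i), hx _⟩), ← h]
  · congr 1
    funext i
    rcases i with i | i <;> rfl
  · rwa [degSum_ofFn, degSum_ofFn, ← Fintype.sum_sum_type a]

/-- The coordinates of a homogeneous element in a homogeneous basis vanish outside of its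
degree. -/
theorem repr_eq_zero_of_degree_ne [DirectSum.Decomposition 𝒱] {r : ℕ} {E : Fin r → Homog 𝒱}
    {b : Module.Basis (Fin r) k V} (hb : ∀ α, b α = (E α).val) {d : ℤ} {v : V} (hv : v ∈ 𝒱 d)
    {α : Fin r} (hα : (E α).1 ≠ d) : b.repr v α = 0 := by
  let P : V →ₗ[k] V := (𝒱 d).subtype ∘ₗ DirectSum.component k ℤ (fun i => 𝒱 i) d ∘ₗ
    (DirectSum.decomposeLinearEquiv 𝒱).toLinearMap
  have hP : ∀ w, P w = (DirectSum.decompose 𝒱 w d : V) := fun _ => rfl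
  have h1 : P v = v := by rw [hP, DirectSum.decompose_of_mem_same 𝒱 hv]
  have h2 : ∀ β, P (b β) = if (E β).1 = d then b β else 0 := fun β => by
    rw [hP, hb]
    split_ifs with h
    · exact DirectSum.decompose_of_mem_same 𝒱 (h ▸ (E β).2.2)
    · exact DirectSum.decompose_of_mem_ne 𝒱 (E β).2.2 h
  rw [← h1, ← b.sum_repr v, map_sum]
  simp only [map_smul, h2, map_sum, Finsupp.coe_finsetSum, Finset.sum_apply, Finsupp.smul_apply]
  refine Finset.sum_eq_zero fun β _ => ?_
  split_ifs with h
  · have : β ≠ α := fun e => hα (e ▸ h)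
    simp [this]
  · simp

variable (Γ : Cochain k V)

/-- The value of the operations `Γ` on a word. -/
def opVal (L : List (Homog 𝒱)) : V := Γ L.length fun i => (L.get i).val

theorem repOp_opVal (n : ℕ) : RepOp (𝒱 := 𝒱) (Γ n) (opVal Γ) := by
  have h : ∀ (L : List (Homog 𝒱)) (n : ℕ) (hL : L.length = n),
      Γ n (fun i => (L.get (i.cast hL.symm)).val) = opVal Γ L := by
    rintro L n rfl
    rfl
  intro x
  rw [← h (List.ofFn x) n (by simp)]
  simp

/-- The value of an operation is a linear function of each letter. -/
theorem exists_linear_opVal (X Y : List (Homog 𝒱)) :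
    ∃ T : V →ₗ[k] V, ∀ z : Homog 𝒱, opVal Γ (X ++ z :: Y) = T z.val := by
  refine ⟨(Γ (X.length + 1 + Y.length)).toLinearMap
    (slotArgs (Sum.elim (fun i => (X.get i).val) fun i => (Y.get i).val) 0)
    ⟨X.length, by omega⟩, fun z => ?_⟩
  have h := (repOp_opVal (𝒱 := 𝒱) Γ (X.length + 1 + Y.length)).apply _
    (List.ofFn X.get ++ z :: List.ofFn Y.get) (by simp; omega) (slotArgs_getElem X.get Y.get z)
  rw [List.ofFn_get, List.ofFn_get] at h
  rw [← h, slotArgs_eq_update]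
  rfl

end Structure

section AInfinity

variable {k V : Type*} [Field k] [AddCommGroup V] [Module k V] {𝒱 : ℤ → Submodule k V}
  [DirectSum.Decomposition 𝒱] {Γ : Cochain k V}

theorem opVal_mem (hΓ : IsAInfinity 𝒱 Γ) {L : List (Homog (shift 𝒱))} (hL : L ≠ []) :
    opVal Γ L ∈ shift 𝒱 (degSum L + 1) := by
  have h := hΓ.degree L.length (List.length_pos_of_ne_nil hL) (fun i => (L.get i).1) _
    fun i => (L.get i).2.2
  rwa [← degSum_ofFn, List.ofFn_get] at h

/-- The value of the operations `Γ` on a word, as a homogeneous element of `V[1]`; it is zero on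
the empty word, as nothing is known about the degree of `Γ_0`. -/
def opHomog (hΓ : IsAInfinity 𝒱 Γ) (L : List (Homog (shift 𝒱))) : Homog (shift 𝒱) :=
  ⟨degSum L + 1, if h : L = [] then 0 else ⟨opVal Γ L, opVal_mem hΓ h⟩⟩

theorem opHomog_val (hΓ : IsAInfinity 𝒱 Γ) {L : List (Homog (shift 𝒱))} (hL : L ≠ []) :
    (opHomog hΓ L).val = opVal Γ L := by
  simp [opHomog, Homog.val, hL]

theorem opHomog_parity (hΓ : IsAInfinity 𝒱 Γ) (L : List (Homog (shift 𝒱))) :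
    (opHomog hΓ L).parity = wt Homog.parity L + 1 := by
  rw [wt_parity_eq_degSum]
  simp [opHomog, Homog.parity]

theorem repOp_opHomog (hΓ : IsAInfinity 𝒱 Γ) (n : ℕ) :
    RepOp (Γ (n + 1)) (fun L => (1 : k) • (opHomog hΓ L).val) :=
  (repOp_opVal Γ (n + 1)).congr fun L hL => by
    rw [opHomog_val hΓ (by rintro rfl; simp at hL), one_smul]

/-- The `A_∞`-relations, evaluated on words. -/
theorem opVal_relation [CharZero k] (hΓ : IsAInfinity 𝒱 Γ) {L : List (Homog (shift 𝒱))}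
    (hL : L ≠ []) :
    ∑ j ∈ Finset.range L.length, ∑ i ∈ Finset.range (L.length - j),
      sgn k (wt Homog.parity (L.take i)) •
        opVal Γ (graft (opHomog hΓ) i (i + j + 1) L) = 0 := by
  have h := hΓ.bracket_self L.length (List.length_pos_of_ne_nil hL)
  have h0 : circ 𝒱 1 Γ Γ L.length = 0 := by
    simp only [gerstenhaber, Pi.sub_apply, Pi.neg_apply, mul_one, Int.cast_one, sgn_one,
      neg_smul, one_smul, sub_neg_eq_add] at h
    -- As `Γ` has odd degree, `[Γ,Γ] = 2 Γ ∘ Γ`.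
    rw [← two_smul k] at h
    exact (smul_eq_zero.1 h).resolve_left two_ne_zero
  have h1 : RepOp (circ 𝒱 1 Γ Γ L.length) _ := RepOp.sum fun j _ => RepOp.sum fun i _ =>
    (repOp_opVal Γ (L.length - j)).insertOp (repOp_opHomog hΓ j) ((1 : ℤ) : ZMod 2)
  rw [h0] at h1
  have h2 := h1.eq_of_length RepOp.zero L rfl
  rw [← h2, ← Fin.sum_univ_eq_sum_range (fun j => ∑ i ∈ Finset.range (L.length - j),
      sgn k (wt Homog.parity (L.take i)) • opVal Γ (graft (opHomog hΓ) i (i + j + 1) L))]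
  refine Finset.sum_congr rfl fun j _ => ?_
  rw [← Fin.sum_univ_eq_sum_range (fun i =>
      sgn k (wt Homog.parity (L.take i)) • opVal Γ (graft (opHomog hΓ) i (i + j + 1) L))]
  refine Finset.sum_congr rfl fun i _ => ?_
  simp

/-- The action of an `A_∞`-structure on functions of pairs of words. -/
def wordAct (hΓ : IsAInfinity 𝒱 Γ) (F : List (Homog (shift 𝒱)) → List (Homog (shift 𝒱)) → k)
    (X Y : List (Homog (shift 𝒱))) : k :=
  (∑ i ∈ Finset.range X.length,
    cycSum Homog.parity (fun X' => F (graft (opHomog hΓ) 0 (i + 1) X') Y) X) +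
  ∑ i ∈ Finset.range Y.length,
    cycSum Homog.parity (fun Y' => sgn k (wt Homog.parity X) *
      F X (graft (opHomog hΓ) 0 (i + 1) Y')) Y

theorem cycOrder_eq_of_lt {i n : ℕ} (h : i < n) : cycOrder n = n := max_eq_left (by omega)

theorem RepForm.cycAct (hΓ : IsAInfinity 𝒱 Γ) {Q : BiForm k V}
    {F : List (Homog (shift 𝒱)) → List (Homog (shift 𝒱)) → k}
    (h : ∀ m n, m + n ≠ 0 → RepForm (Q m n) F) (m n : ℕ) :
    RepForm (cycAct 𝒱 1 Γ Q m n) (wordAct hΓ F) := by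
  have h1 : ∀ i : Fin m, RepForm (∑ a ∈ Finset.range m,
      (UnimodAInf.rotLeft (shift 𝒱) m n ^ a) (insertLeft i (Q (m - i) n) (Γ (i.1 + 1)))) _ :=
    fun i => RepForm.sum fun a _ =>
      ((h (m - i) n (by omega)).plug_left (repOp_opHomog hΓ i)).rotLeft_pow a
  have h2 : ∀ i : Fin n, RepForm (∑ b ∈ Finset.range n,
      (UnimodAInf.rotRight (shift 𝒱) m n ^ b)
        (UnimodAInf.insertRight (shift 𝒱) ((1 : ℤ) : ZMod 2) i (Q m (n - i)) (Γ (i.1 + 1)))) _ :=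
    fun i => RepForm.sum fun b _ =>
      ((h m (n - i) (by omega)).insertRight (repOp_opHomog hΓ i) ((1 : ℤ) : ZMod 2)).rotRight_pow b
  refine ((RepForm.sum fun i _ => h1 i).add (RepForm.sum fun i _ => h2 i)).congr
    fun X Y hX hY => ?_
  subst hX hY
  rw [wordAct]
  congr 1
  · rw [← Fin.sum_univ_eq_sum_range
      (fun i => cycSum Homog.parity (fun X' => F (graft (opHomog hΓ) 0 (i + 1) X') Y) X)]
    refine Finset.sum_congr rfl fun i _ => ?_
    rw [cycSum_apply, cycOrder_eq_of_lt i.2]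
    simp
  · rw [← Fin.sum_univ_eq_sum_range (fun i => cycSum Homog.parity (fun Y' =>
      sgn k (wt Homog.parity X) * F X (graft (opHomog hΓ) 0 (i + 1) Y')) Y)]
    refine Finset.sum_congr rfl fun i _ => ?_
    rw [cycSum_apply, cycOrder_eq_of_lt i.2]
    simp

variable {r : ℕ} {E : Fin r → Homog (shift 𝒱)} {b : Module.Basis (Fin r) k V}

theorem RepForm.wheel (hb : ∀ α, b α = (E α).val) {m n : ℕ} (hmn : m + n ≠ 0) :
    RepForm (wheel 𝒱 Γ m n) (wordWheel Homog.parity E fun α L => b.repr (opVal Γ L) α) := by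
  rw [UnimodAInf.wheel, if_neg hmn]
  have h1 : RepForm (∑ a ∈ Finset.range (cycOrder m), ∑ c ∈ Finset.range (cycOrder n),
      (UnimodAInf.rotRight (shift 𝒱) m n ^ c) ((UnimodAInf.rotLeft (shift 𝒱) m n ^ a)
        (UnimodAInf.traceSlot (shift 𝒱) m n (Γ (m + 1 + n))))) _ :=
    RepForm.sum fun a _ => RepForm.sum fun c _ =>
      ((RepForm.traceSlot hb (repOp_opVal Γ (m + 1 + n))).rotLeft_pow a).rotRight_pow c
  refine h1.congr fun X Y hX hY => ?_
  subst hX hY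
  simp only [wordWheel, cycSum_apply Homog.parity _ X, cycSum_sum]
  rfl

/-- The traces of an `A_∞`-structure, summed over rotations, form an element of `Cyc^1(V,k)`: the
supertrace of the degree one operation `Γ_{m+1+n}` vanishes unless the other letters have total
degree `-1`. -/
theorem wheel_mem_cyc [FiniteDimensional k V] (hΓ : IsAInfinity 𝒱 Γ) :
    UnimodAInf.wheel 𝒱 Γ ∈ Cyc 𝒱 1 := by
  have hV := shift_isInternal 𝒱 (DirectSum.Decomposition.isInternal 𝒱)
  obtain ⟨r, E, b, hb⟩ := exists_homogeneous_basis (shift 𝒱) hV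
  have h0 : UnimodAInf.wheel 𝒱 Γ 0 0 = 0 := if_pos rfl
  refine ⟨h0, fun m n => ?_⟩
  by_cases hmn : m + n = 0
  · obtain ⟨rfl, rfl⟩ : m = 0 ∧ n = 0 := by omega
    rw [h0]
    exact ⟨fun _ _ _ _ => rfl, map_zero _, map_zero _⟩
  have h := RepForm.wheel (Γ := Γ) hb hmn
  refine ⟨h.hasDegree fun X Y hd => ?_, RepForm.ext hV (h.rotLeft.congr fun X Y _ _ => ?_) h,
    RepForm.ext hV (h.rotRight.congr fun X Y _ _ => ?_) h⟩
  · have hdeg : ∀ (c : ℕ) (L : List (Homog (shift 𝒱))),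
        degSum (L.drop c ++ L.take c) = degSum L := fun c L => by
      rw [degSum_append, add_comm, ← degSum_append, List.take_append_drop]
    simp only [wordWheel, cycSum_apply_explicit]
    refine Finset.sum_eq_zero fun c _ => mul_eq_zero_of_right _ <|
      Finset.sum_eq_zero fun a _ => mul_eq_zero_of_right _ <|
      Finset.sum_eq_zero fun α _ => mul_eq_zero_of_right _ <|
      repr_eq_zero_of_degree_ne hb (opVal_mem hΓ (by simp)) fun e => hd ?_
    rw [degSum_append, degSum_cons, hdeg] at e
    have := hdeg c Y
    omega
  · have : (fun X' => wordWheel Homog.parity E (fun α L => b.repr (opVal Γ L) α) X' Y) =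
        cycSum Homog.parity fun X' => cycSum Homog.parity
          (wordTrace Homog.parity E (fun α L => b.repr (opVal Γ L) α) X') Y :=
      funext fun X' => cycSum_comm _ _ _ _
    rw [this, rotWord_cycSum, ← this]
  · exact congrFun (rotWord_cycSum _ _) Y

theorem cycDiff_wheel [FiniteDimensional k V] [CharZero k] (hΓ : IsAInfinity 𝒱 Γ) :
    cycDiff 𝒱 Γ 1 (UnimodAInf.wheel 𝒱 Γ) = 0 := by
  have hV := shift_isInternal 𝒱 (DirectSum.Decomposition.isInternal 𝒱)
  obtain ⟨r, E, b, hb⟩ := exists_homogeneous_basis (shift 𝒱) hV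
  have h : UnimodAInf.cycAct 𝒱 1 Γ (UnimodAInf.wheel 𝒱 Γ) = 0 := by
    funext m n
    refine RepForm.ext hV ((RepForm.cycAct hΓ (fun m n hmn => RepForm.wheel hb hmn) m n).congr
      fun X Y _ _ => ?_) RepForm.zero
    refine wordWheel_closed (opHomog_parity hΓ) (fun α L hL => ?_) (fun α X L Y hL => ?_)
      (fun α L hL hne => ?_) X Y
    · have := congrArg (fun v => b.repr v α) (opVal_relation hΓ hL)
      rw [sum_intervals (fun i e => sgn k (wt Homog.parity (L.take i)) *
        b.repr (opVal Γ (graft (opHomog hΓ) i e L)) α)]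
      simpa only [map_sum, map_smul, map_zero, Finsupp.coe_finsetSum, Finset.sum_apply,
        Finsupp.smul_apply, smul_eq_mul, Finsupp.coe_zero, Pi.zero_apply] using this
    · obtain ⟨T, hT⟩ := exists_linear_opVal Γ X Y
      simp only [hT, ← hb]
      rw [opHomog_val hΓ hL]
      conv_lhs => rw [← b.sum_repr (opVal Γ L)]
      simp only [map_sum, map_smul, Finsupp.coe_finsetSum, Finset.sum_apply, Finsupp.smul_apply,
        smul_eq_mul]
    · have := not_imp_comm.1 (repr_eq_zero_of_degree_ne (α := α) hb (opVal_mem hΓ hL)) hne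
      rw [Homog.parity, this, wt_parity_eq_degSum]
      simp
  rw [cycDiff, LinearMap.smul_apply, h, smul_zero]

end AInfinity

/-! ### Suspension -/

section Values

variable {k V : Type*} [Field k] [AddCommGroup V] [Module k V] {𝒱 : ℤ → Submodule k V}

theorem mem_shift_sub_one {i : ℤ} {x : V} (hx : x ∈ 𝒱 i) : x ∈ shift 𝒱 (i - 1) := by
  rwa [shift, sub_add_cancel]

theorem FormHasDegree.ofShift {m n : ℕ} {q : Form k V m n} (h : FormHasDegree (shift 𝒱) 0 q) :
    FormHasDegree 𝒱 (-m - n) q := fun a x hx ha => by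
  refine h (fun i => a i - 1) x (fun i => mem_shift_sub_one (hx i)) fun e => ha ?_
  rw [Finset.sum_sub_distrib] at e
  simp only [Finset.sum_const, Finset.card_univ, Fintype.card_sum, Fintype.card_fin,
    nsmul_one] at e
  push_cast at e
  linarith

theorem FormHasDegree.toShift {m n : ℕ} {q : Form k V m n} (h : FormHasDegree 𝒱 (-m - n) q) :
    FormHasDegree (shift 𝒱) 0 q := fun a x hx ha => by
  refine h (fun i => a i + 1) x hx fun e => ha ?_
  rw [Finset.sum_add_distrib] at e
  simp only [Finset.sum_const, Finset.card_univ, Fintype.card_sum, Fintype.card_fin,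
    nsmul_one] at e
  push_cast at e
  linarith

/-- The values of a family of forms on pairs of words. -/
def formVal (Q : BiForm k V) (X Y : List (Homog 𝒱)) : k :=
  Q X.length Y.length (Sum.elim (fun i => (X.get i).val) fun i => (Y.get i).val)

theorem repForm_formVal (Q : BiForm k V) (m n : ℕ) :
    RepForm (𝒱 := 𝒱) (Q m n) (formVal Q) := by
  have h : ∀ (X Y : List (Homog 𝒱)) (m n : ℕ) (hX : X.length = m) (hY : Y.length = n),
      Q m n (Sum.elim (fun i => (X.get (i.cast hX.symm)).val)
        fun i => (Y.get (i.cast hY.symm)).val) = formVal Q X Y := by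
    rintro X Y m n rfl rfl
    rfl
  intro x y
  rw [← h (List.ofFn x) (List.ofFn y) m n (by simp) (by simp)]
  simp

end Values

section Suspension

variable {k V W : Type*} [Field k] [AddCommGroup V] [Module k V] [AddCommGroup W] [Module k W]
  {𝒱 : ℤ → Submodule k V} [DirectSum.Decomposition 𝒱]

/-- A twist by signs is an involution. -/
theorem twist_twist [FiniteDimensional k V] {ι : Type} [Fintype ι] [DecidableEq ι]
    (e : (ι → ZMod 2) → ZMod 2) (f : Multi k V ι W) : twist 𝒱 e (twist 𝒱 e f) = f := by
  obtain ⟨r, E, b, hb⟩ := exists_homogeneous_basis 𝒱 (DirectSum.Decomposition.isInternal 𝒱)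
  refine Module.Basis.ext_multilinear (fun _ => b) fun v => ?_
  have h : ∀ i, b (v i) ∈ 𝒱 (E (v i)).1 := fun i => by
    rw [hb]
    exact (E (v i)).2.2
  rw [twist_apply_of_mem 𝒱 e _ _ _ h, twist_apply_of_mem 𝒱 e _ _ _ h, ← mul_smul,
    sgn_mul_self, one_smul]

theorem HasDegree.twist {ι : Type} [Fintype ι] [DecidableEq ι] {p : ℤ} {f : Multi k V ι V}
    (h : HasDegree 𝒱 p f) (e : (ι → ZMod 2) → ZMod 2) : HasDegree 𝒱 p (twist 𝒱 e f) :=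
  fun a x hx => by
    rw [twist_apply_of_mem 𝒱 e f a x hx]
    exact Submodule.smul_mem _ _ (h a x hx)

theorem FormHasDegree.twist {ι : Type} [Fintype ι] [DecidableEq ι] {p : ℤ} {f : Multi k V ι k}
    (h : FormHasDegree 𝒱 p f) (e : (ι → ZMod 2) → ZMod 2) :
    FormHasDegree 𝒱 p (twist 𝒱 e f) := fun a x hx ha => by
  rw [twist_apply_of_mem 𝒱 e f a x hx, h a x hx ha, smul_zero]

theorem suspend_suspend [FiniteDimensional k V] {n : ℕ} (f : Multi k V (Fin n) V) :
    suspend 𝒱 (suspend 𝒱 f) = f := twist_twist _ f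

theorem HasDegree.suspend {n : ℕ} {f : Multi k V (Fin n) V} (h : HasDegree (shift 𝒱) 1 f) :
    HasDegree 𝒱 (2 - n) (suspend 𝒱 f) := fun a x hx => by
  have := h.twist (fun ε => ∑ p : Fin n, ((n - 1 - p.1 : ℕ) : ZMod 2) * ε p) (fun i => a i - 1) x
    fun i => mem_shift_sub_one (hx i)
  rw [Finset.sum_sub_distrib] at this
  simp only [shift, Finset.sum_const, Finset.card_univ, Fintype.card_fin, nsmul_one] at this
  rwa [show (∑ i, a i - n + 1 + 1 : ℤ) = ∑ i, a i + (2 - n) by ring] at this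

theorem RepOp.suspend {n : ℕ} {f : Multi k V (Fin n) V} {φ : List (Homog (shift 𝒱)) → V}
    (h : RepOp f φ) :
    RepOp (UnimodAInf.suspend 𝒱 f) (fun L => sgn k (suspSign L) • φ L) :=
  RepOp.twist h fun x => sum_eq_suspSign x

/-- The exponent of the sign that relates forms on `V^{⊗m} ⊗ V^{⊗n}` and on
`V[1]^{⊗m} ⊗ V[1]^{⊗n}`: the suspension signs of the two words, the sign `n |X|` of moving
`s^{⊗n}` past `X`, and the normalisation `(-1)^n`. -/
def biSign (X Y : List (Homog 𝒱)) : ZMod 2 :=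
  suspSign X + suspSign Y + Y.length * (wt Homog.parity X + 1)

variable (𝒱) in
/-- The suspension of forms on two blocks, normalised so that it takes solutions of
`R • Γ + Γ^↻ = 0` to the operations `q_{m,n}`. The last summand `1` of the exponent changes the
sign of the terms with `q`, but not of the traces, in the equation of `q_{m,n}`. -/
def biSuspend (m n : ℕ) : Module.End k (Form k V m n) :=
  twist (shift 𝒱) fun ε => (∑ p : Fin m, ((m - 1 - p.1 : ℕ) : ZMod 2) * ε (Sum.inl p)) +
    (∑ p : Fin n, ((n - 1 - p.1 : ℕ) : ZMod 2) * ε (Sum.inr p)) +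
      n * ((∑ p : Fin m, ε (Sum.inl p)) + 1) + 1

theorem biSuspend_biSuspend [FiniteDimensional k V] {m n : ℕ} (q : Form k V m n) :
    biSuspend 𝒱 m n (biSuspend 𝒱 m n q) = q := twist_twist _ q

theorem RepForm.biSuspend {m n : ℕ} {q : Form k V m n}
    {F : List (Homog (shift 𝒱)) → List (Homog (shift 𝒱)) → k} (h : RepForm q F) :
    RepForm (biSuspend 𝒱 m n q) (fun X Y => sgn k (biSign X Y + 1) * F X Y) :=
  RepForm.twist h (E := fun X Y => biSign X Y + 1) fun x y => by
    simp only [Sum.elim_inl, Sum.elim_inr, sum_eq_suspSign, sum_parity_eq_wt, biSign,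
      List.length_ofFn]

/-! #### Rotations and suspended forms -/

variable {m n : ℕ} {q : Form k V m n} {F : List (Homog (shift 𝒱)) → List (Homog (shift 𝒱)) → k}

theorem RepForm.signedRotLeft_pow_biSign
    (h : RepForm q (fun X Y => sgn k (biSign X Y) * F X Y)) {a : ℕ} (ha : a = 0 ∨ 1 ≤ m) :
    RepForm ((signedRotLeft 𝒱 m n ^ a) q) (fun X Y => sgn k (biSign X Y) *
      (rotWord Homog.parity ^ a) (fun X' => F X' Y) X) := by
  simp only [biSign, add_assoc] at h ⊢
  exact RepForm.signedRotLeft_pow (c := fun w Y => suspSign Y + Y.length * (w + 1)) h ha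

theorem RepForm.signedRotRight_pow_biSign
    (h : RepForm q (fun X Y => sgn k (biSign X Y) * F X Y)) {a : ℕ} (ha : a = 0 ∨ 1 ≤ n) :
    RepForm ((signedRotRight 𝒱 m n ^ a) q) (fun X Y => sgn k (biSign X Y) *
      (rotWord Homog.parity ^ a) (F X) Y) := by
  have e : ∀ X Y : List (Homog (UnimodAInf.shift 𝒱)), biSign X Y =
      suspSign Y + (suspSign X + Y.length * (wt Homog.parity X + 1)) := fun X Y => by
    rw [biSign]; ring
  simp only [e] at h ⊢
  exact RepForm.signedRotRight_pow (c := suspSign) h ha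

theorem signedRotLeft_biSuspend [FiniteDimensional k V] (Q : BiForm k V) (hm : 1 ≤ m) :
    signedRotLeft 𝒱 m n (biSuspend 𝒱 m n (Q m n)) =
      biSuspend 𝒱 m n (rotLeft (UnimodAInf.shift 𝒱) m n (Q m n)) := by
  have hV := shift_isInternal 𝒱 (DirectSum.Decomposition.isInternal 𝒱)
  have h := repForm_formVal (𝒱 := UnimodAInf.shift 𝒱) Q m n
  have h1 : RepForm (biSuspend 𝒱 m n (Q m n))
      (fun X Y => sgn k (biSign X Y) * -formVal Q X Y) := h.biSuspend.congr fun X Y _ _ => by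
    rw [sgn_add, sgn_one]; ring
  have h2 := h1.signedRotLeft_pow_biSign (a := 1) (Or.inr hm)
  rw [pow_one] at h2
  refine RepForm.ext hV h2 (h.rotLeft.biSuspend.congr fun X Y _ _ => ?_)
  rw [pow_one, sgn_add, sgn_one, rotWord_eq_rotExponent, rotWord_eq_rotExponent]
  ring

theorem signedRotRight_biSuspend [FiniteDimensional k V] (Q : BiForm k V) (hn : 1 ≤ n) :
    signedRotRight 𝒱 m n (biSuspend 𝒱 m n (Q m n)) =
      biSuspend 𝒱 m n (rotRight (UnimodAInf.shift 𝒱) m n (Q m n)) := by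
  have hV := shift_isInternal 𝒱 (DirectSum.Decomposition.isInternal 𝒱)
  have h := repForm_formVal (𝒱 := UnimodAInf.shift 𝒱) Q m n
  have h1 : RepForm (biSuspend 𝒱 m n (Q m n))
      (fun X Y => sgn k (biSign X Y) * -formVal Q X Y) := h.biSuspend.congr fun X Y _ _ => by
    rw [sgn_add, sgn_one]; ring
  have h2 := h1.signedRotRight_pow_biSign (a := 1) (Or.inr hn)
  rw [pow_one] at h2
  refine RepForm.ext hV h2 (h.rotRight.biSuspend.congr fun X Y _ _ => ?_)
  rw [pow_one, sgn_add, sgn_one, rotWord_eq_rotExponent, rotWord_eq_rotExponent]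
  ring

end Suspension

section Unimodular

variable {k V : Type*} [Field k] [AddCommGroup V] [Module k V] {𝒱 : ℤ → Submodule k V}
  [DirectSum.Decomposition 𝒱]

theorem RepOp.insertOp_unshift {G : List (Homog (shift 𝒱)) → Homog (shift 𝒱)}
    {c : List (Homog (shift 𝒱)) → k} {n : ℕ} {j : Fin n} {i : Fin (n - j)}
    {f : Multi k V (Fin (n - j)) V} {g : Multi k V (Fin (j.1 + 1)) V}
    {φ : List (Homog (shift 𝒱)) → V}
    (hf : RepOp f φ) (hg : RepOp g (fun L => c L • (G L).val)) (a : ZMod 2) :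
    RepOp (UnimodAInf.insertOp 𝒱 a j i f g)
      (fun L => sgn k (a * (wt Homog.parity (L.take i) + i.1)) •
        c ((L.take (i + j + 1)).drop i) • φ (graft G i (i + j + 1) L)) := by
  refine (hf.plug hg).twist_unshift
    (E := fun L => a * (wt Homog.parity (L.take i) + i.1)) fun x => ?_
  rw [sum_parity_add_one_lt _ (by omega)]

theorem RepForm.insertRight_unshift {G : List (Homog (shift 𝒱)) → Homog (shift 𝒱)}
    {c : List (Homog (shift 𝒱)) → k} {m n : ℕ} {i : Fin n} {q : Form k V m (n - i)}
    {g : Multi k V (Fin (i.1 + 1)) V}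
    {F : List (Homog (shift 𝒱)) → List (Homog (shift 𝒱)) → k}
    (hq : RepForm q F) (hg : RepOp g (fun L => c L • (G L).val)) (a : ZMod 2) :
    RepForm (UnimodAInf.insertRight 𝒱 a i q g)
      (fun X Y => sgn k (a * (wt Homog.parity X + X.length)) *
        (c (Y.take (i + 1)) * F X (graft G 0 (i + 1) Y))) := by
  refine (hq.plug_right hg).twist_unshift
    (E := fun X _ => a * (wt Homog.parity X + X.length)) fun x y => ?_
  simp only [Sum.elim_inl]
  rw [sum_parity_add_one, List.length_ofFn]

theorem RepOp.insertDiff_unshift {G : List (Homog (shift 𝒱)) → Homog (shift 𝒱)} {n : ℕ}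
    {f : Multi k V (Fin n) V} {φ : List (Homog (shift 𝒱)) → V} (h : RepOp f φ) {d : V →ₗ[k] V}
    (hd : ∀ z, (G [z]).val = d z.val) :
    RepOp (insertDiff 𝒱 (· < ·) d f) (fun L => ∑ s : Fin n,
      sgn k (wt Homog.parity (L.take s) + s.1) • φ (graft G s (s + 1) L)) :=
  RepOp.sum fun s _ => (h.compLinearMap_update hd s).twist_unshift
    (E := fun L => wt Homog.parity (L.take s) + s.1) fun x => by
      rw [← sum_parity_add_one_lt _ s.2.le]
      rfl

theorem RepForm.insertDiff_unshift {G : List (Homog (shift 𝒱)) → Homog (shift 𝒱)} {m n : ℕ}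
    {q : Form k V m n} {F : List (Homog (shift 𝒱)) → List (Homog (shift 𝒱)) → k}
    (h : RepForm q F) {d : V →ₗ[k] V} (hd : ∀ z, (G [z]).val = d z.val) :
    RepForm (insertDiff 𝒱 (Sum.Lex (· < ·) (· < ·)) d q) (fun X Y =>
      (∑ s : Fin m, sgn k (wt Homog.parity (X.take s) + s.1) * F (graft G s (s + 1) X) Y) +
      ∑ s : Fin n, sgn k (wt Homog.parity X + X.length + (wt Homog.parity (Y.take s) + s.1)) *
        F X (graft G s (s + 1) Y)) := by
  rw [insertDiff, Fintype.sum_sum_type]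
  refine RepForm.add (RepForm.sum fun s _ => ?_) (RepForm.sum fun s _ => ?_)
  · refine (h.compLinearMap_update_left hd s).twist_unshift
      (E := fun X _ => wt Homog.parity (X.take s) + s.1) fun x y => ?_
    rw [Fintype.sum_sum_type, ← sum_parity_add_one_lt _ s.2.le]
    simp
  · refine (h.compLinearMap_update_right hd s).twist_unshift
      (E := fun X Y => wt Homog.parity X + X.length + (wt Homog.parity (Y.take s) + s.1))
      fun x y => ?_
    rw [Fintype.sum_sum_type, ← sum_parity_add_one_lt _ s.2.le, List.length_ofFn,
      ← sum_parity_add_one]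
    simp

end Unimodular

/-! ### The equations of a unimodular `A_∞`-structure on words -/

section Equations

variable {k V : Type*} [Field k] [AddCommGroup V] [Module k V] {𝒱 : ℤ → Submodule k V}

/-- The sign by which insertions of desuspended operations at the place `i` differ from the
desuspension of the insertion; the inner operation has `j + 1` inputs. -/
theorem suspSign_graft {G : List (Homog 𝒱) → Homog 𝒱}
    (hG : ∀ L, (G L).parity = wt Homog.parity L + 1) {i j : ℕ} {L : List (Homog 𝒱)}
    (h : i + j + 1 ≤ L.length) :
    suspSign ((L.take (i + j + 1)).drop i) + suspSign (graft G i (i + j + 1) L) =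
      suspSign L + j * wt Homog.parity (L.take i) + (L.length + i + j + 1) := by
  obtain ⟨A, B, C, rfl, rfl, hB⟩ : ∃ A B C : List (Homog 𝒱), L = A ++ (B ++ C) ∧ i = A.length ∧
      B.length = j + 1 :=
    ⟨L.take i, (L.drop i).take (j + 1), (L.drop i).drop (j + 1), by simp, by simp; omega,
      by simp; omega⟩
  have h1 : A.length + j + 1 = A.length + B.length := by omega
  have h2 : ((A ++ (B ++ C)).take (A.length + B.length)).drop A.length = B := by
    rw [← List.append_assoc, ← List.length_append, List.take_left, List.drop_left]
  rw [h1, graft_append, h2]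
  simp only [suspSign_append, suspSign_cons, List.take_left, List.length_append,
    List.length_cons, hG, hB]
  push_cast
  generalize wt Homog.parity A = a
  generalize wt Homog.parity B = b
  generalize suspSign C = c'
  generalize suspSign A = a'
  generalize suspSign B = b'
  generalize (A.length : ZMod 2) = l
  generalize (C.length : ZMod 2) = c
  generalize (j : ZMod 2) = j
  have h2 : (2 : ZMod 2) = 0 := rfl
  linear_combination (-(j * a) - l - j - 1) * h2

theorem suspSign_length_one {L : List (Homog 𝒱)} (hL : L.length = 1) : suspSign L = 0 := by
  obtain ⟨x, rfl⟩ := List.length_eq_one_iff.1 hL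
  simp

theorem length_drop_take_succ {α : Type*} {i : ℕ} {L : List α} (hi : i < L.length) :
    ((L.take (i + 1)).drop i).length = 1 := by
  rw [List.length_drop, List.length_take, min_eq_left hi, Nat.add_sub_cancel_left]

theorem biSign_graft_left {G : List (Homog 𝒱) → Homog 𝒱}
    (hG : ∀ L, (G L).parity = wt Homog.parity L + 1) {i j : ℕ} {X Y : List (Homog 𝒱)}
    (h : i + j + 1 ≤ X.length) :
    suspSign ((X.take (i + j + 1)).drop i) + biSign (graft G i (i + j + 1) X) Y =
      biSign X Y + j * wt Homog.parity (X.take i) + (X.length + Y.length + i + j + 1) := by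
  have h1 := suspSign_graft hG h
  rw [biSign, biSign, wt_graft hG (by omega)]
  linear_combination h1

theorem biSign_graft_right {G : List (Homog 𝒱) → Homog 𝒱}
    (hG : ∀ L, (G L).parity = wt Homog.parity L + 1) {i j : ℕ} {X Y : List (Homog 𝒱)}
    (h : i + j + 1 ≤ Y.length) :
    suspSign ((Y.take (i + j + 1)).drop i) + biSign X (graft G i (i + j + 1) Y) =
      biSign X Y + j * wt Homog.parity (Y.take i) + j * wt Homog.parity X +
        (Y.length + i + 1) := by
  have h1 := suspSign_graft hG h
  have h2 : (graft G i (i + j + 1) Y).length + j = Y.length := by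
    rw [length_graft _ (by omega) h]
    omega
  have h2 := congrArg (Nat.cast (R := ZMod 2)) h2
  push_cast at h2
  have h3 : (2 : ZMod 2) = 0 := rfl
  rw [biSign, biSign]
  linear_combination h1 + (wt Homog.parity X + 1) * h2 - j * wt Homog.parity X * h3

end Equations

section Operations

variable {k V : Type*} [Field k] [AddCommGroup V] [Module k V] {𝒱 : ℤ → Submodule k V}
  [DirectSum.Decomposition 𝒱] {Γ : Cochain k V}

theorem opHomog_singleton (hΓ : IsAInfinity 𝒱 Γ) {d : V →ₗ[k] V}
    (hd : ∀ x : Fin 1 → V, Γ 1 x = d (x 0)) (z : Homog (shift 𝒱)) :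
    (opHomog hΓ [z]).val = d z.val := by
  rw [opHomog_val hΓ (List.cons_ne_nil _ _)]
  exact hd _

/-- The `A_∞`-relation on words of one letter says that `Γ_1` is a differential. -/
theorem differential_sq [FiniteDimensional k V] [CharZero k] (hΓ : IsAInfinity 𝒱 Γ) {d : V →ₗ[k] V}
    (hd : ∀ x : Fin 1 → V, Γ 1 x = d (x 0)) : d ∘ₗ d = 0 := by
  have hV := shift_isInternal 𝒱 (DirectSum.Decomposition.isInternal 𝒱)
  obtain ⟨r, E, b, hb⟩ := exists_homogeneous_basis (shift 𝒱) hV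
  refine b.ext fun α => ?_
  have h := opVal_relation hΓ (List.cons_ne_nil (E α) [])
  simp only [List.length_singleton, Finset.sum_range_one, List.take_zero, wt_nil, sgn_zero,
    one_smul, Nat.sub_zero] at h
  rw [LinearMap.comp_apply, hb, ← opHomog_singleton hΓ hd, ← opHomog_singleton hΓ hd,
    opHomog_val hΓ (List.cons_ne_nil _ _), LinearMap.zero_apply, ← h]
  rfl

theorem differential_mem (hΓ : IsAInfinity 𝒱 Γ) {d : V →ₗ[k] V}
    (hd : ∀ x : Fin 1 → V, Γ 1 x = d (x 0)) (i : ℤ) (x : V) (hx : x ∈ 𝒱 i) :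
    d x ∈ 𝒱 (i + 1) := by
  have h := hΓ.degree 1 le_rfl (fun _ => i - 1) (fun _ => x) fun _ => mem_shift_sub_one hx
  rw [hd] at h
  simpa [shift] using h

variable {μ : ∀ n : ℕ, Multi k V (Fin n) V}

theorem repOp_mu [FiniteDimensional k V] (hμ : ∀ n, 2 ≤ n → Γ n = suspend 𝒱 (μ n)) {n : ℕ}
    (hn : 2 ≤ n) :
    RepOp (μ n) (fun L : List (Homog (shift 𝒱)) => sgn k (suspSign L) • opVal Γ L) := by
  rw [← suspend_suspend (𝒱 := 𝒱) (μ n), ← hμ n hn]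
  exact (repOp_opVal Γ n).suspend

theorem repOp_mu_homog [FiniteDimensional k V] (hΓ : IsAInfinity 𝒱 Γ)
    (hμ : ∀ n, 2 ≤ n → Γ n = suspend 𝒱 (μ n)) {n : ℕ} (hn : 1 ≤ n) :
    RepOp (μ (n + 1)) (fun L => sgn k (suspSign L) • (opHomog hΓ L).val) :=
  (repOp_mu hμ (Nat.succ_le_succ hn)).congr fun L hL => by
    rw [opHomog_val hΓ (by rintro rfl; simp at hL)]

theorem sum_fin_filter_middle {M : Type*} [AddCommMonoid M] (n : ℕ) (g : ℕ → M) :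
    ∑ j : Fin (n + 2) with 1 ≤ j.1 ∧ j.1 + 1 < n + 2, g j.1 =
      ∑ j ∈ Finset.range n, g (j + 1) := by
  rw [Finset.sum_filter, Fin.sum_univ_eq_sum_range
    (fun j => if 1 ≤ j ∧ j + 1 < n + 2 then g j else 0), Finset.sum_range_succ,
    Finset.sum_range_succ', if_neg (by omega), if_neg (by omega), add_zero, add_zero]
  refine Finset.sum_congr rfl fun j hj => ?_
  have := Finset.mem_range.1 hj
  rw [if_pos (by omega)]

/-- The desuspended `A_∞`-relations are the equations of the operations `μ_n`. -/
theorem mu_equation [FiniteDimensional k V] [CharZero k] (hΓ : IsAInfinity 𝒱 Γ) {d : V →ₗ[k] V}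
    (hd : ∀ x : Fin 1 → V, Γ 1 x = d (x 0)) (hμ : ∀ n, 2 ≤ n → Γ n = suspend 𝒱 (μ n)) (n : ℕ)
    (hn : 2 ≤ n) :
    d.compMultilinearMap (μ n) - (-1 : k) ^ n • insertDiff 𝒱 (· < ·) d (μ n) =
      ∑ j : Fin n with 1 ≤ j.1 ∧ j.1 + 1 < n, ∑ i : Fin (n - j),
        (-1 : k) ^ (i.1 * (j.1 + 1) + i.1 + (j.1 + 1) + 1 + n) •
          insertOp 𝒱 ((j.1 + 1 : ℕ) : ZMod 2) j i (μ (n - j)) (μ (j.1 + 1)) := by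
  have hV := shift_isInternal 𝒱 (DirectSum.Decomposition.isInternal 𝒱)
  have h1 : RepOp (d.compMultilinearMap (μ n))
      (fun L : List (Homog (shift 𝒱)) => d (sgn k (suspSign L) • opVal Γ L)) :=
    fun x => congrArg d (repOp_mu hμ hn x)
  have h2 := h1.sub (((repOp_mu hμ hn).insertDiff_unshift (opHomog_singleton hΓ hd)).smul
    ((-1 : k) ^ n))
  have h3 : RepOp (∑ j : Fin n with 1 ≤ j.1 ∧ j.1 + 1 < n, ∑ i : Fin (n - j),
        (-1 : k) ^ (i.1 * (j.1 + 1) + i.1 + (j.1 + 1) + 1 + n) •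
          insertOp 𝒱 ((j.1 + 1 : ℕ) : ZMod 2) j i (μ (n - j)) (μ (j.1 + 1))) _ :=
    RepOp.sum fun j hj => RepOp.sum fun i _ => ((repOp_mu hμ (by
      have := (Finset.mem_filter.1 hj).2
      omega)).insertOp_unshift (repOp_mu_homog hΓ hμ (Finset.mem_filter.1 hj).2.1) _).smul _
  refine RepOp.ext hV h2 (h3.congr fun L hL => ?_)
  have hL0 : L ≠ [] := by
    rintro rfl
    simp at hL
    omega
  have hrel := opVal_relation hΓ hL0
  rw [hL] at hrel
  obtain ⟨f, hf⟩ : ∃ f : ℕ → V, ∀ j, f j = ∑ i ∈ Finset.range (n - j),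
    sgn k (wt Homog.parity (L.take i)) • opVal Γ (graft (opHomog hΓ) i (i + j + 1) L) :=
      ⟨_, fun _ => rfl⟩
  -- `f j` collects the insertions of `Γ_{j+1}`, so that `∑_j f j = 0`. Up to a common sign, the
  -- right hand side is minus the sum of the `f j` with `0 < j < n - 1`, by `hR`. The extreme
  -- terms give the differential of `μ_n`: `f 0` inserts `Γ_1` (`hD`), and `f (n - 1)` applies
  -- `Γ_1` to the value of `Γ_n` (`hlast`).
  simp only [← hf] at hrel
  have hterm : ∀ (j i : ℕ), j < n → i < n - j →
      (-1 : k) ^ (i * (j + 1) + i + (j + 1) + 1 + n) •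
        (sgn k (((j + 1 : ℕ) : ZMod 2) * (wt Homog.parity (L.take i) + i)) •
          sgn k (suspSign ((L.take (i + j + 1)).drop i)) •
            sgn k (suspSign (graft (opHomog hΓ) i (i + j + 1) L)) •
              opVal Γ (graft (opHomog hΓ) i (i + j + 1) L)) =
      sgn k (suspSign L + 1) • (sgn k (wt Homog.parity (L.take i)) •
        opVal Γ (graft (opHomog hΓ) i (i + j + 1) L)) := by
    intro j i hj hi
    rw [neg_one_pow_eq_sgn]
    simp only [← mul_smul, ← sgn_add]
    congr 2
    have h1 := suspSign_graft (opHomog_parity hΓ) (L := L) (i := i) (j := j) (by omega)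
    rw [hL] at h1
    push_cast
    have h3 : (2 : ZMod 2) = 0 := rfl
    linear_combination h1 + (j * i + i + j + 1 + n + j * wt Homog.parity (L.take i) + i) * h3
  have hR : (∑ j : Fin n with 1 ≤ j.1 ∧ j.1 + 1 < n, ∑ i : Fin (n - j),
      (-1 : k) ^ (i.1 * (j.1 + 1) + i.1 + (j.1 + 1) + 1 + n) •
        (sgn k (((j.1 + 1 : ℕ) : ZMod 2) * (wt Homog.parity (L.take i) + i.1)) •
          sgn k (suspSign ((L.take (i + j + 1)).drop i)) •
            sgn k (suspSign (graft (opHomog hΓ) i (i + j + 1) L)) •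
              opVal Γ (graft (opHomog hΓ) i (i + j + 1) L))) =
      ∑ j : Fin n with 1 ≤ j.1 ∧ j.1 + 1 < n, sgn k (suspSign L + 1) • f j.1 := by
    refine Finset.sum_congr rfl fun j _ => ?_
    rw [hf, ← Fin.sum_univ_eq_sum_range (fun i => sgn k (wt Homog.parity (L.take i)) •
      opVal Γ (graft (opHomog hΓ) i (i + j + 1) L)), Finset.smul_sum]
    exact Finset.sum_congr rfl fun i _ => hterm j i j.2 i.2
  have hD : -((-1 : k) ^ n • ∑ s : Fin n, sgn k (wt Homog.parity (L.take s) + s.1) •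
      sgn k (suspSign (graft (opHomog hΓ) s (s + 1) L)) •
        opVal Γ (graft (opHomog hΓ) s (s + 1) L)) = sgn k (suspSign L) • f 0 := by
    rw [← neg_smul, neg_one_pow_eq_sgn, neg_eq_sgn_mul, hf, Finset.smul_sum, Finset.smul_sum,
      Nat.sub_zero, ← Fin.sum_univ_eq_sum_range (fun s => sgn k (suspSign L) •
        sgn k (wt Homog.parity (L.take s)) • opVal Γ (graft (opHomog hΓ) s (s + 0 + 1) L))]
    refine Finset.sum_congr rfl fun s _ => ?_
    simp only [← mul_smul, ← sgn_add, add_zero]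
    congr 2
    have h1 := suspSign_graft (opHomog_parity hΓ) (L := L) (i := s) (j := 0) (by omega)
    rw [add_zero, suspSign_length_one (length_drop_take_succ (hL ▸ s.2)), hL] at h1
    push_cast at h1
    have h3 : (2 : ZMod 2) = 0 := rfl
    linear_combination h1 + (1 + n + s.1) * h3
  have hlast : d (sgn k (suspSign L) • opVal Γ L) = sgn k (suspSign L) • f (n - 1) := by
    rw [map_smul, ← opHomog_val hΓ hL0, ← opHomog_singleton hΓ hd,
      opHomog_val hΓ (List.cons_ne_nil _ _), hf]
    rw [show n - (n - 1) = 1 by omega, Finset.sum_range_one]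
    have h0 := graft_zero_append (opHomog hΓ) L []
    rw [List.append_nil, hL] at h0
    rw [show 0 + (n - 1) + 1 = n by omega, h0]
    simp
  obtain ⟨n, rfl⟩ : ∃ n', n = n' + 2 := ⟨n - 2, by omega⟩
  rw [hR, sub_eq_add_neg, hD, hlast, sum_fin_filter_middle n fun j => sgn k (suspSign L + 1) • f j]
  rw [Finset.sum_range_succ, Finset.sum_range_succ'] at hrel
  rw [← Finset.smul_sum, sgn_add, sgn_one, mul_neg_one, neg_smul, ← smul_neg, ← smul_add]
  congr 1
  rw [neg_eq_iff_add_eq_zero, show n + 2 - 1 = n + 1 from rfl]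
  refine Eq.trans ?_ hrel
  abel

end Operations

/-! ### The equations of the operations `q_{m,n}` -/

/-- The insertions of `Γ_1` are the terms with index `0`, separated from the insertions of the
higher operations. -/
theorem sum_filter_one_le {M : Type*} [AddCommMonoid M] (n : ℕ) (g : ℕ → M) :
    (∑ i : Fin n with 1 ≤ i.1, g i.1) + (if n = 0 then 0 else g 0) =
      ∑ i ∈ Finset.range n, g i := by
  rw [Finset.sum_filter, Fin.sum_univ_eq_sum_range (fun i => if 1 ≤ i then g i else 0)]
  cases n with
  | zero => simp
  | succ n =>
    rw [Finset.sum_range_succ', Finset.sum_range_succ', if_neg (by omega), add_zero,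
      if_neg (by omega)]
    simp

/-- On an invariant function of words, inserting an odd operation of one letter at all places is
the same as inserting it at the first place and summing over rotations. -/
theorem sum_graft_one {k : Type*} [Field k] {H : Type*} {p : H → ZMod 2} {G : List H → H}
    (hG : ∀ L, p (G L) = wt p L + 1) {φ : List H → k} {n : ℕ}
    (hφ : ∀ X : List H, X.length = n → rotWord p φ X = φ X) {X : List H} (hX : X.length = n) :
    ∑ s : Fin n, sgn k (wt p (X.take s)) * φ (graft G s (s + 1) X) =
      if n = 0 then 0 else cycSum p (fun X' => φ (graft G 0 (0 + 1) X')) X := by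
  cases n with
  | zero => simp
  | succ n =>
    rw [if_neg (Nat.succ_ne_zero n), cycSum_apply, hX, cycOrder_eq_of_lt (Nat.succ_pos n),
      Fin.sum_univ_eq_sum_range (fun s => sgn k (wt p (X.take s)) * φ (graft G s (s + 1) X))]
    refine Finset.sum_congr rfl fun s hs => ?_
    have hs := Finset.mem_range.1 hs
    have h := rotWord_pow_graftSigned hG φ (s := s) (r := 1) (X := X) (by omega)
    simp only [graftSigned_def, List.take_zero, wt_nil, sgn_zero, one_mul] at h
    rw [h, rotWord_pow_of_invariant p hφ]
    rw [length_graft _ (by omega) (by omega)]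
    omega

section Forms

variable {k V : Type*} [Field k] [AddCommGroup V] [Module k V] {𝒱 : ℤ → Submodule k V}

/-- Forms whose values on words agree up to signs vanish simultaneously. -/
theorem eq_zero_iff_of_sgn [FiniteDimensional k V] (hV : DirectSum.IsInternal 𝒱) {m n : ℕ}
    {q q' : Form k V m n} {F : List (Homog 𝒱) → List (Homog 𝒱) → k}
    {c : List (Homog 𝒱) → List (Homog 𝒱) → ZMod 2}
    (h : RepForm q (fun X Y => sgn k (c X Y) * F X Y)) (h' : RepForm q' F) : q = 0 ↔ q' = 0 := by
  constructor
  · rintro rfl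
    refine RepForm.ext hV (h'.congr fun X Y hX hY => ?_) RepForm.zero
    exact (mul_eq_zero.1 (h.eq_of_length RepForm.zero X Y hX hY)).resolve_left (sgn_ne_zero _)
  · rintro rfl
    refine RepForm.ext hV (h.congr fun X Y hX hY => ?_) RepForm.zero
    rw [h'.eq_of_length RepForm.zero X Y hX hY, mul_zero]

variable [DirectSum.Decomposition 𝒱] {Γ : Cochain k V} {μ : ∀ n : ℕ, Multi k V (Fin n) V}
  {F : List (Homog (shift 𝒱)) → List (Homog (shift 𝒱)) → k} {m n : ℕ}

/-- Insertions of the operations `μ_i` into the first block, on words. -/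
theorem repForm_left_terms [FiniteDimensional k V] (hΓ : IsAInfinity 𝒱 Γ)
    (hμ : ∀ n, 2 ≤ n → Γ n = suspend 𝒱 (μ n)) {q : ∀ m n : ℕ, Form k V m n}
    (hq : ∀ m n, m + n ≠ 0 → RepForm (q m n) (fun X Y => sgn k (biSign X Y + 1) * F X Y)) :
    RepForm (∑ i : Fin m with 1 ≤ i.1, ∑ a ∈ Finset.range m,
        (-1 : k) ^ ((i.1 + 1) + m + n + 1) •
          (signedRotLeft 𝒱 m n ^ a) (insertLeft i (q (m - i) n) (μ (i.1 + 1))))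
      (fun X Y => sgn k (biSign X Y) * ∑ i : Fin m with 1 ≤ i.1,
        cycSum Homog.parity (fun X' => F (graft (opHomog hΓ) 0 (i + 1) X') Y) X) := by
  simp only [← map_smul]
  have h : ∀ i ∈ Finset.univ.filter fun i : Fin m => 1 ≤ i.1, ∀ a ∈ Finset.range m,
      RepForm ((signedRotLeft 𝒱 m n ^ a) ((-1 : k) ^ ((i.1 + 1) + m + n + 1) •
        insertLeft i (q (m - i) n) (μ (i.1 + 1)))) _ := fun i hi a _ => by
    refine RepForm.signedRotLeft_pow_biSign
      (F := fun X Y => F (graft (opHomog hΓ) 0 (i + 1) X) Y) (RepForm.congr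
      (((hq (m - i) n (by omega)).plug_left
        (repOp_mu_homog hΓ hμ (Finset.mem_filter.1 hi).2)).smul _) fun X Y hX hY => ?_)
      (Or.inr (Nat.one_le_of_lt i.2))
    rw [neg_one_pow_eq_sgn, ← mul_assoc, ← mul_assoc, ← sgn_add, ← sgn_add]
    congr 2
    have h1 := biSign_graft_left (opHomog_parity hΓ) (X := X) (Y := Y) (i := 0) (j := i) (by omega)
    rw [zero_add, List.drop_zero, hX, hY] at h1
    push_cast at h1 ⊢
    rw [List.take_zero, wt_nil] at h1
    have h2 : (2 : ZMod 2) = 0 := rfl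
    linear_combination h1 + (m + n + i + 2) * h2
  refine (RepForm.sum fun i hi => RepForm.sum (h i hi)).congr fun X Y hX _ => ?_
  rw [Finset.mul_sum]
  refine Finset.sum_congr rfl fun i _ => ?_
  rw [cycSum_apply, hX, cycOrder_eq_of_lt i.2, Finset.mul_sum]

/-- Insertions of the operations `μ_i` into the second block, on words. -/
theorem repForm_right_terms [FiniteDimensional k V] (hΓ : IsAInfinity 𝒱 Γ)
    (hμ : ∀ n, 2 ≤ n → Γ n = suspend 𝒱 (μ n)) {q : ∀ m n : ℕ, Form k V m n}
    (hq : ∀ m n, m + n ≠ 0 → RepForm (q m n) (fun X Y => sgn k (biSign X Y + 1) * F X Y)) :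
    RepForm (∑ i : Fin n with 1 ≤ i.1, ∑ b ∈ Finset.range n,
        (-1 : k) ^ ((i.1 + 1) * m + n) •
          (signedRotRight 𝒱 m n ^ b)
            (insertRight 𝒱 ((i.1 + 1 : ℕ) : ZMod 2) i (q m (n - i)) (μ (i.1 + 1))))
      (fun X Y => sgn k (biSign X Y) * ∑ i : Fin n with 1 ≤ i.1,
        cycSum Homog.parity (fun Y' => sgn k (wt Homog.parity X) *
          F X (graft (opHomog hΓ) 0 (i + 1) Y')) Y) := by
  simp only [← map_smul]
  have h : ∀ i ∈ Finset.univ.filter fun i : Fin n => 1 ≤ i.1, ∀ b ∈ Finset.range n,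
      RepForm ((signedRotRight 𝒱 m n ^ b) ((-1 : k) ^ ((i.1 + 1) * m + n) •
        insertRight 𝒱 ((i.1 + 1 : ℕ) : ZMod 2) i (q m (n - i)) (μ (i.1 + 1)))) _ :=
      fun i hi b _ => by
    refine RepForm.signedRotRight_pow_biSign
      (F := fun X Y => sgn k (wt Homog.parity X) * F X (graft (opHomog hΓ) 0 (i + 1) Y))
      (RepForm.congr (((hq m (n - i) (by omega)).insertRight_unshift
        (repOp_mu_homog hΓ hμ (Finset.mem_filter.1 hi).2) _).smul _) fun X Y hX hY => ?_)
      (Or.inr (Nat.one_le_of_lt i.2))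
    rw [neg_one_pow_eq_sgn]
    simp only [← mul_assoc, ← sgn_add]
    congr 2
    have h1 := biSign_graft_right (opHomog_parity hΓ) (X := X) (Y := Y) (i := 0) (j := i)
      (by omega)
    rw [zero_add, List.drop_zero, hY] at h1
    push_cast at h1 ⊢
    rw [List.take_zero, wt_nil] at h1
    rw [hX]
    have h2 : (2 : ZMod 2) = 0 := rfl
    linear_combination h1 + ((i + 1) * m + n + i * wt Homog.parity X + 1) * h2
  refine (RepForm.sum fun i hi => RepForm.sum (h i hi)).congr fun X Y _ hY => ?_
  rw [Finset.mul_sum]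
  refine Finset.sum_congr rfl fun i _ => ?_
  rw [cycSum_apply, hY, cycOrder_eq_of_lt i.2, Finset.mul_sum]

/-- The differential of a suspended form, on words: these are the insertions of `Γ_1`. -/
theorem repForm_insertDiff (hΓ : IsAInfinity 𝒱 Γ) {d : V →ₗ[k] V}
    (hd : ∀ x : Fin 1 → V, Γ 1 x = d (x 0)) {q : Form k V m n}
    (hq : RepForm q (fun X Y => sgn k (biSign X Y + 1) * F X Y))
    (hl : ∀ X Y : List (Homog (shift 𝒱)), X.length = m → Y.length = n →
      rotWord Homog.parity (fun X' => F X' Y) X = F X Y)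
    (hr : ∀ X Y : List (Homog (shift 𝒱)), X.length = m → Y.length = n →
      rotWord Homog.parity (F X) Y = F X Y) :
    RepForm ((-1 : k) ^ (m + n) • insertDiff 𝒱 (Sum.Lex (· < ·) (· < ·)) d q)
      (fun X Y => sgn k (biSign X Y) *
        ((if m = 0 then 0 else
          cycSum Homog.parity (fun X' => F (graft (opHomog hΓ) 0 (0 + 1) X') Y) X) +
        if n = 0 then 0 else cycSum Homog.parity (fun Y' => sgn k (wt Homog.parity X) *
          F X (graft (opHomog hΓ) 0 (0 + 1) Y')) Y)) := by
  refine ((hq.insertDiff_unshift (opHomog_singleton hΓ hd)).smul _).congr fun X Y hX hY => ?_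
  have h2 : (2 : ZMod 2) = 0 := rfl
  rw [← sum_graft_one (opHomog_parity hΓ) (fun X' hX' => hl X' Y hX' hY) hX,
    ← sum_graft_one (φ := fun Y' => sgn k (wt Homog.parity X) * F X Y') (opHomog_parity hΓ)
      (fun Y' hY' => ?_) hY, neg_one_pow_eq_sgn, mul_add, mul_add]
  · simp only [Finset.mul_sum, ← mul_assoc, ← sgn_add]
    congr 1
    · refine Finset.sum_congr rfl fun s _ => ?_
      congr 2
      have h1 := biSign_graft_left (opHomog_parity hΓ) (X := X) (Y := Y) (i := s) (j := 0)
        (by omega)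
      rw [add_zero, suspSign_length_one (length_drop_take_succ (hX ▸ s.2)), hX, hY] at h1
      push_cast at h1 ⊢
      linear_combination h1 + (m + n + s.1 + 1) * h2
    · refine Finset.sum_congr rfl fun s _ => ?_
      congr 2
      have h1 := biSign_graft_right (opHomog_parity hΓ) (X := X) (Y := Y) (i := s) (j := 0)
        (by omega)
      rw [add_zero, suspSign_length_one (length_drop_take_succ (hY ▸ s.2)), hY] at h1
      rw [hX]
      push_cast at h1 ⊢
      linear_combination h1 + (m + n + s.1 + 1) * h2
  · have := congrFun (rotWord_pow_smul (k := k) (p := Homog.parity)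
      (c := fun _ => sgn k (wt Homog.parity X)) (fun _ _ => rfl) (F X) 1) Y'
    rw [pow_one] at this
    rw [this, hr X Y' hX hY']

variable {r : ℕ} {E : Fin r → Homog (shift 𝒱)} {b : Module.Basis (Fin r) k V}

/-- The trace on `V` of `μ_{m+1+n}` is the suspended trace on `V[1]` of `Γ_{m+1+n}`. -/
theorem repForm_traceSlot_mu [FiniteDimensional k V] (hΓ : IsAInfinity 𝒱 Γ)
    (hμ : ∀ n, 2 ≤ n → Γ n = suspend 𝒱 (μ n)) (hb : ∀ α, b α = (E α).val) (hmn : m + n ≠ 0) :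
    RepForm (traceSlot 𝒱 m n (μ (m + 1 + n))) (fun X Y => sgn k (biSign X Y) *
      wordTrace Homog.parity E (fun α L => b.repr (opVal Γ L) α) X Y) := by
  refine (RepForm.traceSlot_unshift hb (repOp_mu hμ (by omega))).congr fun X Y hX hY => ?_
  rw [wordTrace, Finset.mul_sum]
  refine Finset.sum_congr rfl fun α _ => ?_
  rw [map_smul, Finsupp.smul_apply, smul_eq_mul]
  -- A nonzero diagonal entry forces `|X| + |Y|` to be odd, which is needed to compare the signs.
  by_cases h0 : b.repr (opVal Γ (X ++ E α :: Y)) α = 0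
  · simp [h0]
  have h1 := not_imp_comm.1 (repr_eq_zero_of_degree_ne (α := α) hb (opVal_mem hΓ (by simp))) h0
  have h1 := congrArg (Int.cast (R := ZMod 2)) h1
  rw [Int.cast_add, ← wt_parity_eq_degSum] at h1
  change (E α).parity = _ at h1
  simp only [wt_append, wt_cons, Int.cast_one] at h1
  simp only [← mul_assoc, ← sgn_add]
  congr 2
  simp only [suspSign_append, suspSign_cons, List.length_cons, biSign]
  push_cast
  have h2 : (2 : ZMod 2) = 0 := rfl
  linear_combination (-1 : ZMod 2) * h1 + Y.length * (E α).parity * h2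

/-- The sum of the traces in the equation of `q_{m,n}` is the suspension of `Γ^↻_{m,n}`. -/
theorem repForm_wheel_terms [FiniteDimensional k V] (hΓ : IsAInfinity 𝒱 Γ)
    (hμ : ∀ n, 2 ≤ n → Γ n = suspend 𝒱 (μ n)) (hb : ∀ α, b α = (E α).val) (hmn : m + n ≠ 0) :
    RepForm (∑ a ∈ Finset.range (cycOrder m), ∑ b ∈ Finset.range (cycOrder n),
        (signedRotRight 𝒱 m n ^ b) ((signedRotLeft 𝒱 m n ^ a)
          (traceSlot 𝒱 m n (μ (m + 1 + n)))))
      (fun X Y => sgn k (biSign X Y) *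
        wordWheel Homog.parity E (fun α L => b.repr (opVal Γ L) α) X Y) := by
  have hc : ∀ {a N : ℕ}, a ∈ Finset.range (cycOrder N) → a = 0 ∨ 1 ≤ N := fun {a N} ha => by
    have := Finset.mem_range.1 ha
    rw [cycOrder] at this
    omega
  refine (RepForm.sum fun a ha => RepForm.sum fun c hc' =>
    ((repForm_traceSlot_mu hΓ hμ hb hmn).signedRotLeft_pow_biSign
      (hc ha)).signedRotRight_pow_biSign (F := fun X Y => (rotWord Homog.parity ^ a) (fun X' =>
        wordTrace Homog.parity E (fun α L => b.repr (opVal Γ L) α) X' Y) X) (hc hc')).congr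
      fun X Y hX hY => ?_
  subst hX hY
  simp only [wordWheel, cycSum_apply Homog.parity _ X, cycSum_sum, Finset.mul_sum]
  refine Finset.sum_congr rfl fun a _ => ?_
  rw [cycSum_apply, Finset.mul_sum]

/-- The equation of the operation `q_{m,n}` is the component of `R • Γ + Γ^↻ = 0` at `m, n`, where
`q` is the suspension of `R`. -/
theorem q_equation_iff [FiniteDimensional k V] [CharZero k] (hΓ : IsAInfinity 𝒱 Γ)
    {d : V →ₗ[k] V} (hd : ∀ x : Fin 1 → V, Γ 1 x = d (x 0))
    (hμ : ∀ n, 2 ≤ n → Γ n = suspend 𝒱 (μ n)) {q : ∀ m n : ℕ, Form k V m n} {R : BiForm k V}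
    (hq : ∀ m n, m + n ≠ 0 → q m n = biSuspend 𝒱 m n (R m n))
    (hl : ∀ m n, rotLeft (shift 𝒱) m n (R m n) = R m n)
    (hr : ∀ m n, rotRight (shift 𝒱) m n (R m n) = R m n) (hmn : m + n ≠ 0) :
    (-((-1 : k) ^ (m + n) • insertDiff 𝒱 (Sum.Lex (· < ·) (· < ·)) d (q m n)) =
      (∑ i : Fin m with 1 ≤ i.1, ∑ a ∈ Finset.range m,
        (-1 : k) ^ ((i.1 + 1) + m + n + 1) •
          (signedRotLeft 𝒱 m n ^ a) (insertLeft i (q (m - i) n) (μ (i.1 + 1)))) +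
      (∑ i : Fin n with 1 ≤ i.1, ∑ b ∈ Finset.range n,
        (-1 : k) ^ ((i.1 + 1) * m + n) •
          (signedRotRight 𝒱 m n ^ b)
            (insertRight 𝒱 ((i.1 + 1 : ℕ) : ZMod 2) i (q m (n - i)) (μ (i.1 + 1)))) +
      ∑ a ∈ Finset.range (cycOrder m), ∑ b ∈ Finset.range (cycOrder n),
        (signedRotRight 𝒱 m n ^ b) ((signedRotLeft 𝒱 m n ^ a)
          (traceSlot 𝒱 m n (μ (m + 1 + n))))) ↔
      cycAct 𝒱 1 Γ R m n + wheel 𝒱 Γ m n = 0 := by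
  have hV := shift_isInternal 𝒱 (DirectSum.Decomposition.isInternal 𝒱)
  obtain ⟨r, E, b, hb⟩ := exists_homogeneous_basis (shift 𝒱) hV
  have hR : ∀ m n, m + n ≠ 0 → RepForm (𝒱 := shift 𝒱) (R m n) (formVal R) :=
    fun m n _ => repForm_formVal R m n
  have hqF : ∀ m n, m + n ≠ 0 →
      RepForm (q m n) (fun X Y => sgn k (biSign X Y + 1) * formVal R X Y) := fun m n h => by
    rw [hq m n h]
    exact (hR m n h).biSuspend
  have hl' : ∀ X Y : List (Homog (shift 𝒱)), X.length = m → Y.length = n →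
      rotWord Homog.parity (fun X' => formVal R X' Y) X = formVal R X Y := by
    have h := (hR m n hmn).rotLeft
    rw [hl m n] at h
    exact h.eq_of_length (hR m n hmn)
  have hr' : ∀ X Y : List (Homog (shift 𝒱)), X.length = m → Y.length = n →
      rotWord Homog.parity (formVal R X) Y = formVal R X Y := by
    have h := (hR m n hmn).rotRight
    rw [hr m n] at h
    exact h.eq_of_length (hR m n hmn)
  rw [← sub_eq_zero, sub_eq_add_neg, ← neg_add, neg_eq_zero]
  refine eq_zero_iff_of_sgn (c := biSign) hV (((repForm_insertDiff hΓ hd (hqF m n hmn) hl' hr').add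
    (((repForm_left_terms hΓ hμ hqF).add (repForm_right_terms hΓ hμ hqF)).add
      (repForm_wheel_terms hΓ hμ hb hmn))).congr fun X Y hX hY => ?_)
    ((RepForm.cycAct hΓ hR m n).add (RepForm.wheel hb hmn))
  rw [wordAct, hX, hY,
    ← sum_filter_one_le m fun i =>
      cycSum Homog.parity (fun X' => formVal R (graft (opHomog hΓ) 0 (i + 1) X') Y) X,
    ← sum_filter_one_le n fun i => cycSum Homog.parity (fun Y' => sgn k (wt Homog.parity X) *
      formVal R X (graft (opHomog hΓ) 0 (i + 1) Y')) Y]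
  ring

end Forms

/-! ### Unimodular structures and primitives of `Γ^↻` -/

section Unimodular

variable {k V : Type*} [Field k] [AddCommGroup V] [Module k V] [FiniteDimensional k V]
  {𝒱 : ℤ → Submodule k V} [DirectSum.Decomposition 𝒱] {Γ : Cochain k V}

/-- The cyclic group `C_0` acts trivially. -/
theorem rotLeft_zero (n : ℕ) (q : Form k V 0 n) : rotLeft 𝒱 0 n q = q := by
  -- `q` is extended to a family of forms by zero, in order to speak of its values on words.
  let Q : BiForm k V := fun m' n' => if h : m' = 0 ∧ n' = n then h.1 ▸ h.2 ▸ q else 0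
  have hQ : Q 0 n = q := by simp [Q]
  have h := repForm_formVal (𝒱 := 𝒱) Q 0 n
  rw [hQ] at h
  refine RepForm.ext (DirectSum.Decomposition.isInternal 𝒱) h.rotLeft (h.congr fun X Y hX _ => ?_)
  rw [List.length_eq_zero_iff.1 hX, rotWord_nil]

theorem rotRight_zero (m : ℕ) (q : Form k V m 0) : rotRight 𝒱 m 0 q = q := by
  let Q : BiForm k V := fun m' n' => if h : m' = m ∧ n' = 0 then h.1 ▸ h.2 ▸ q else 0
  have hQ : Q m 0 = q := by simp [Q]
  have h := repForm_formVal (𝒱 := 𝒱) Q m 0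
  rw [hQ] at h
  refine RepForm.ext (DirectSum.Decomposition.isInternal 𝒱) h.rotRight (h.congr fun X Y _ hY => ?_)
  rw [List.length_eq_zero_iff.1 hY, rotWord_nil]

/-- The suspensions of the forms `q_{m,n}` of a unimodular structure. The component at `m = n = 0`,
where `q` is unconstrained, is set to zero. -/
def UnimodularAInfinity.cycForm (U : UnimodularAInfinity 𝒱) : BiForm k V := fun m n =>
  if m + n = 0 then 0 else biSuspend 𝒱 m n (U.q m n)

theorem UnimodularAInfinity.q_eq_biSuspend (U : UnimodularAInfinity 𝒱) {m n : ℕ}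
    (hmn : m + n ≠ 0) : U.q m n = biSuspend 𝒱 m n (U.cycForm m n) := by
  rw [cycForm, if_neg hmn, biSuspend_biSuspend]

theorem UnimodularAInfinity.cycForm_mem (U : UnimodularAInfinity 𝒱) : U.cycForm ∈ Cyc 𝒱 0 := by
  refine ⟨if_pos rfl, fun m n => ?_⟩
  by_cases hmn : m + n = 0
  · rw [cycForm, if_pos hmn]
    exact ⟨fun _ _ _ _ => rfl, map_zero _, map_zero _⟩
  refine ⟨?_, ?_, ?_⟩
  · rw [cycForm, if_neg hmn]
    exact (U.q_degree m n (by omega)).toShift.twist _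
  · rcases Nat.eq_zero_or_pos m with rfl | hm
    · exact rotLeft_zero n _
    · have h := signedRotLeft_biSuspend (𝒱 := 𝒱) (n := n) U.cycForm hm
      rw [← U.q_eq_biSuspend hmn, U.q_left m n hm, U.q_eq_biSuspend hmn] at h
      simpa only [biSuspend_biSuspend] using (congrArg (biSuspend 𝒱 m n) h).symm
  · rcases Nat.eq_zero_or_pos n with rfl | hn
    · exact rotRight_zero m _
    · have h := signedRotRight_biSuspend (𝒱 := 𝒱) (m := m) U.cycForm hn
      rw [← U.q_eq_biSuspend hmn, U.q_right m n hn, U.q_eq_biSuspend hmn] at h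
      simpa only [biSuspend_biSuspend] using (congrArg (biSuspend 𝒱 m n) h).symm

/-- The unimodular structure whose forms `q_{m,n}` are the suspensions of a solution `R` of
`R • Γ + Γ^↻ = 0`. -/
def UnimodularAInfinity.ofPrimitive [CharZero k] (hΓ : IsAInfinity 𝒱 Γ) {R : BiForm k V}
    (hR : R ∈ Cyc 𝒱 0) (h : cycAct 𝒱 1 Γ R + wheel 𝒱 Γ = 0) : UnimodularAInfinity 𝒱 :=
  let d := (MultilinearMap.ofSubsingletonₗ k k V V (0 : Fin 1)).symm (Γ 1)
  have hd : ∀ x : Fin 1 → V, Γ 1 x = d (x 0) := fun x =>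
    congrArg (Γ 1) (funext fun i => by rw [Subsingleton.elim i 0])
  have hμ : ∀ n, 2 ≤ n → Γ n = suspend 𝒱 (suspend 𝒱 (Γ n)) := fun n _ =>
    (suspend_suspend (Γ n)).symm
  { d := d
    μ := fun n => suspend 𝒱 (Γ n)
    q := fun m n => biSuspend 𝒱 m n (R m n)
    d_degree := differential_mem hΓ hd
    d_sq := differential_sq hΓ hd
    μ_degree := fun n hn => (hΓ.degree n (by omega)).suspend
    q_degree := fun m n _ => ((hR.2 m n).1.twist _).ofShift
    q_left := fun m n hm => by rw [signedRotLeft_biSuspend R hm, (hR.2 m n).2.1]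
    q_right := fun m n hn => by rw [signedRotRight_biSuspend R hn, (hR.2 m n).2.2]
    μ_eq := mu_equation hΓ hd hμ
    q_eq := fun m n hmn => (q_equation_iff hΓ hd hμ (fun _ _ _ => rfl) (fun m n => (hR.2 m n).2.1)
      (fun m n => (hR.2 m n).2.2) (by omega)).2 (congrFun (congrFun h m) n) }

theorem UnimodularAInfinity.ofPrimitive_extends [CharZero k] (hΓ : IsAInfinity 𝒱 Γ)
    {R : BiForm k V} (hR : R ∈ Cyc 𝒱 0) (h : cycAct 𝒱 1 Γ R + wheel 𝒱 Γ = 0) :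
    (ofPrimitive hΓ hR h).Extends Γ :=
  ⟨fun x => congrArg (Γ 1) (funext fun i => by rw [Subsingleton.elim i 0]),
    fun n _ => (suspend_suspend (Γ n)).symm⟩

theorem UnimodularAInfinity.cycAct_cycForm [CharZero k] (hΓ : IsAInfinity 𝒱 Γ)
    {U : UnimodularAInfinity 𝒱} (hU : U.Extends Γ) :
    cycAct 𝒱 1 Γ U.cycForm + wheel 𝒱 Γ = 0 := by
  have hR := U.cycForm_mem
  funext m n
  by_cases hmn : m + n = 0
  · obtain ⟨rfl, rfl⟩ : m = 0 ∧ n = 0 := by omega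
    simp [cycAct, wheel]
  · exact (q_equation_iff hΓ hU.1 hU.2 (fun _ _ => U.q_eq_biSuspend) (fun m n => (hR.2 m n).2.1)
      (fun m n => (hR.2 m n).2.2) hmn).1 (U.q_eq m n (by omega))

/-- Primitives of `Γ^↻` and unimodular structures that extend `Γ` determine each other. -/
theorem wheel_mem_coboundaries_iff [CharZero k] (hΓ : IsAInfinity 𝒱 Γ) :
    wheel 𝒱 Γ ∈ coboundaries 𝒱 Γ 1 ↔ ∃ U : UnimodularAInfinity 𝒱, U.Extends Γ := by
  have hdiff : cycDiff 𝒱 Γ (1 - 1) = -cycAct 𝒱 1 Γ := by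
    rw [cycDiff, sub_self, Int.cast_zero, sgn_zero]
    exact neg_one_smul k (cycAct 𝒱 1 Γ)
  rw [coboundaries, hdiff, sub_self]
  constructor
  · rintro ⟨R, hR, h⟩
    have h' : cycAct 𝒱 1 Γ R + wheel 𝒱 Γ = 0 := by
      rw [← h, LinearMap.neg_apply, add_neg_cancel]
    exact ⟨_, UnimodularAInfinity.ofPrimitive_extends hΓ hR h'⟩
  · rintro ⟨U, hU⟩
    exact ⟨U.cycForm, U.cycForm_mem,
      neg_eq_of_add_eq_zero_right (UnimodularAInfinity.cycAct_cycForm hΓ hU)⟩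

end Unimodular

end UnimodAInf

theorem mainTheorem8 {k V : Type*} [Field k] [CharZero k] [AddCommGroup V] [Module k V]
    [FiniteDimensional k V] (𝒱 : ℤ → Submodule k V) [DirectSum.Decomposition 𝒱]
    (Γ : UnimodAInf.Cochain k V) (hΓ : UnimodAInf.IsAInfinity 𝒱 Γ) :
    UnimodAInf.wheel 𝒱 Γ ∈ UnimodAInf.Cyc 𝒱 1 ∧
    UnimodAInf.cycDiff 𝒱 Γ 1 (UnimodAInf.wheel 𝒱 Γ) = 0 ∧
    ∃ h : UnimodAInf.wheel 𝒱 Γ ∈ UnimodAInf.cocycles 𝒱 Γ 1,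
      ((Submodule.Quotient.mk ⟨UnimodAInf.wheel 𝒱 Γ, h⟩ :
          UnimodAInf.CycCohomology 𝒱 Γ 1) = 0 ↔
        ∃ U : UnimodAInf.UnimodularAInfinity 𝒱, U.Extends Γ) := by
  refine ⟨UnimodAInf.wheel_mem_cyc hΓ, UnimodAInf.cycDiff_wheel hΓ,
    ⟨UnimodAInf.wheel_mem_cyc hΓ, LinearMap.mem_ker.2 (UnimodAInf.cycDiff_wheel hΓ)⟩, ?_⟩
  rw [Submodule.Quotient.mk_eq_zero]
  exact UnimodAInf.wheel_mem_coboundaries_iff hΓ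

end
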